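/- Let $\mathfrak g$ be a finite-dimensional complex semisimple Lie algebra with Cartan subalgebra $\mathfrak h$, root system $\Phi$, basis $\Delta$ of $\Phi$, positive roots $\Phi^+$, height function $\mathrm{ht}$ and coroots $h_\alpha$, and choose root vectors $x_\alpha$ ($\alpha\in\Phi$) such that $\{x_\alpha\ (\alpha\in\Phi),\ h_\alpha\ (\alpha\in\Delta)\}$ is a Chevalley basis. Let $\mathcal U$ be the universal enveloping algebra of $\mathfrak g$, $\mathcal U_{\mathbb Z}\subseteq\mathcal U$ the $\mathbb Z$-subalgebra generated by all $x_\alpha^n/n!$ ($\alpha\in\Phi$, $n\ge 0$), and $\mathcal U_{\mathbb Z}^-$ the $\mathbb Z$-subalgebra generated by all $x_{-\alpha}^n/n!$ ($\alpha\in\Phi^+$, $n\ge0$). Fix a prime $p$ and let $\mathcal S\subseteq\mathcal U_{\mathbb Z}$ be the $\mathbb Z$-subalgebra generated by the elements $x_{-\alpha}^n/n!$ and $p^{m\,\mathrm{ht}(\alpha)}x_\alpha^m/m!$ ($\alpha\in\Phi^+$, $n,m\ge 0$). Let $\Gamma_{\rm sc}=\{\mu\in\mathfrak h^*:\mu(h_\alpha)\in\mathbb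 Z\text{ for all }\alpha\in\Phi\}$. Let $\lambda\in\Gamma_{\rm sc}$ be dominant and $r\ge 0$ an integer. For $\mu=\lambda-\sum_{\alpha\in\Delta}c_\alpha\alpha$ with $c_\alpha\in\mathbb Z_{\ge0}$ put $\mathrm{ht}_\lambda(\mu)=\sum_\alpha c_\alpha$. For a $\mathfrak g$-module $M$ with weight spaces $M(\mu)$ and a $\mathbb Z$-submodule $M(\mathbb Z)\subseteq M$ put $M(\mathbb Z,\mu)=M(\mu)\cap M(\mathbb Z)$ and $$M(\mathbb Z,r)=\bigoplus_{\mathrm{ht}_\lambda(\mu)\le r}p^{\,r-\mathrm{ht}_\lambda(\mu)}M(\mathbb Z,\mu)\ \oplus\bigoplus_{\mathrm{ht}_\lambda(\mu)>r}M(\mathbb Z,\mu),$$ where $\mu$ runs over the elements of $\lambda-\sum_{\alpha\in\Delta}\mathbb Z_{\ge0}\,\alpha$. This is applied to * the finite-dimensional irreducible $\mathfrak g$-module $L_\lambda$ of highest weight $\lambda$, with a fixed maximal vector $v_\lambda$ and $L_\lambda(\mathbb Z)=\mathcal U_{\mathbb Z}^-v_\lambda$; * the Verma module $V_\lambda=\mathcal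 U/I_\lambda$, where $I_\lambda$ is the left ideal generated by the $x_\alpha$ ($\alpha\in\Phi^+$) and the $h_\alpha-\lambda(h_\alpha)$ ($\alpha\in\Delta$), with $\mathrm v_\lambda=1+I_\lambda$ and $V_\lambda(\mathbb Z)=\mathcal U_{\mathbb Z}\mathrm v_\lambda$. Let also $U_\lambda=\sum_{\alpha\in\Delta}\mathcal U\,x_{-\alpha}^{\lambda(h_\alpha)+1}\mathrm v_\lambda\subseteq V_\lambda$ and $U_\lambda(\mathbb Z)=U_\lambda\cap V_\lambda(\mathbb Z)$. **Proposition.** Let $r\ge 0$ be an integer, $\mathcal T\subseteq\Delta$, and let $\lambda,\lambda'\in\Gamma_{\rm sc}$ be dominant; put $m_\alpha=\lambda(h_\alpha)$ and $m'_\alpha=\lambda'(h_\alpha)$ for $\alpha\in\Delta$. Suppose that 1. $m_\alpha=m'_\alpha$ for all $\alpha\in\Delta\setminus\mathcal T$; 2. $m_\alpha>r$ and $m'_\alpha>r$ for all $\alpha\in\mathcal T$; 3. $\lambda\equiv\lambda'\pmod{p^{\lceil pr/(p-1)\rceil}\,\Gamma_{\rm sc}}$. Then $L_\lambda(\mathbb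 Z)$ and $L_\lambda(\mathbb Z,r)$, as well as $V_\lambda(\mathbb Z)$ and $U_\lambda(\mathbb Z)+V_\lambda(\mathbb Z,r)$, are stable under $\mathcal S$, likewise for $\lambda'$, and there are isomorphisms of $\mathcal S$-modules $$\frac{L_\lambda(\mathbb Z)}{L_\lambda(\mathbb Z,r)}\cong\frac{L_{\lambda'}(\mathbb Z)}{L_{\lambda'}(\mathbb Z,r)}\qquad\text{and}\qquad\frac{V_\lambda(\mathbb Z)}{U_\lambda(\mathbb Z)+V_\lambda(\mathbb Z,r)}\cong\frac{V_{\lambda'}(\mathbb Z)}{U_{\lambda'}(\mathbb Z)+V_{\lambda'}(\mathbb Z,r)}.$$ -/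

import Mathlib

open scoped Nat Pointwise
open LieAlgebra.IsKilling Module

noncomputable section

namespace Truncation

variable {𝔤 : Type*} [LieRing 𝔤] [LieAlgebra ℂ 𝔤]

/-! ### Lie algebra modules as modules over the enveloping algebra -/

/-- The universal enveloping algebra of `𝔤`. -/
abbrev Env (𝔤 : Type*) [LieRing 𝔤] [LieAlgebra ℂ 𝔤] := UniversalEnvelopingAlgebra ℂ 𝔤

/-- The canonical map from `𝔤` to its universal enveloping algebra. -/
abbrev toEnv (y : 𝔤) : Env 𝔤 := UniversalEnvelopingAlgebra.ι ℂ y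

/-- The divided power `y ^ n / n!` in the enveloping algebra. -/
def divPow (y : 𝔤) (n : ℕ) : Env 𝔤 := ((n ! : ℂ)⁻¹) • toEnv y ^ n

/-- The complex vector space underlying a representation `L` of `𝔤`, regarded as a module over the
universal enveloping algebra of `𝔤` through the extension of the representation. -/
@[nolint unusedArguments]
def EnvModule (𝔤 : Type*) [LieRing 𝔤] [LieAlgebra ℂ 𝔤] (L : Type*) := L

section EnvModule

variable (L : Type*) [AddCommGroup L] [Module ℂ L] [LieRingModule 𝔤 L] [LieModule ℂ 𝔤 L]

instance : AddCommGroup (EnvModule 𝔤 L) := inferInstanceAs (AddCommGroup L)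

instance : Module ℂ (EnvModule 𝔤 L) := inferInstanceAs (Module ℂ L)

instance : Module (Env 𝔤) (EnvModule 𝔤 L) :=
  Module.compHom (EnvModule 𝔤 L) (R := Module.End ℂ (EnvModule 𝔤 L))
    (UniversalEnvelopingAlgebra.lift ℂ (LieModule.toEnd ℂ 𝔤 L)).toRingHom

variable (𝔤) {L} in
/-- The identity map from `L` to its copy on which the enveloping algebra acts. -/
def EnvModule.of : L ≃ₗ[ℂ] EnvModule 𝔤 L := LinearEquiv.refl ℂ L

theorem EnvModule.smul_def (u : Env 𝔤) (w : L) :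
    u • EnvModule.of 𝔤 w =
      EnvModule.of 𝔤 (UniversalEnvelopingAlgebra.lift ℂ (LieModule.toEnd ℂ 𝔤 L) u w) :=
  rfl

theorem EnvModule.toEnv_smul (y : 𝔤) (w : L) :
    toEnv y • EnvModule.of 𝔤 w = EnvModule.of 𝔤 ⁅y, w⁆ := by
  rw [EnvModule.smul_def, toEnv, UniversalEnvelopingAlgebra.lift_ι_apply]
  rfl

instance : IsScalarTower ℂ (Env 𝔤) (EnvModule 𝔤 L) where
  smul_assoc z u w := by
    obtain ⟨w, rfl⟩ := (EnvModule.of 𝔤).surjective w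
    rw [EnvModule.smul_def, EnvModule.smul_def, map_smul]
    rfl

end EnvModule

/-! ### Subquotients as modules over a subalgebra -/

section Subquotients

variable {M M' : Type*} [AddCommGroup M] [Module (Env 𝔤) M] [AddCommGroup M'] [Module (Env 𝔤) M']

/-- The `ℤ`-submodule `N` is stable under the subalgebra `A`. -/
def IsStable (A : Subalgebra ℤ (Env 𝔤)) (N : Submodule ℤ M) : Prop :=
  ∀ u ∈ A, ∀ w ∈ N, u • w ∈ N

/-- A stable `ℤ`-submodule as an `A`-submodule. -/
def IsStable.toSubmodule {A : Subalgebra ℤ (Env 𝔤)} {N : Submodule ℤ M} (h : IsStable A N) :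
    Submodule A M where
  carrier := N
  zero_mem' := N.zero_mem
  add_mem' := N.add_mem
  smul_mem' := fun u _ hw => h u.1 u.2 _ hw

/-- The `A`-module `N / (N ∩ K)`, for `A`-stable `N` and `K` (this is `N / K` if `K ≤ N`). -/
abbrev Subquotient {A : Subalgebra ℤ (Env 𝔤)} {N K : Submodule ℤ M} (hN : IsStable A N)
    (hK : IsStable A K) : Type _ :=
  hN.toSubmodule ⧸ hK.toSubmodule.submoduleOf hN.toSubmodule

/-- `N / K` and `N' / K'` are `A`-modules (that is, `K ≤ N`, `K' ≤ N'` and all four submodules are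
stable under `A`), and they are isomorphic as `A`-modules. -/
def QuotientsIsomorphic (A : Subalgebra ℤ (Env 𝔤)) (N K : Submodule ℤ M)
    (N' K' : Submodule ℤ M') : Prop :=
  K ≤ N ∧ K' ≤ N' ∧
    ∃ (hN : IsStable A N) (hK : IsStable A K) (hN' : IsStable A N') (hK' : IsStable A K'),
      Nonempty (Subquotient hN hK ≃ₗ[A] Subquotient hN' hK')

end Subquotients

/-! ### Roots, weights and Chevalley bases -/

variable [FiniteDimensional ℂ 𝔤] [LieAlgebra.IsSemisimple ℂ 𝔤]
variable {H : LieSubalgebra ℂ 𝔤} [H.IsCartanSubalgebra]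

/-- The root `-α`. -/
def negRoot (α : H.root) : H.root := ⟨-α.1, by
  have h := α.2
  simp only [LieSubalgebra.root, Finset.mem_filter_univ] at h ⊢
  exact LieModule.Weight.IsNonZero.neg h⟩

/-- A family of root vectors `x α` that belongs to a Chevalley basis
`{x α, h_γ | α a root, γ a simple root}` of `𝔤`, where `h_γ` is the coroot of `γ`: one has
`[x_α, x_{-α}] = h_α`, and if `α`, `β`, `α + β` are roots and `[x_α, x_β] = c x_{α+β}`, then
`[x_{-α}, x_{-β}] = -c x_{-α-β}`. -/
structure IsChevalleyBasis (x : H.root → 𝔤) : Prop where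
  mem_rootSpace : ∀ α : H.root, x α ∈ LieAlgebra.rootSpace H α.1
  lie_neg : ∀ α : H.root, ⁅x α, x (negRoot α)⁆ = (coroot α.1 : 𝔤)
  lie_add : ∀ α β γ : H.root, γ.1.toLinear = α.1.toLinear + β.1.toLinear →
    ∃ c : ℂ, ⁅x α, x β⁆ = c • x γ ∧
      ⁅x (negRoot α), x (negRoot β)⁆ = -c • x (negRoot γ)

variable (H) in
/-- The weight lattice `Γ_sc`: all functionals on the Cartan subalgebra with integral values on all
coroots. -/
def weightLattice : AddSubgroup (Dual ℂ H) where
  carrier := {μ | ∀ α : H.root, ∃ n : ℤ, μ (coroot α.1) = n}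
  zero_mem' := fun _ => ⟨0, by simp⟩
  add_mem' := by
    intro μ ν hμ hν α
    obtain ⟨m, hm⟩ := hμ α
    obtain ⟨n, hn⟩ := hν α
    exact ⟨m + n, by simp [hm, hn]⟩
  neg_mem' := by
    intro μ hμ α
    obtain ⟨m, hm⟩ := hμ α
    exact ⟨-m, by simp [hm]⟩

variable (b : (rootSystem H).Base) (x : H.root → 𝔤)

/-! ### The Kostant form and its subalgebras -/

/-- The Kostant `ℤ`-form `U_ℤ` of the enveloping algebra. -/
def kostantForm : Subalgebra ℤ (Env 𝔤) :=
  Algebra.adjoin ℤ {u | ∃ (α : H.root) (n : ℕ), u = divPow (x α) n}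

/-- The Kostant `ℤ`-form `U_ℤ⁻` of the enveloping algebra of the sum of the negative root spaces. -/
def kostantFormNeg : Subalgebra ℤ (Env 𝔤) :=
  Algebra.adjoin ℤ {u | ∃ (α : H.root) (n : ℕ), b.IsPos α ∧ u = divPow (x (negRoot α)) n}

/-- The Iwahori-type `ℤ`-subalgebra of the Kostant form, generated by all `x_{-α} ^ n / n!` and all
`p ^ (m ht α) x_α ^ m / m!` with `α` a positive root. -/
def iwahoriAlgebra (p : ℕ) : Subalgebra ℤ (Env 𝔤) :=
  Algebra.adjoin ℤ
    ({u | ∃ (α : H.root) (n : ℕ), b.IsPos α ∧ u = divPow (x (negRoot α)) n} ∪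
      {u | ∃ (α : H.root) (m : ℕ), b.IsPos α ∧
        u = ((p : ℤ) ^ (m * (b.height α).toNat)) • divPow (x α) m})

/-! ### Weight spaces, lattices and truncating submodules -/

section Modules

variable {M : Type*} [AddCommGroup M] [Module ℂ M] [Module (Env 𝔤) M] [IsScalarTower ℂ (Env 𝔤) M]

variable (M) in
/-- The subspace of weight `μ` of an `𝔤`-module. -/
def weightSpace (μ : Dual ℂ H) : Submodule ℂ M where
  carrier := {w | ∀ h : H, toEnv (h : 𝔤) • w = μ h • w}
  zero_mem' := fun h => by simp
  add_mem' := by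
    intro v w hv hw h
    rw [smul_add, smul_add, hv h, hw h]
  smul_mem' := by
    intro c w hw h
    have e : ∀ (u : Env 𝔤), u • c • w = c • u • w := fun u => by
      rw [← algebraMap_smul (Env 𝔤) c w, ← algebraMap_smul (Env 𝔤) c (u • w), smul_smul, smul_smul,
        Algebra.commutes]
    rw [e, hw h, smul_comm]

/-- `v` is a maximal vector of weight `lam`. -/
structure IsMaximalVector (lam : Dual ℂ H) (v : M) : Prop where
  ne_zero : v ≠ 0
  mem_weightSpace : v ∈ weightSpace M lam
  smul_eq_zero : ∀ α : H.root, b.IsPos α →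
    ∀ e ∈ LieAlgebra.rootSpace H α.1, toEnv e • v = 0

/-- For a `ℤ`-subalgebra `A` of the enveloping algebra, the `ℤ`-submodule `A v = {u • v | u ∈ A}`. -/
def orbit (A : Subalgebra ℤ (Env 𝔤)) (v : M) : Submodule ℤ M where
  carrier := {w | ∃ u ∈ A, w = u • v}
  zero_mem' := ⟨0, A.zero_mem, by simp⟩
  add_mem' := by
    rintro _ _ ⟨u, hu, rfl⟩ ⟨u', hu', rfl⟩
    exact ⟨u + u', A.add_mem hu hu', (add_smul u u' v).symm⟩
  smul_mem' := by
    rintro c _ ⟨u, hu, rfl⟩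
    exact ⟨c • u, A.smul_mem hu c, (smul_assoc c u v).symm⟩

/-- For a lattice `N` in a module of highest weight `lam`, the `ℤ`-submodule
`⊕_μ p ^ max (r - ht_lam μ, 0) N(μ)`, where `N(μ)` is the weight `μ` subspace of `N` and `μ` runs
over the weights `lam - ∑ c_α α` (`α` simple, `c_α ∈ ℕ`), which have relative height
`ht_lam μ = ∑ c_α`. The subtraction in the exponent is that of natural numbers. -/
def truncating (p r : ℕ) (lam : Dual ℂ H) (N : Submodule ℤ M) : Submodule ℤ M :=
  ⨆ c : b.support → ℕ, ((p : ℤ) ^ (r - ∑ α, c α)) •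
    (N ⊓ (weightSpace M (lam - ∑ α, c α • (rootSystem H).root α)).restrictScalars ℤ)

end Modules

/-! ### The lattice in an irreducible representation -/

/-- The lattice `L(ℤ) = U_ℤ⁻ v` in a representation `L` with maximal vector `v`. -/
def irrLattice {L : Type*} [AddCommGroup L] [Module ℂ L] [LieRingModule 𝔤 L] [LieModule ℂ 𝔤 L]
    (v : L) : Submodule ℤ (EnvModule 𝔤 L) :=
  orbit (kostantFormNeg b x) (EnvModule.of 𝔤 v)

/-! ### Verma modules -/

/-- The left ideal `I_lam` generated by the positive root vectors `x_α` and the elements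
`h_γ - lam(h_γ)` with `γ` simple. -/
def vermaIdeal (lam : Dual ℂ H) : Submodule (Env 𝔤) (Env 𝔤) :=
  Submodule.span (Env 𝔤)
    ({u | ∃ α : H.root, b.IsPos α ∧ u = toEnv (x α)} ∪
      {u | ∃ γ ∈ b.support, u = toEnv (coroot γ.1 : 𝔤) -
        algebraMap ℂ (Env 𝔤) (lam (coroot γ.1))})

/-- The Verma module `V_lam` of highest weight `lam`. -/
abbrev Verma (lam : Dual ℂ H) : Type _ := Env 𝔤 ⧸ vermaIdeal b x lam

/-- The canonical generator of the Verma module. -/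
def vermaVector (lam : Dual ℂ H) : Verma b x lam := (vermaIdeal b x lam).mkQ 1

/-- The integral Verma module `V_lam(ℤ)`. -/
def vermaLattice (lam : Dual ℂ H) : Submodule ℤ (Verma b x lam) :=
  orbit (kostantForm x) (vermaVector b x lam)

/-- The submodule `U_lam` of the Verma module generated by the elements
`x_{-γ} ^ (m_γ + 1) v_lam` with `γ` simple and `m_γ = lam(h_γ)`, for `lam` integral dominant. -/
def vermaKernel (lam : Dual ℂ H) : Submodule (Env 𝔤) (Verma b x lam) :=
  Submodule.span (Env 𝔤)
    {w | ∃ γ ∈ b.support, ∃ m : ℕ, lam (coroot γ.1) = m ∧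
      w = toEnv (x (negRoot γ)) ^ (m + 1) • vermaVector b x lam}

/-- The lattice `U_lam(ℤ) = U_lam ∩ V_lam(ℤ)`. -/
def vermaKernelLattice (lam : Dual ℂ H) : Submodule ℤ (Verma b x lam) :=
  (vermaKernel b x lam).restrictScalars ℤ ⊓ vermaLattice b x lam

end Truncation

end

noncomputable section

set_option linter.unusedSectionVars false

namespace Truncation

variable {𝔤 : Type*} [LieRing 𝔤] [LieAlgebra ℂ 𝔤] [FiniteDimensional ℂ 𝔤]
  [LieAlgebra.IsSemisimple ℂ 𝔤] {H : LieSubalgebra ℂ 𝔤} [H.IsCartanSubalgebra]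

/-! ### Root vectors -/

/-! Everything takes place in the Verma modules, where only the action of the positive root vectors
depends on the highest weight. The annihilator of the generator in the algebra of the negative
simple root vectors is the same for `lam` and `lam'` (`IsChevalleyBasis.smul_vermaVector_eq_zero`).
So `u • v_lam ↦ u • v_lam'` is a well-defined bijection `f` of Verma modules. The integral Verma
module is the orbit of the generator under the negative simple divided powers alone (Kostant:
`IsChevalleyBasis.divPow_smul_mem_orbit`), so `f` matches the lattices, and it preserves relative
heights. It remains to see that `f` commutes with the Iwahori algebra modulo the truncating
submodule, and that it matches the truncating submodules.

Commutation with negative divided powers is exact. If `lam ≡ lam'` modulo `k`, then `f` commutes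
with the Chevalley lattice of `𝔤` modulo `k` times the lattice: this is clear on the generator, and
moving `y` past a divided power replaces `y` by other elements of the Chevalley lattice
(`IsChevalleyBasis.dadLie_mem`, `IsComparison.map_toEnv_smul_sub_mem`). For `m ≤ r`, passing from
`x_α ^ m` to `x_α ^ m / m!` costs `v_p(m!) ≤ r / (p - 1)` factors `p`. A congruence modulo `p ^
⌈pr/(p-1)⌉` therefore leaves `p ^ r`, and `p ^ r` times the lattice is truncated away. For `m > r`
the factor `p ^ (m ht α)` already suffices.

The generator of `U_lam` at a simple root `γ` is sent to the corresponding generator if `m_γ =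
m'_γ`; if `γ ∈ T`, it is sent to height `m_γ + 1 > r`, where the truncating submodule is the whole
lattice (`IsComparison.map_mem_sup_weightSum`).

Finally `U_lam` is the kernel of the map from the Verma module to `L`
(`IsChevalleyBasis.ker_vermaHom`, by the Casimir element), so the truncation of `L` is the
truncation of the Verma module by `U_lam`.

The equality of annihilators takes the place of the PBW theorem. Tensoring with a module that has a
nonzero highest weight vector of weight `μ` transports relations from `lam + μ` to `lam`. The
representation itself and a module containing a formal inverse of its maximal vector supply the
weights `μ` that are needed. -/

@[simp] theorem coe_negRoot (α : H.root) : (negRoot α).1 = -α.1 := rfl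

@[simp] theorem negRoot_negRoot (α : H.root) : negRoot (negRoot α) = α :=
  Subtype.ext (neg_neg α.1)

theorem root_negRoot (α : H.root) :
    (rootSystem H).root (negRoot α) = -(rootSystem H).root α := by
  ext h; simp

theorem negRoot_eq_reflectionPerm (α : H.root) :
    negRoot α = (rootSystem H).reflectionPerm α α := by
  apply (rootSystem H).root.injective
  rw [root_negRoot, RootPairing.root_reflectionPerm, RootPairing.reflection_apply_self]

theorem root_apply_coroot_self (α : H.root) : (rootSystem H).root α (coroot α.1) = 2 := by
  simpa using root_apply_coroot (LieSubalgebra.isNonZero_coe_root α)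

section

variable {x : H.root → 𝔤} (hx : IsChevalleyBasis x)
include hx

theorem IsChevalleyBasis.lie_coe (α : H.root) (h : H) :
    ⁅(h : 𝔤), x α⁆ = (rootSystem H).root α h • x α :=
  lie_eq_smul_of_mem_rootSpace (hx.mem_rootSpace α) h

theorem IsChevalleyBasis.isSl2Triple (α : H.root) :
    IsSl2Triple (coroot α.1 : 𝔤) (x α) (x (negRoot α)) where
  h_ne_zero := by
    intro h
    have h2 := root_apply_coroot_self α
    rw [show coroot α.1 = 0 from Subtype.ext h] at h2
    simp at h2
  lie_e_f := hx.lie_neg α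
  lie_h_e_nsmul := by
    rw [hx.lie_coe, root_apply_coroot_self, ofNat_smul_eq_nsmul]
  lie_h_f_nsmul := by
    rw [hx.lie_coe, root_negRoot, LinearMap.neg_apply, root_apply_coroot_self, neg_smul,
      ofNat_smul_eq_nsmul]

theorem IsChevalleyBasis.ne_zero (α : H.root) : x α ≠ 0 := (hx.isSl2Triple α).e_ne_zero

theorem IsChevalleyBasis.exists_eq_smul (α : H.root) {y : 𝔤}
    (hy : ∀ h : H, ⁅(h : 𝔤), y⁆ = (rootSystem H).root α h • y) : ∃ c : ℂ, y = c • x α := by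
  have hy' : y ∈ LieAlgebra.rootSpace H α.1 :=
    (LieModule.mem_genWeightSpace _ _ _).mpr fun h => ⟨1, by
      simpa [sub_eq_zero] using hy h⟩
  obtain ⟨c, hc⟩ := (finrank_eq_one_iff_of_nonzero' (⟨x α, hx.mem_rootSpace α⟩ :
    LieAlgebra.rootSpace H α.1) (by simpa using hx.ne_zero α)).mp
    (finrank_rootSpace_eq_one α.1 (LieSubalgebra.isNonZero_coe_root α)) ⟨y, hy'⟩
  exact ⟨c, by simpa using congrArg Subtype.val hc.symm⟩

omit hx in
theorem lie_lie_coe {y z : 𝔤} {μ ν : Dual ℂ H} (hy : ∀ h : H, ⁅(h : 𝔤), y⁆ = μ h • y)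
    (hz : ∀ h : H, ⁅(h : 𝔤), z⁆ = ν h • z) (h : H) : ⁅(h : 𝔤), ⁅y, z⁆⁆ = (μ + ν) h • ⁅y, z⁆ := by
  rw [leibniz_lie, hy, hz, smul_lie, lie_smul, ← add_smul, LinearMap.add_apply]

omit hx in
theorem eq_zero_of_lie_coe {y : 𝔤} {μ : Dual ℂ H} (hy : ∀ h : H, ⁅(h : 𝔤), y⁆ = μ h • y)
    (h0 : μ ≠ 0) (hμ : μ ∉ Set.range (rootSystem H).root) : y = 0 := by
  by_contra hne
  have hy' : y ∈ LieAlgebra.rootSpace H (μ : H → ℂ) :=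
    (LieModule.mem_genWeightSpace _ _ _).mpr fun h => ⟨1, by
      simpa [sub_eq_zero] using hy h⟩
  let W : LieModule.Weight ℂ H 𝔤 := ⟨μ, fun hb => hne (by
    rw [LieAlgebra.rootSpace, hb] at hy'; simpa using hy')⟩
  have hW : W.IsNonZero := fun h => h0 (by
    ext h'; exact congrFun h h')
  exact hμ ⟨⟨W, by simpa using hW⟩, by ext h; rfl⟩

theorem IsChevalleyBasis.lie_eq_zero {α β : H.root}
    (h0 : (rootSystem H).root α + (rootSystem H).root β ≠ 0)
    (hμ : (rootSystem H).root α + (rootSystem H).root β ∉ Set.range (rootSystem H).root) :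
    ⁅x α, x β⁆ = 0 :=
  eq_zero_of_lie_coe (lie_lie_coe (hx.lie_coe α) (hx.lie_coe β)) h0 hμ

/-! ### Root lengths through the Killing form. -/

/-- The value of the Killing form on a pair of opposite root vectors. -/
def killingNorm (x : H.root → 𝔤) (α : H.root) : ℂ := killingForm ℂ 𝔤 (x α) (x (negRoot α))

theorem IsChevalleyBasis.coroot_eq (α : H.root) :
    coroot α.1 = killingNorm x α • (cartanEquivDual H).symm ((rootSystem H).root α) := by
  have h := lie_eq_killingForm_smul_of_mem_rootSpace_of_mem_rootSpace_neg
    (hx.mem_rootSpace α) (hx.mem_rootSpace (negRoot α))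
  rw [hx.lie_neg] at h
  exact Subtype.ext h

theorem IsChevalleyBasis.killingNorm_ne_zero (α : H.root) : killingNorm x α ≠ 0 := by
  intro h
  have h2 := root_apply_coroot_self α
  rw [hx.coroot_eq, h, zero_smul, map_zero] at h2
  exact two_ne_zero h2.symm

/-- Evaluating the root on both sides shows that the inverse of `killingNorm x α` is half the
squared length of `α` for the form dual to the Killing form. All comparisons of root lengths below
are stated with these inverses. -/
theorem IsChevalleyBasis.inv_smul_coroot (α : H.root) :
    (killingNorm x α)⁻¹ • coroot α.1 =
      (cartanEquivDual H).symm ((rootSystem H).root α) := by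
  rw [hx.coroot_eq, smul_smul, inv_mul_cancel₀ (hx.killingNorm_ne_zero α), one_smul]

omit hx in
theorem apply_cartanEquivDual_symm (μ ν : Dual ℂ H) :
    μ ((cartanEquivDual H).symm ν) = killingForm ℂ 𝔤 ((cartanEquivDual H).symm μ : H)
      ((cartanEquivDual H).symm ν : H) := by
  conv_lhs => rw [← (cartanEquivDual H).apply_symm_apply μ]
  rfl

omit hx in
theorem apply_cartanEquivDual_symm_comm (μ ν : Dual ℂ H) :
    μ ((cartanEquivDual H).symm ν) = ν ((cartanEquivDual H).symm μ) := by
  rw [apply_cartanEquivDual_symm, apply_cartanEquivDual_symm, LieModule.traceForm_comm]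

theorem IsChevalleyBasis.pairing_swap (α β : H.root) :
    (killingNorm x β)⁻¹ * (rootSystem H).root α (coroot β.1) =
      (killingNorm x α)⁻¹ * (rootSystem H).root β (coroot α.1) := by
  simpa only [← hx.inv_smul_coroot, map_smul, smul_eq_mul] using
    apply_cartanEquivDual_symm_comm ((rootSystem H).root α) ((rootSystem H).root β)

omit hx in
theorem root_apply_coroot_eq (α β : H.root) :
    (rootSystem H).root α (coroot β.1) = (rootSystem H).pairingIn ℤ α β := by
  have := (rootSystem H).algebraMap_pairingIn ℤ α β
  simp only [algebraMap_int_eq, eq_intCast] at this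
  rw [this]
  rfl

/-- This is `|α + β|² / 2 = |β|² / 2 + (α, β) + |α|² / 2`, with `(α, β)` expressed by the Cartan
integer and the length of `α`. -/
theorem IsChevalleyBasis.inv_killingNorm_add {i j k : H.root}
    (hk : (rootSystem H).root k = (rootSystem H).root j + (rootSystem H).root i) :
    (killingNorm x k)⁻¹ = (killingNorm x j)⁻¹ +
      ((rootSystem H).pairingIn ℤ j i + 1) * (killingNorm x i)⁻¹ := by
  have h1 : (killingNorm x k)⁻¹ • coroot k.1 =
      (killingNorm x j)⁻¹ • coroot j.1 + (killingNorm x i)⁻¹ • coroot i.1 := by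
    rw [hx.inv_smul_coroot, hx.inv_smul_coroot, hx.inv_smul_coroot, hk, map_add]
  have h2 := congrArg ((rootSystem H).root k) h1
  rw [map_add, map_smul, map_smul, map_smul, root_apply_coroot_self, hk, LinearMap.add_apply,
    LinearMap.add_apply, root_apply_coroot_self, root_apply_coroot_self] at h2
  have h3 := hx.pairing_swap i j
  rw [root_apply_coroot_eq] at h2 h3
  rw [root_apply_coroot_eq] at h2 h3
  simp only [smul_eq_mul] at h2
  linear_combination h2 / 2 + h3 / 2

omit hx in
-- The numerical content of `q |α + β|² = (r + 1) |β|²` for the `α`-string through `β`, with `d`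
-- standing for half squared lengths, `a` and `b` for the Cartan integers of `β` and `α`, and `b'`
-- for the one of `α` against `α + β`. A string has at most four roots, so finitely many `(q, r)`
-- remain; in each, the list of possible pairs of Cartan integers fixes what is still needed.
theorem chain_length_relation {q r : ℕ} {a b b' : ℤ} {di dj dk : ℂ} (ha : (r : ℤ) - q = a)
    (hqr : r + q ≤ 3) (hq : 1 ≤ q)
    (h₁ : (a, b) ∈ ({(0, 0), (1, 1), (-1, -1), (1, 2), (2, 1), (-1, -2), (-2, -1), (1, 3), (3, 1),
      (-1, -3), (-3, -1)} : Set (ℤ × ℤ)))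
    (h₂ : (a + 2, b') ∈ ({(0, 0), (1, 1), (-1, -1), (1, 2), (2, 1), (-1, -2), (-2, -1), (1, 3),
      (3, 1), (-1, -3), (-3, -1)} : Set (ℤ × ℤ)))
    (hk : dk = dj + (a + 1) * di) (hj : di * a = dj * b) (hk' : di * (a + 2) = dk * b') :
    q * dk = (r + 1) * dj := by
  subst ha
  simp only [Set.mem_insert_iff, Set.mem_singleton_iff, Prod.mk.injEq] at h₁ h₂
  have hq3 : q ≤ 3 := by lia
  interval_cases q
  · have hr : r ≤ 2 := by lia
    interval_cases r
    · norm_num at hk ⊢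
      exact hk
    · obtain rfl : b' = 1 := by lia
      push_cast at *
      linear_combination 2 * hk + hk'
    · obtain rfl : b' = 1 := by lia
      push_cast at *
      linear_combination 3 * hk + 2 * hk'
  · have hr : r ≤ 1 := by lia
    interval_cases r
    · obtain rfl : b = -1 := by lia
      push_cast at *
      linear_combination 2 * hk + hj
    · push_cast at *
      linear_combination 2 * hk
  · obtain rfl : r = 0 := by lia
    obtain rfl : b = -1 := by lia
    push_cast at *
    linear_combination 3 * hk + hj * 2

omit hx in
theorem ne_of_linearIndependent {i j : H.root}
    (h : LinearIndependent ℂ ![(rootSystem H).root i, (rootSystem H).root j]) :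
    (rootSystem H).root j ≠ (rootSystem H).root i ∧
      (rootSystem H).root j ≠ -(rootSystem H).root i := by
  rw [LinearIndependent.pair_iff] at h
  constructor
  · intro he
    simpa using h 1 (-1) (by rw [he]; simp)
  · intro he
    simpa using h 1 1 (by rw [he]; simp)

omit hx in
theorem linearIndependent_add {i j k : H.root}
    (h : LinearIndependent ℂ ![(rootSystem H).root i, (rootSystem H).root j])
    (hk : (rootSystem H).root k = (rootSystem H).root j + (rootSystem H).root i) :
    LinearIndependent ℂ ![(rootSystem H).root i, (rootSystem H).root k] := by
  rw [LinearIndependent.pair_iff] at h ⊢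
  intro s t hst
  obtain ⟨h1, h2⟩ := h (s + t) t (by rw [← hst, hk]; module)
  exact ⟨by linear_combination h1 - h2, h2⟩

/-- The relation between the lengths of `β` and `α + β` and the position of `β` in its `α`-chain. -/
theorem IsChevalleyBasis.chainTopCoeff_mul {i j k : H.root}
    (h : LinearIndependent ℂ ![(rootSystem H).root i, (rootSystem H).root j])
    (hk : (rootSystem H).root k = (rootSystem H).root j + (rootSystem H).root i) :
    ((rootSystem H).chainTopCoeff i j : ℂ) * (killingNorm x k)⁻¹ =
      ((rootSystem H).chainBotCoeff i j + 1) * (killingNorm x j)⁻¹ := by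
  have hki' : (rootSystem H).pairingIn ℤ k i = (rootSystem H).pairingIn ℤ j i + 2 := by
    have := congrArg (fun f => f (coroot i.1)) hk
    simp only [LinearMap.add_apply, root_apply_coroot_self, root_apply_coroot_eq] at this
    exact_mod_cast this
  have hsw := hx.pairing_swap j i
  have hsw' := hx.pairing_swap k i
  rw [root_apply_coroot_eq, root_apply_coroot_eq] at hsw hsw'
  have hj := ne_of_linearIndependent h
  have hk₂ := ne_of_linearIndependent (linearIndependent_add h hk)
  have t1 := (rootSystem H).pairingIn_pairingIn_mem_set_of_isCrystal_of_isRed' _ _ hj.1 hj.2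
  have t2 := (rootSystem H).pairingIn_pairingIn_mem_set_of_isCrystal_of_isRed' _ _ hk₂.1 hk₂.2
  rw [hki'] at t2 hsw'
  exact chain_length_relation (RootPairing.chainBotCoeff_sub_chainTopCoeff h)
    RootPairing.chainBotCoeff_add_chainTopCoeff_le_three
    (RootPairing.one_le_chainTopCoeff_of_root_add_mem (by rw [add_comm, ← hk]; exact ⟨k, rfl⟩))
    t1 t2 (hx.inv_killingNorm_add hk) hsw (by rw [← hsw']; push_cast; ring)

theorem IsChevalleyBasis.lie_pow_coe (α : H.root) {y : 𝔤} {μ : Dual ℂ H}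
    (hy : ∀ h : H, ⁅(h : 𝔤), y⁆ = μ h • y) (n : ℕ) (h : H) :
    ⁅(h : 𝔤), (LieAlgebra.ad ℂ 𝔤 (x α) ^ n) y⁆ =
      (μ + n • (rootSystem H).root α) h • (LieAlgebra.ad ℂ 𝔤 (x α) ^ n) y := by
  induction n generalizing h with
  | zero => simpa using hy h
  | succ n ih =>
    rw [pow_succ', Module.End.mul_apply, LieAlgebra.ad_apply, lie_lie_coe (hx.lie_coe α) ih,
      succ_nsmul]
    congr 2
    abel

/-! ### Structure constants of a Chevalley basis. -/

/-- The action of `[x_{-α}, [x_α, ·]]` on a root vector. -/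
theorem IsChevalleyBasis.lie_lie_self {i j : H.root}
    (h : LinearIndependent ℂ ![(rootSystem H).root i, (rootSystem H).root j]) :
    ⁅x (negRoot i), ⁅x i, x j⁆⁆ = (((rootSystem H).chainTopCoeff i j : ℂ) *
      ((rootSystem H).chainBotCoeff i j + 1)) • x j := by
  set q := (rootSystem H).chainTopCoeff i j with hq
  set t := (rootSystem H).chainTopIdx i j with ht
  have htop : (rootSystem H).root t = (rootSystem H).root j + q • (rootSystem H).root i :=
    RootPairing.root_chainTopIdx
  -- The top `t` of the `i`-string through `j` gives a primitive vector for the `sl₂` of `i`.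
  -- Applying the lowering operator `q` times leads to a nonzero multiple of `x j`, where the
  -- coefficient is known from `sl₂` theory.
  have P : (hx.isSl2Triple i).HasPrimitiveVectorWith (x t)
      (((rootSystem H).chainBotCoeff i j + q : ℕ) : ℂ) :=
    { ne_zero := hx.ne_zero t
      lie_h := by
        rw [hx.lie_coe, root_apply_coroot_eq,
          ← RootPairing.chainBotCoeff_add_chainTopCoeff_eq_pairingIn_chainTopIdx h]
        push_cast
        rfl
      lie_e := by
        refine hx.lie_eq_zero ?_ ?_
        · rw [htop]
          intro h0
          rw [LinearIndependent.pair_iff] at h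
          simpa using (h (q + 1) 1 (by rw [← h0, ← Nat.cast_smul_eq_nsmul ℂ]; module)).2
        · rw [htop]
          intro hm
          have := ((rootSystem H).root_add_nsmul_mem_range_iff_le_chainTopCoeff h
            (n := q + 1)).mp (by convert hm using 1; module)
          lia }
  have hne := P.pow_toEnd_f_ne_zero_of_eq_nat rfl (i := q) (by lia)
  obtain ⟨c, hc⟩ := hx.exists_eq_smul j (y := (LieAlgebra.ad ℂ 𝔤 (x (negRoot i)) ^ q) (x t))
    (fun h' => by
      rw [hx.lie_pow_coe (negRoot i) (hx.lie_coe t), htop, root_negRoot]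
      congr 2
      module)
  have hc' : (LieModule.toEnd ℂ 𝔤 𝔤 (x (negRoot i)) ^ q) (x t) = c • x j := hc
  have hc0 : c ≠ 0 := by
    rintro rfl
    exact hne (by rw [hc', zero_smul])
  suffices ⁅x (negRoot i), ⁅x i, c • x j⁆⁆ = ((q : ℂ) *
      ((rootSystem H).chainBotCoeff i j + 1)) • c • x j by
    rw [lie_smul, lie_smul, smul_comm] at this
    exact smul_right_injective _ hc0 this
  rw [← hc']
  rcases Nat.eq_zero_or_pos q with h0 | hpos
  · rw [h0]
    simp [P.lie_e]
  · obtain ⟨n, hn⟩ : ∃ n, q = n + 1 := ⟨q - 1, by lia⟩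
    rw [hn, P.lie_e_pow_succ_toEnd_f, lie_smul, P.lie_f_pow_toEnd_f, hn]
    congr 1
    push_cast
    ring

/-- **Chevalley's theorem** on the structure constants of a Chevalley basis. -/
theorem IsChevalleyBasis.lie_eq {i j k : H.root}
    (h : LinearIndependent ℂ ![(rootSystem H).root i, (rootSystem H).root j])
    (hk : (rootSystem H).root k = (rootSystem H).root j + (rootSystem H).root i) :
    ⁅x i, x j⁆ = ((rootSystem H).chainBotCoeff i j + 1) • x k ∨
      ⁅x i, x j⁆ = -(((rootSystem H).chainBotCoeff i j + 1) • x k) := by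
  obtain ⟨c, hc, hc'⟩ := hx.lie_add i j k (by rw [add_comm]; exact hk)
  have hkk := hx.killingNorm_ne_zero k
  have hkj := hx.killingNorm_ne_zero j
  -- The same value of the Killing form is computed twice: by the sign condition of a Chevalley
  -- basis, which yields the square of `c`, and by invariance, which yields the coefficient of
  -- `lie_lie_self`. The length relation `h3` turns the comparison into `c ^ 2 = (r + 1) ^ 2`.
  have h1 : killingForm ℂ 𝔤 ⁅x i, x j⁆ ⁅x (negRoot i), x (negRoot j)⁆ =
      -(c ^ 2) * killingNorm x k := by
    rw [hc, hc', killingNorm]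
    simp only [map_smul, LinearMap.smul_apply, smul_eq_mul]
    ring
  have h2 : killingForm ℂ 𝔤 ⁅x i, x j⁆ ⁅x (negRoot i), x (negRoot j)⁆ =
      -((((rootSystem H).chainTopCoeff i j : ℂ) *
      ((rootSystem H).chainBotCoeff i j + 1)) * killingNorm x j) := by
    rw [← LieModule.traceForm_apply_lie_apply, ← lie_skew, hx.lie_lie_self h, killingNorm]
    simp
  have h3 := hx.chainTopCoeff_mul h hk
  rw [h1] at h2
  have h4 : (c - ((rootSystem H).chainBotCoeff i j + 1)) *
      (c + ((rootSystem H).chainBotCoeff i j + 1)) = 0 := by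
    field_simp at h3
    apply mul_right_cancel₀ hkk
    linear_combination -h2 + ((rootSystem H).chainBotCoeff i j + 1) * h3
  rcases mul_eq_zero.mp h4 with h5 | h5
  · left
    rw [hc, show c = (((rootSystem H).chainBotCoeff i j + 1 : ℕ) : ℂ) by
      push_cast; linear_combination h5, Nat.cast_smul_eq_nsmul]
  · right
    rw [hc, show c = -(((rootSystem H).chainBotCoeff i j + 1 : ℕ) : ℂ) by
      push_cast; linear_combination h5, neg_smul, Nat.cast_smul_eq_nsmul]

end

/-! ### Divided powers in associative algebras -/

section DividedPowers

variable {A : Type*} [Ring A] [Algebra ℂ A]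

/-- The divided power `a ^ n / n!` in an associative algebra. -/
def dpow (a : A) (n : ℕ) : A := ((n ! : ℂ)⁻¹) • a ^ n

@[simp] theorem dpow_zero (a : A) : dpow a 0 = 1 := by simp [dpow]

@[simp] theorem dpow_one (a : A) : dpow a 1 = a := by simp [dpow]

theorem factorial_cast_ne_zero (n : ℕ) : (n ! : ℂ) ≠ 0 := Nat.cast_ne_zero.mpr n.factorial_ne_zero

theorem factorial_smul_dpow (a : A) (n : ℕ) : (n ! : ℂ) • dpow a n = a ^ n := by
  rw [dpow, smul_smul, mul_inv_cancel₀ (factorial_cast_ne_zero n), one_smul]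

theorem dpow_add {a c : A} (h : Commute a c) (n : ℕ) :
    dpow (a + c) n = ∑ ij ∈ Finset.HasAntidiagonal.antidiagonal n, dpow a ij.1 * dpow c ij.2 := by
  rw [dpow, h.add_pow', Finset.smul_sum]
  refine Finset.sum_congr rfl fun ij hij => ?_
  obtain rfl := Finset.HasAntidiagonal.mem_antidiagonal.mp hij
  rw [dpow, dpow, smul_mul_smul_comm, ← Nat.cast_smul_eq_nsmul ℂ, smul_smul]
  congr 1
  have h1 : ((ij.1 + ij.2).choose ij.1 : ℂ) * (ij.1 ! * ij.2 !) = (ij.1 + ij.2)! := by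
    rw [← mul_assoc, Nat.choose_symm_add]
    exact_mod_cast Nat.add_choose_mul_factorial_mul_factorial ij.1 ij.2
  have := factorial_cast_ne_zero ij.1
  have := factorial_cast_ne_zero ij.2
  have := factorial_cast_ne_zero (ij.1 + ij.2)
  field_simp
  rw [← h1]
  ring

theorem dpow_zero_left (n : ℕ) : dpow (0 : A) n = if n = 0 then 1 else 0 := by
  split_ifs with h
  · simp [h]
  · simp [dpow, h]

theorem dpow_neg (a : A) (n : ℕ) : dpow (-a) n = (-1 : ℤ) ^ n • dpow a n := by
  rw [dpow, dpow, neg_pow]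
  rcases Nat.even_or_odd n with h | h <;> simp [h.neg_one_pow]

theorem mul_dpow_succ (a : A) (n : ℕ) : a * dpow a n = ((n + 1 : ℕ) : ℂ) • dpow a (n + 1) := by
  rw [dpow, dpow, mul_smul_comm, smul_smul, ← pow_succ', Nat.factorial_succ]
  congr 1
  have := factorial_cast_ne_zero n
  have : ((n + 1 : ℕ) : ℂ) ≠ 0 := Nat.cast_ne_zero.mpr (by lia)
  push_cast at *
  field_simp

/-- The divided power of the inner derivation `[a, ·]` of an associative algebra. -/
def dad (a : A) (k : ℕ) (y : A) : A :=
  dpow (LinearMap.mulLeft ℂ a - LinearMap.mulRight ℂ a) k y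

theorem dpow_mulLeft (a y : A) (k : ℕ) : dpow (LinearMap.mulLeft ℂ a) k y = dpow a k * y := by
  simp [dpow, LinearMap.pow_mulLeft]

theorem dpow_mulRight (a y : A) (k : ℕ) : dpow (LinearMap.mulRight ℂ a) k y = y * dpow a k := by
  simp [dpow, LinearMap.pow_mulRight]

theorem dad_smul (a : A) (k : ℕ) (c : ℂ) (y : A) : dad a k (c • y) = c • dad a k y := by
  simp [dad]

theorem dad_eq_sum (a y : A) (k : ℕ) :
    dad a k y = ∑ ij ∈ Finset.HasAntidiagonal.antidiagonal k, dpow a ij.1 * y * dpow (-a) ij.2 := by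
  have h : Commute (LinearMap.mulLeft ℂ a) (LinearMap.mulRight ℂ (-a)) :=
    LinearMap.commute_mulLeft_right a (-a)
  have h1 : LinearMap.mulLeft ℂ a - LinearMap.mulRight ℂ a =
      LinearMap.mulLeft ℂ a + LinearMap.mulRight ℂ (-a) := by
    ext y; simp [sub_eq_add_neg]
  rw [dad, h1, dpow_add h, LinearMap.sum_apply]
  refine Finset.sum_congr rfl fun ij _ => ?_
  rw [Module.End.mul_apply, dpow_mulLeft, dpow_mulRight, mul_assoc]

/-- Moving an element past a divided power. -/
theorem mul_dpow_eq_sum (a y : A) (n : ℕ) :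
    y * dpow a n = ∑ ij ∈ Finset.HasAntidiagonal.antidiagonal n, dpow a ij.1 * dad (-a) ij.2 y := by
  have h : Commute (LinearMap.mulLeft ℂ a)
      (LinearMap.mulLeft ℂ (-a) - LinearMap.mulRight ℂ (-a)) := by
    have h1 := LinearMap.commute_mulLeft_right (R := ℂ) a (-a)
    have h2 : Commute (LinearMap.mulLeft ℂ a) (LinearMap.mulLeft ℂ (-a)) := by
      ext y; simp
    exact h2.sub_right h1
  have h1 : LinearMap.mulRight ℂ a = LinearMap.mulLeft ℂ a +
      (LinearMap.mulLeft ℂ (-a) - LinearMap.mulRight ℂ (-a)) := by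
    ext y; simp
  rw [← dpow_mulRight, h1, dpow_add h, LinearMap.sum_apply]
  refine Finset.sum_congr rfl fun ij _ => ?_
  rw [Module.End.mul_apply, dpow_mulLeft, dad]

/-! ### Conjugation by formal exponentials. -/

theorem mk_dpow_mul_mk_dpow_neg (a : A) :
    (PowerSeries.mk (dpow a)) * PowerSeries.mk (dpow (-a)) = 1 := by
  ext n
  have h : Commute a (-a) := (Commute.refl a).neg_right
  simp only [PowerSeries.coeff_mul, PowerSeries.coeff_mk]
  rw [← dpow_add h, add_neg_cancel, dpow_zero_left, PowerSeries.coeff_one]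

/-- The generating series of the divided powers of `[a, ·]` is conjugation by `exp(ta)`; hence it is
multiplicative in `y`, which gives `mk_dad_pow`. -/
theorem mk_dad (a y : A) : PowerSeries.mk (fun k => dad a k y) =
    PowerSeries.mk (dpow a) * PowerSeries.C y * PowerSeries.mk (dpow (-a)) := by
  ext n
  rw [PowerSeries.coeff_mk, dad_eq_sum, PowerSeries.coeff_mul]
  simp only [PowerSeries.coeff_mul_C, PowerSeries.coeff_mk]

theorem mk_dad_pow (a y : A) (n : ℕ) : PowerSeries.mk (fun k => dad a k (y ^ n)) =
    PowerSeries.mk (fun k => dad a k y) ^ n := by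
  have h : PowerSeries.mk (dpow (-a)) * PowerSeries.mk (dpow a) = 1 := by
    simpa using mk_dpow_mul_mk_dpow_neg (-a)
  induction n with
  | zero => simp [mk_dad, mk_dpow_mul_mk_dpow_neg]
  | succ n ih =>
    rw [pow_succ (PowerSeries.mk _), ← ih, mk_dad, mk_dad, mk_dad, pow_succ, map_mul]
    simp only [mul_assoc]
    rw [← mul_assoc (PowerSeries.mk (dpow (-a))) (PowerSeries.mk (dpow a)), h, one_mul]

/-- Exponentials of inner derivations preserve the set of elements all of whose divided powers lie
in a given subring that contains the divided powers of the element defining the derivation. -/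
theorem dpow_sum_dad_mem (S : Subring A) {a y : A} {K : ℕ} (ha : ∀ n, dpow a n ∈ S)
    (ha' : ∀ n, dpow (-a) n ∈ S) (hy : ∀ n, dpow y n ∈ S) (hK : ∀ k, K ≤ k → dad a k y = 0)
    (n : ℕ) : dpow (∑ k ∈ Finset.range K, dad a k y) n ∈ S := by
  -- `P` is the polynomial `exp(ta) y exp(-ta)` in `t`, and the sum in question is its value at `t =
  -- 1`. The coefficients of `P ^ n` are `dad a k (y ^ n)`, so after division by `n!` they involve
  -- only divided powers of `a`, `-a` and `y`.
  let P : Polynomial A := ∑ k ∈ Finset.range K, Polynomial.monomial k (dad a k y)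
  have hP : (P : PowerSeries A) = PowerSeries.mk (fun k => dad a k y) := by
    ext k
    simp only [P, Polynomial.coeff_coe, Polynomial.finsetSum_coeff, Polynomial.coeff_monomial,
      PowerSeries.coeff_mk, Finset.sum_ite_eq', Finset.mem_range]
    split_ifs with h
    · rfl
    · exact (hK k (not_lt.mp h)).symm
  have hc : ∀ k, (P ^ n).coeff k = dad a k (y ^ n) := by
    intro k
    rw [← Polynomial.coeff_coe, Polynomial.coe_pow, hP, ← mk_dad_pow, PowerSeries.coeff_mk]
  let ev : Polynomial A →+* A := Polynomial.eval₂RingHom' (RingHom.id A) 1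
    (fun b => Commute.one_right b)
  have hev : ∀ Q : Polynomial A, ev Q = Q.sum fun _ b => b := by
    intro Q
    change Polynomial.eval₂ _ _ _ = _
    rw [Polynomial.eval₂_eq_sum]
    simp
  have h1 : ev P = ∑ k ∈ Finset.range K, dad a k y := by
    simp only [P, map_sum]
    refine Finset.sum_congr rfl fun k _ => ?_
    rw [hev, Polynomial.sum_monomial_index _ _ rfl]
  rw [dpow, ← h1, ← map_pow, hev, Polynomial.sum_def, Finset.smul_sum]
  refine S.sum_mem fun k _ => ?_
  rw [hc, ← dad_smul, ← dpow, dad_eq_sum]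
  exact S.sum_mem fun ij _ => S.mul_mem (S.mul_mem (ha _) (hy _)) (ha' _)

end DividedPowers

/-! ### The Chevalley lattice -/

/-- The `ℤ`-span of the root vectors and the coroots. -/
def chevalleyLattice (x : H.root → 𝔤) : Submodule ℤ 𝔤 :=
  Submodule.span ℤ (Set.range x ∪ Set.range fun α : H.root => (coroot α.1 : 𝔤))

theorem mem_chevalleyLattice (x : H.root → 𝔤) (α : H.root) : x α ∈ chevalleyLattice x :=
  Submodule.subset_span (Or.inl ⟨α, rfl⟩)

theorem coroot_mem_chevalleyLattice (x : H.root → 𝔤) (α : H.root) :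
    (coroot α.1 : 𝔤) ∈ chevalleyLattice x :=
  Submodule.subset_span (Or.inr ⟨α, rfl⟩)

/-- The divided power of the adjoint action. -/
def dadLie (y : 𝔤) (k : ℕ) : Module.End ℂ 𝔤 := dpow (LieAlgebra.ad ℂ 𝔤 y) k

theorem dadLie_of_pow {y z w : 𝔤} {k : ℕ} (h : (LieAlgebra.ad ℂ 𝔤 y ^ k) z = (k ! : ℤ) • w) :
    dadLie y k z = w := by
  rw [dadLie, dpow, LinearMap.smul_apply, h, ← Int.cast_smul_eq_zsmul ℂ, smul_smul]
  push_cast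
  rw [inv_mul_cancel₀ (factorial_cast_ne_zero k), one_smul]

theorem dadLie_neg (y : 𝔤) (k : ℕ) : dadLie (-y) k = (-1 : ℤ) ^ k • dadLie y k := by
  rw [dadLie, map_neg, dpow_neg, dadLie]

section

variable {x : H.root → 𝔤} (hx : IsChevalleyBasis x)
include hx

/-- Each step up the string multiplies by the next structure constant, up to sign: `r + 1`, `r + 2`,
and so on, where `r` counts the steps below `j`. Divisibility of the ascending factorial by `k!`
then makes the divided powers integral. -/
theorem IsChevalleyBasis.dadLie_root_mem (k : ℕ) {i j : H.root}
    (h : LinearIndependent ℂ ![(rootSystem H).root i, (rootSystem H).root j]) :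
    ∃ z ∈ chevalleyLattice x, (LieAlgebra.ad ℂ 𝔤 (x i) ^ k) (x j) =
      (((rootSystem H).chainBotCoeff i j + 1).ascFactorial k : ℤ) • z := by
  induction k generalizing j with
  | zero => exact ⟨x j, mem_chevalleyLattice x j, by simp⟩
  | succ k ih =>
    rw [pow_succ, Module.End.mul_apply, LieAlgebra.ad_apply]
    by_cases hm : (rootSystem H).root i + (rootSystem H).root j ∈ Set.range (rootSystem H).root
    · obtain ⟨l, hl⟩ := hm
      have hl' : (rootSystem H).root l = (rootSystem H).root j + (rootSystem H).root i := by
        rw [hl, add_comm]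
      obtain ⟨z, hz, hz'⟩ := ih (linearIndependent_add h hl')
      rw [RootPairing.chainBotCoeff_of_add h hl'] at hz'
      have e : ((rootSystem H).chainBotCoeff i j + 1).ascFactorial (k + 1) =
          ((rootSystem H).chainBotCoeff i j + 1) *
            ((rootSystem H).chainBotCoeff i j + 1 + 1).ascFactorial k := by
        rw [Nat.ascFactorial_succ, Nat.succ_ascFactorial]
      rcases hx.lie_eq h hl' with hc | hc
      · refine ⟨z, hz, ?_⟩
        rw [hc, map_nsmul, hz', e, ← natCast_zsmul, smul_smul]
        push_cast
        rfl
      · refine ⟨-z, neg_mem hz, ?_⟩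
        rw [hc, map_neg, map_nsmul, hz', e, ← natCast_zsmul, smul_smul, smul_neg]
        push_cast
        rfl
    · refine ⟨0, zero_mem _, ?_⟩
      rw [hx.lie_eq_zero _ hm, map_zero, smul_zero]
      intro h0
      rw [LinearIndependent.pair_iff] at h
      simpa using h 1 1 (by simpa using h0)

theorem IsChevalleyBasis.lie_root_coroot (i : H.root) (h : H) :
    ⁅x i, (h : 𝔤)⁆ = -((rootSystem H).root i h • x i) := by
  rw [← lie_skew, hx.lie_coe]

/-- For independent roots this is `dadLie_root_mem`. The remaining cases live in a single `sl₂` or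
start from a coroot; the only genuine division there is by `2!`, since applying `ad (x i)` twice to
`x (negRoot i)` gives `-2 • x i`. -/
theorem IsChevalleyBasis.dadLie_mem (i : H.root) (k : ℕ) {y : 𝔤} (hy : y ∈ chevalleyLattice x) :
    dadLie (x i) k y ∈ chevalleyLattice x := by
  induction hy using Submodule.span_induction with
  | zero => simp
  | add y z _ _ hy hz => rw [map_add]; exact add_mem hy hz
  | smul n y _ hy => rw [map_zsmul]; exact Submodule.smul_mem _ n hy
  | mem y hy =>
    have hco : ∀ α : H.root, ⁅x i, (coroot α.1 : 𝔤)⁆ =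
        -((rootSystem H).pairingIn ℤ i α) • x i := by
      intro α
      rw [hx.lie_root_coroot, root_apply_coroot_eq, neg_smul, Int.cast_smul_eq_zsmul]
    rcases hy with ⟨j, rfl⟩ | ⟨α, rfl⟩
    · rcases eq_or_ne i j with rfl | hij
      · rcases k with _ | k
        · simpa [dadLie] using mem_chevalleyLattice x i
        · rw [dadLie, dpow, pow_succ]
          simp
      by_cases hij' : (rootSystem H).root i = -(rootSystem H).root j
      · obtain rfl : j = negRoot i := by
          apply (rootSystem H).root.injective
          rw [root_negRoot, hij', neg_neg]
        rcases k with _ | _ | _ | k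
        · simpa [dadLie] using mem_chevalleyLattice x (negRoot i)
        · simpa [dadLie, hx.lie_neg] using coroot_mem_chevalleyLattice x i
        · have : dadLie (x i) (0 + 1 + 1) (x (negRoot i)) = -x i := by
            apply dadLie_of_pow
            simp only [pow_succ, Module.End.mul_apply, LieAlgebra.ad_apply, hx.lie_neg,
              pow_zero, Module.End.one_apply]
            rw [hx.lie_root_coroot, root_apply_coroot_self]
            simp [ofNat_smul_eq_nsmul]
          rw [this]
          exact neg_mem (mem_chevalleyLattice x i)
        · have : dadLie (x i) (k + 1 + 1 + 1) (x (negRoot i)) = 0 := by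
            apply dadLie_of_pow
            simp only [pow_succ _ (k + 1 + 1), pow_succ _ (k + 1), pow_succ _ k,
              Module.End.mul_apply, LieAlgebra.ad_apply, hx.lie_neg]
            rw [hx.lie_root_coroot]
            simp
          rw [this]
          exact zero_mem _
      · obtain ⟨z, hz, hz'⟩ := hx.dadLie_root_mem k
          (RootPairing.IsReduced.linearIndependent _ hij hij')
        have := Nat.factorial_mul_ascFactorial ((rootSystem H).chainBotCoeff i j) k
        obtain ⟨c, hc⟩ := Nat.factorial_dvd_ascFactorial ((rootSystem H).chainBotCoeff i j + 1) k
        rw [hc, Nat.cast_mul, mul_smul] at hz'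
        rw [dadLie_of_pow hz']
        exact Submodule.smul_mem _ _ hz
    · rcases k with _ | _ | k
      · simpa [dadLie] using coroot_mem_chevalleyLattice x α
      · rw [dadLie, dpow_one, LieAlgebra.ad_apply, hco]
        exact Submodule.smul_mem _ _ (mem_chevalleyLattice x i)
      · rw [dadLie, dpow, pow_succ, pow_succ]
        simp only [LinearMap.smul_apply, Module.End.mul_apply, LieAlgebra.ad_apply, hco]
        simp

theorem IsChevalleyBasis.dadLie_neg_mem (i : H.root) (k : ℕ) {y : 𝔤}
    (hy : y ∈ chevalleyLattice x) : dadLie (-x i) k y ∈ chevalleyLattice x := by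
  rw [dadLie_neg, LinearMap.smul_apply]
  exact Submodule.smul_mem _ _ (hx.dadLie_mem i k hy)

/-- The normalized pairing with the opposite root vector is `1` on `x i` and integral on the
lattice. In `expAd_root` this forces the scalars there to be integers. -/
theorem IsChevalleyBasis.mem_int_of_smul_mem (i : H.root) {c : ℂ}
    (h : c • x i ∈ chevalleyLattice x) : ∃ n : ℤ, c = n := by
  let f : 𝔤 →ₗ[ℂ] ℂ := (killingNorm x i)⁻¹ • (killingForm ℂ 𝔤).flip (x (negRoot i))
  have hf : ∀ y, f y = (killingNorm x i)⁻¹ * killingForm ℂ 𝔤 y (x (negRoot i)) := fun y => rfl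
  have key : ∀ y ∈ chevalleyLattice x, ∃ n : ℤ, f y = n := by
    intro y hy
    induction hy using Submodule.span_induction with
    | zero => exact ⟨0, by simp⟩
    | add y z _ _ hy hz =>
      obtain ⟨m, hm⟩ := hy
      obtain ⟨n, hn⟩ := hz
      exact ⟨m + n, by rw [map_add, hm, hn]; push_cast; rfl⟩
    | smul n y _ hy =>
      obtain ⟨m, hm⟩ := hy
      exact ⟨n * m, by rw [map_zsmul, hm]; push_cast; simp⟩
    | mem y hy =>
      rcases hy with ⟨j, rfl⟩ | ⟨α, rfl⟩
      · rcases eq_or_ne j i with rfl | hij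
        · exact ⟨1, by rw [hf, ← killingNorm, inv_mul_cancel₀ (hx.killingNorm_ne_zero j)]; simp⟩
        · refine ⟨0, ?_⟩
          rw [hf, LieAlgebra.killingForm_apply_eq_zero_of_mem_rootSpace_of_add_ne_zero ℂ 𝔤 H
            (hx.mem_rootSpace j) (hx.mem_rootSpace (negRoot i))]
          · simp
          · intro h0
            apply hij
            apply Subtype.ext
            ext h
            have := congrFun h0 h
            simp only [coe_negRoot, LieModule.Weight.coe_neg, Pi.add_apply, Pi.neg_apply,
              Pi.zero_apply] at this
            linear_combination this
      · refine ⟨0, ?_⟩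
        have h0 : (coroot α.1 : 𝔤) ∈ LieAlgebra.rootSpace H (0 : H → ℂ) := by
          rw [LieAlgebra.rootSpace_zero_eq]
          exact (coroot α.1).2
        rw [hf, LieAlgebra.killingForm_apply_eq_zero_of_mem_rootSpace_of_add_ne_zero ℂ 𝔤 H h0
            (hx.mem_rootSpace (negRoot i))]
        · simp
        · rw [zero_add]
          exact LieSubalgebra.isNonZero_coe_root (negRoot i)
  obtain ⟨n, hn⟩ := key _ h
  refine ⟨n, ?_⟩
  rw [← hn, map_smul, hf, ← killingNorm, inv_mul_cancel₀ (hx.killingNorm_ne_zero i)]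
  simp

end

/-! ### Exponentials of nilpotent adjoint actions -/

/-- The exponential of a nilpotent adjoint action as an automorphism of the Lie algebra. -/
def expAd (y : 𝔤) (h : IsNilpotent (LieAlgebra.ad ℂ 𝔤 y)) : 𝔤 ≃ₗ⁅ℂ⁆ 𝔤 :=
  -- The exponential of a derivation is taken over `ℚ`; the rational structure is the restriction of
  -- the complex one.
  letI : LieAlgebra ℚ 𝔤 := { Module.compHom 𝔤 (algebraMap ℚ ℂ) with
    lie_smul := fun t a c => lie_smul (algebraMap ℚ ℂ t) a c }
  LieDerivation.exp (LieDerivation.ad ℂ 𝔤 y) (by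
    convert h using 1
    ext z
    simp)

theorem dadLie_eq_zero {y : 𝔤} {n : ℕ} (hn : LieAlgebra.ad ℂ 𝔤 y ^ n = 0) {k : ℕ} (hk : n ≤ k) :
    dadLie y k = 0 := by
  rw [dadLie, dpow, pow_eq_zero_of_le hk hn, smul_zero]

theorem expAd_apply {y : 𝔤} (h : IsNilpotent (LieAlgebra.ad ℂ 𝔤 y)) {n : ℕ} {z : 𝔤}
    (hn : (LieAlgebra.ad ℂ 𝔤 y ^ n) z = 0) :
    expAd y h z = ∑ k ∈ Finset.range n, dadLie y k z := by
  let _ : LieAlgebra ℚ 𝔤 := { Module.compHom 𝔤 (algebraMap ℚ ℂ) with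
    lie_smul := fun t a c => lie_smul (algebraMap ℚ ℂ t) a c }
  have e : (LieDerivation.ad ℂ 𝔤 y).toLinearMap = LieAlgebra.ad ℂ 𝔤 y := by ext; simp
  rw [expAd, LieDerivation.exp_map_apply, e]
  have := IsNilpotent.exp_smul_eq_sum (M := 𝔤) (a := LieAlgebra.ad ℂ 𝔤 y) (m := z) hn h
  rw [Module.End.smul_def] at this
  rw [this]
  refine Finset.sum_congr rfl fun k _ => ?_
  rw [dadLie, dpow, LinearMap.smul_apply]
  change algebraMap ℚ ℂ ((k ! : ℚ)⁻¹) • (LieAlgebra.ad ℂ 𝔤 y ^ k) z = _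
  congr 1
  simp

theorem expAd_neg_apply {y : 𝔤} (h : IsNilpotent (LieAlgebra.ad ℂ 𝔤 y))
    (h' : IsNilpotent (LieAlgebra.ad ℂ 𝔤 (-y))) (z : 𝔤) : expAd (-y) h' (expAd y h z) = z := by
  let _ : LieAlgebra ℚ 𝔤 := { Module.compHom 𝔤 (algebraMap ℚ ℂ) with
    lie_smul := fun t a c => lie_smul (algebraMap ℚ ℂ t) a c }
  have e : ∀ y, (LieDerivation.ad ℂ 𝔤 y).toLinearMap = LieAlgebra.ad ℂ 𝔤 y := by intro; ext; simp
  rw [expAd, LieDerivation.exp_map_apply, expAd, LieDerivation.exp_map_apply, e, e,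
    ← Module.End.mul_apply, map_neg, IsNilpotent.exp_neg_mul_exp_self h]
  rfl

/-! ### Divided powers of root vectors -/

attribute [local instance 100] LieRing.ofAssociativeRing in
theorem toEnv_lie (y z : 𝔤) : toEnv ⁅y, z⁆ = toEnv y * toEnv z - toEnv z * toEnv y := by
  exact (UniversalEnvelopingAlgebra.ι ℂ).map_lie y z

theorem divPow_eq_dpow (y : 𝔤) (n : ℕ) : divPow y n = dpow (toEnv y) n := rfl

theorem toEnv_dadLie (y z : 𝔤) (k : ℕ) :
    toEnv (dadLie y k z) = dad (toEnv y) k (toEnv z) := by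
  have h : ∀ k, toEnv ((LieAlgebra.ad ℂ 𝔤 y ^ k) z) =
      ((LinearMap.mulLeft ℂ (toEnv y) - LinearMap.mulRight ℂ (toEnv y)) ^ k) (toEnv z) := by
    intro k
    induction k with
    | zero => rfl
    | succ k ih =>
      rw [pow_succ', pow_succ', Module.End.mul_apply, Module.End.mul_apply, ← ih,
        LieAlgebra.ad_apply, toEnv_lie]
      rfl
  rw [dadLie, dad, dpow, dpow, LinearMap.smul_apply, LinearMap.smul_apply, ← h, toEnv, map_smul]

/-- In the enveloping algebra `exp(ad y) z` is the conjugate of `z` by `exp(y)`, so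
`dpow_sum_dad_mem` applies. -/
theorem divPow_expAd_mem (S : Subring (Env 𝔤)) {y z : 𝔤}
    (h : IsNilpotent (LieAlgebra.ad ℂ 𝔤 y)) (hy : ∀ n, divPow y n ∈ S)
    (hz : ∀ n, divPow z n ∈ S) (n : ℕ) : divPow (expAd y h z) n ∈ S := by
  obtain ⟨K, hK⟩ := id h
  rw [expAd_apply (n := K) _ (by rw [hK]; rfl), divPow_eq_dpow, toEnv, map_sum]
  have hs : ∑ k ∈ Finset.range K, UniversalEnvelopingAlgebra.ι ℂ (dadLie y k z) =
      ∑ k ∈ Finset.range K, dad (toEnv y) k (toEnv z) :=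
    Finset.sum_congr rfl fun k _ => toEnv_dadLie y z k
  rw [hs]
  refine dpow_sum_dad_mem S hy (fun n => ?_) hz (fun k hk => ?_) n
  · rw [dpow_neg]
    exact S.zsmul_mem (hy n) _
  · rw [← toEnv_dadLie, dadLie_eq_zero hK hk, LinearMap.zero_apply, toEnv, map_zero]

/-! ### Reflections lifted to automorphisms of the Lie algebra. -/

/-- The automorphism of a Lie algebra lifting the reflection in a root. -/
theorem expAd_expAd_expAd_apply {α : H.root} {e f : 𝔤} (t : IsSl2Triple (coroot α.1 : 𝔤) e f)
    (he : ∀ h : H, ⁅(h : 𝔤), e⁆ = (rootSystem H).root α h • e)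
    (hf : ∀ h : H, ⁅(h : 𝔤), f⁆ = -((rootSystem H).root α h • f))
    (ne : IsNilpotent (LieAlgebra.ad ℂ 𝔤 e)) (nf : IsNilpotent (LieAlgebra.ad ℂ 𝔤 (-f))) (h : H) :
    expAd e ne (expAd (-f) nf (expAd e ne h)) =
      (h : 𝔤) - (rootSystem H).root α h • (coroot α.1 : 𝔤) := by
  have hh : ∀ h' : H, ⁅(coroot α.1 : 𝔤), (h' : 𝔤)⁆ = 0 := fun h' => by
    have := congrArg Subtype.val (trivial_lie_zero H H (coroot α.1) h')
    simpa using this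
  have he' : ∀ h : H, ⁅e, (h : 𝔤)⁆ = -((rootSystem H).root α h • e) := fun h => by
    rw [← lie_skew, he]
  have hf' : ∀ h : H, ⁅f, (h : 𝔤)⁆ = (rootSystem H).root α h • f := fun h => by
    rw [← lie_skew, hf, neg_neg]
  have hfe : ⁅f, e⁆ = -(coroot α.1 : 𝔤) := by rw [← lie_skew, t.lie_e_f]
  have a1 : ∀ h : H, expAd e ne h = (h : 𝔤) - (rootSystem H).root α h • e := fun h => by
    rw [expAd_apply (n := 2)]
    · simp [Finset.sum_range_succ, dadLie, he', sub_eq_add_neg]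
    · simp [pow_two, he']
  have a2 : ∀ h : H, expAd (-f) nf h = (h : 𝔤) - (rootSystem H).root α h • f := fun h => by
    rw [expAd_apply (n := 2)]
    · simp [Finset.sum_range_succ, dadLie, hf', sub_eq_add_neg]
    · simp [pow_two, hf']
  have a3 : expAd (-f) nf e = e + coroot α.1 - f := by
    rw [expAd_apply (n := 3)]
    · simp only [Finset.sum_range_succ, dadLie, dpow, pow_two, pow_one, pow_zero]
      simp [hf', hfe, root_apply_coroot (LieSubalgebra.isNonZero_coe_root α), smul_smul,
        sub_eq_add_neg]
    · simp [pow_succ, hf', hfe]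
  have a4 : expAd e ne e = e := by
    rw [expAd_apply (n := 1)]
    · simp [dadLie]
    · simp
  rw [a1, map_sub, map_smul, a2, a3]
  rw [show (h : 𝔤) - (rootSystem H).root α h • f - (rootSystem H).root α h •
    (e + coroot α.1 - f) = (h : 𝔤) - (rootSystem H).root α h • (e + coroot α.1) by module]
  rw [map_sub, map_smul, map_add, a1, a1, a4, root_apply_coroot_self]
  module

theorem lie_expAd_expAd_expAd {α β : H.root} {e f y : 𝔤}
    (t : IsSl2Triple (coroot α.1 : 𝔤) e f)
    (he : ∀ h : H, ⁅(h : 𝔤), e⁆ = (rootSystem H).root α h • e)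
    (hf : ∀ h : H, ⁅(h : 𝔤), f⁆ = -((rootSystem H).root α h • f))
    (ne : IsNilpotent (LieAlgebra.ad ℂ 𝔤 e)) (nf : IsNilpotent (LieAlgebra.ad ℂ 𝔤 (-f)))
    (hy : ∀ h : H, ⁅(h : 𝔤), y⁆ = (rootSystem H).root β h • y) (h : H) :
    ⁅(h : 𝔤), expAd e ne (expAd (-f) nf (expAd e ne y))⁆ =
      (rootSystem H).root ((rootSystem H).reflectionPerm α β) h •
        expAd e ne (expAd (-f) nf (expAd e ne y)) := by
  -- The reflection is an involution on `H`, so `h` is the image of its own reflection; being an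
  -- automorphism, the product then moves the weight of `y` by the reflection.
  have h1 := expAd_expAd_expAd_apply t he hf ne nf
    (h - (rootSystem H).root α h • coroot α.1)
  have h2 : expAd e ne (expAd (-f) nf (expAd e ne
      (h - (rootSystem H).root α h • coroot α.1 : H))) = (h : 𝔤) := by
    rw [h1, map_sub, map_smul, root_apply_coroot_self]
    push_cast
    simp only [smul_eq_mul]
    module
  conv_lhs => rw [← h2]
  rw [← LieEquiv.map_lie, ← LieEquiv.map_lie, ← LieEquiv.map_lie, hy, map_smul, map_smul, map_smul,
    RootPairing.root_reflectionPerm, RootPairing.reflection_apply]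
  congr 1
  rw [map_sub, map_smul, LinearMap.sub_apply, LinearMap.smul_apply]
  simp only [smul_eq_mul]
  rw [mul_comm]
  rfl

section

variable (b : (rootSystem H).Base) (x : H.root → 𝔤)

/-- The `ℤ`-form of the enveloping algebra generated by the divided powers of the root vectors
that belong to simple roots and their negatives. -/
def simpleForm : Subalgebra ℤ (Env 𝔤) :=
  Algebra.adjoin ℤ {u | ∃ γ ∈ b.support, ∃ n : ℕ,
    u = divPow (x γ) n ∨ u = divPow (x (negRoot γ)) n}

/-- The negative part of `simpleForm`. -/
def simpleFormNeg : Subalgebra ℤ (Env 𝔤) :=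
  Algebra.adjoin ℤ {u | ∃ γ ∈ b.support, ∃ n : ℕ, u = divPow (x (negRoot γ)) n}

end

section

variable {b : (rootSystem H).Base} {x : H.root → 𝔤} (hx : IsChevalleyBasis x)
include hx

theorem IsChevalleyBasis.isNilpotent_ad (α : H.root) : IsNilpotent (LieAlgebra.ad ℂ 𝔤 (x α)) :=
  LieAlgebra.isNilpotent_ad_of_mem_rootSpace H (LieSubalgebra.isNonZero_coe_root α)
    (hx.mem_rootSpace α)

theorem IsChevalleyBasis.isNilpotent_ad_neg (α : H.root) :
    IsNilpotent (LieAlgebra.ad ℂ 𝔤 (-x α)) := by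
  rw [map_neg]
  exact (hx.isNilpotent_ad α).neg

theorem IsChevalleyBasis.expAd_mem (α : H.root) {y : 𝔤} (hy : y ∈ chevalleyLattice x) :
    expAd (x α) (hx.isNilpotent_ad α) y ∈ chevalleyLattice x := by
  obtain ⟨n, hn⟩ := id (hx.isNilpotent_ad α)
  rw [expAd_apply (n := n) _ (by rw [hn]; rfl)]
  exact sum_mem fun k _ => hx.dadLie_mem α k hy

theorem IsChevalleyBasis.expAd_neg_mem (α : H.root) {y : 𝔤} (hy : y ∈ chevalleyLattice x) :
    expAd (-x α) (hx.isNilpotent_ad_neg α) y ∈ chevalleyLattice x := by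
  obtain ⟨n, hn⟩ := id (hx.isNilpotent_ad_neg α)
  rw [expAd_apply (n := n) _ (by rw [hn]; rfl)]
  exact sum_mem fun k _ => hx.dadLie_neg_mem α k hy

/-- The lifted reflection and its inverse both preserve the Chevalley lattice and permute the root
lines. The two scalars are therefore integers with product `1`. -/
theorem IsChevalleyBasis.expAd_root (α β : H.root) :
    let τ := expAd (x α) (hx.isNilpotent_ad α) (expAd (-x (negRoot α))
      (hx.isNilpotent_ad_neg (negRoot α)) (expAd (x α) (hx.isNilpotent_ad α) (x β)))
    τ = x ((rootSystem H).reflectionPerm α β) ∨ τ = -x ((rootSystem H).reflectionPerm α β) := by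
  intro τ
  have hf : ∀ h : H, ⁅(h : 𝔤), x (negRoot α)⁆ = -((rootSystem H).root α h • x (negRoot α)) := by
    intro h
    rw [hx.lie_coe, root_negRoot, LinearMap.neg_apply, neg_smul]
  obtain ⟨c, hc⟩ := hx.exists_eq_smul ((rootSystem H).reflectionPerm α β) (y := τ)
    (lie_expAd_expAd_expAd (hx.isSl2Triple α) (hx.lie_coe α) hf _ _ (hx.lie_coe β))
  -- The inverse is the same triple product for the `sl₂`-triple with both root vectors negated,
  -- which explains the double negation below.
  have t' : IsSl2Triple (coroot α.1 : 𝔤) (-x α) (-x (negRoot α)) :=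
    { h_ne_zero := (hx.isSl2Triple α).h_ne_zero
      lie_e_f := by rw [neg_lie, _root_.lie_neg, neg_neg, (hx.isSl2Triple α).lie_e_f]
      lie_h_e_nsmul := by rw [_root_.lie_neg, (hx.isSl2Triple α).lie_h_e_nsmul, smul_neg]
      lie_h_f_nsmul := by rw [_root_.lie_neg, (hx.isSl2Triple α).lie_h_f_nsmul, smul_neg] }
  have nf : IsNilpotent (LieAlgebra.ad ℂ 𝔤 (- -x (negRoot α))) := by
    rw [neg_neg]
    exact hx.isNilpotent_ad (negRoot α)
  set σ : 𝔤 → 𝔤 := fun y => expAd (-x α) (hx.isNilpotent_ad_neg α) (expAd (- -x (negRoot α))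
      nf (expAd (-x α) (hx.isNilpotent_ad_neg α) y)) with hσ
  have hστ : σ τ = x β := by
    simp only [hσ, τ]
    rw [expAd_neg_apply, expAd_neg_apply, expAd_neg_apply]
  obtain ⟨c', hc'⟩ := hx.exists_eq_smul β (y := σ (x ((rootSystem H).reflectionPerm α β)))
    (by
      have := lie_expAd_expAd_expAd (y := x ((rootSystem H).reflectionPerm α β))
        (β := (rootSystem H).reflectionPerm α β) t'
        (fun h => by rw [_root_.lie_neg, hx.lie_coe, smul_neg])
        (fun h => by rw [_root_.lie_neg, hf, smul_neg]) (hx.isNilpotent_ad_neg α) nf (hx.lie_coe _)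
      have hs : (rootSystem H).reflectionPerm α ((rootSystem H).reflectionPerm α β) = β :=
        (rootSystem H).reflectionPerm_self α β
      rw [hs] at this
      exact this)
  have hcc : c * c' = 1 := by
    have h1 : σ τ = (c * c') • x β := by
      rw [hc, mul_smul, ← hc']
      simp only [hσ, map_smul]
    rw [hστ] at h1
    have h2 : (1 - c * c') • x β = 0 := by rw [sub_smul, ← h1, one_smul, sub_self]
    rcases smul_eq_zero.mp h2 with h3 | h3
    · linear_combination -h3
    · exact absurd h3 (hx.ne_zero β)
  have m1 : τ ∈ chevalleyLattice x :=
    hx.expAd_mem α (hx.expAd_neg_mem _ (hx.expAd_mem α (mem_chevalleyLattice x β)))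
  have m2 : σ (x ((rootSystem H).reflectionPerm α β)) ∈ chevalleyLattice x := by
    refine hx.expAd_neg_mem α ?_
    have := hx.expAd_mem (negRoot α) (hx.expAd_neg_mem α (mem_chevalleyLattice x
      ((rootSystem H).reflectionPerm α β)))
    simpa only [neg_neg] using this
  rw [hc] at m1
  rw [hc'] at m2
  obtain ⟨n, rfl⟩ := hx.mem_int_of_smul_mem _ m1
  obtain ⟨n', rfl⟩ := hx.mem_int_of_smul_mem _ m2
  have hn : n * n' = 1 := by exact_mod_cast hcc
  rcases Int.eq_one_or_neg_one_of_mul_eq_one hn with rfl | rfl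
  · left; rw [hc]; simp
  · right; rw [hc]; simp

/-- The Kostant form is generated by the divided powers of the root vectors that belong to simple
roots and their negatives. -/
theorem IsChevalleyBasis.divPow_mem_simpleForm (α : H.root) (n : ℕ) :
    divPow (x α) n ∈ simpleForm b x := by
  have hneg : ∀ {y : 𝔤}, (∀ n, divPow y n ∈ simpleForm b x) →
      ∀ n, divPow (-y) n ∈ simpleForm b x := by
    intro y hy n
    rw [divPow_eq_dpow, toEnv, map_neg, dpow_neg]
    exact Subalgebra.smul_mem _ (hy n) _
  -- Treating `α` and `-α` together makes the negation case of the induction a swap. The reflection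
  -- case conjugates by exponentials of simple root vectors, and the sign in `expAd_root` is
  -- absorbed by `hneg`.
  have key : (∀ n, divPow (x α) n ∈ simpleForm b x) ∧
      ∀ n, divPow (x (negRoot α)) n ∈ simpleForm b x := by
    induction α using b.induction_reflect with
    | h₀ α h =>
      rw [← negRoot_eq_reflectionPerm, negRoot_negRoot]
      exact h.symm
    | h₁ α h =>
      exact ⟨fun n => Algebra.subset_adjoin ⟨α, h, n, Or.inl rfl⟩,
        fun n => Algebra.subset_adjoin ⟨α, h, n, Or.inr rfl⟩⟩
    | h₂ β γ h hγ =>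
      have hr : negRoot ((rootSystem H).reflectionPerm γ β) =
          (rootSystem H).reflectionPerm γ (negRoot β) := by
        apply (rootSystem H).root.injective
        rw [root_negRoot, RootPairing.root_reflectionPerm, RootPairing.root_reflectionPerm,
          root_negRoot, map_neg]
      have step : ∀ δ, (∀ n, divPow (x δ) n ∈ simpleForm b x) →
          ∀ n, divPow (x ((rootSystem H).reflectionPerm γ δ)) n ∈ simpleForm b x := by
        intro δ hδ
        have he : ∀ n, divPow (x γ) n ∈ simpleForm b x :=
          fun n => Algebra.subset_adjoin ⟨γ, hγ, n, Or.inl rfl⟩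
        have hf : ∀ n, divPow (-x (negRoot γ)) n ∈ simpleForm b x :=
          hneg fun n => Algebra.subset_adjoin ⟨γ, hγ, n, Or.inr rfl⟩
        have := divPow_expAd_mem (simpleForm b x).toSubring (hx.isNilpotent_ad γ) he
          (divPow_expAd_mem (simpleForm b x).toSubring (hx.isNilpotent_ad_neg (negRoot γ)) hf
            (divPow_expAd_mem (simpleForm b x).toSubring (hx.isNilpotent_ad γ) he hδ))
        rcases hx.expAd_root γ δ with hc | hc
        · rw [hc] at this
          exact this
        · rw [hc] at this
          simpa only [neg_neg] using hneg this
      exact ⟨step β h.1, by rw [hr]; exact step _ h.2⟩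
  exact key.1 n

theorem IsChevalleyBasis.kostantForm_eq : kostantForm x = simpleForm b x := by
  apply le_antisymm
  · refine Algebra.adjoin_le ?_
    rintro _ ⟨α, n, rfl⟩
    exact hx.divPow_mem_simpleForm α n
  · refine Algebra.adjoin_mono ?_
    rintro _ ⟨γ, -, n, rfl | rfl⟩
    · exact ⟨γ, n, rfl⟩
    · exact ⟨negRoot γ, n, rfl⟩

end

/-! ### Weight spaces -/

section Weights

variable {M : Type*} [AddCommGroup M] [Module ℂ M] [Module (Env 𝔤) M] [IsScalarTower ℂ (Env 𝔤) M]
  {M' : Type*} [AddCommGroup M'] [Module ℂ M'] [Module (Env 𝔤) M'] [IsScalarTower ℂ (Env 𝔤) M']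

omit [FiniteDimensional ℂ 𝔤] [LieAlgebra.IsSemisimple ℂ 𝔤] in
theorem toEnv_smul (c : ℂ) (y : 𝔤) : toEnv (c • y) = c • toEnv y := map_smul _ c y

theorem toEnv_smul_toEnv_smul (y z : 𝔤) (w : M) :
    toEnv y • toEnv z • w = toEnv z • toEnv y • w + toEnv ⁅y, z⁆ • w := by
  rw [toEnv_lie, sub_smul, mul_smul, mul_smul]
  abel

theorem toEnv_smul_mem_weightSpace {y : 𝔤} {μ ν : Dual ℂ H}
    (hy : ∀ h : H, ⁅(h : 𝔤), y⁆ = ν h • y) {w : M} (hw : w ∈ weightSpace M μ) :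
    toEnv y • w ∈ weightSpace M (μ + ν) := by
  intro h
  rw [toEnv_smul_toEnv_smul, hw h, hy h, smul_comm, toEnv_smul, smul_assoc, ← add_smul,
    LinearMap.add_apply]

theorem toEnv_pow_smul_mem_weightSpace {y : 𝔤} {μ ν : Dual ℂ H}
    (hy : ∀ h : H, ⁅(h : 𝔤), y⁆ = ν h • y) {w : M} (hw : w ∈ weightSpace M μ) (n : ℕ) :
    toEnv y ^ n • w ∈ weightSpace M (μ + n • ν) := by
  induction n with
  | zero => simpa using hw
  | succ n ih =>
    rw [pow_succ', mul_smul, add_smul, one_smul, ← add_assoc]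
    exact toEnv_smul_mem_weightSpace hy ih

theorem divPow_smul_mem_weightSpace {y : 𝔤} {μ ν : Dual ℂ H}
    (hy : ∀ h : H, ⁅(h : 𝔤), y⁆ = ν h • y) {w : M} (hw : w ∈ weightSpace M μ) (n : ℕ) :
    divPow y n • w ∈ weightSpace M (μ + n • ν) := by
  rw [divPow, smul_assoc]
  exact Submodule.smul_mem _ _ (toEnv_pow_smul_mem_weightSpace hy hw n)

variable (H M) in
-- The elements of `H` act by commuting operators, and a weight space lies in the corresponding
-- simultaneous generalized eigenspace.
theorem iSupIndep_weightSpace : iSupIndep fun μ : Dual ℂ H => weightSpace M μ := by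
  let f : H → Module.End ℂ M := fun h => Module.toModuleEnd ℂ (S := Env 𝔤) M (toEnv (h : 𝔤))
  have hc : ∀ i j, Commute (f i) (f j) := fun i j => by
    have : Commute (toEnv (i : 𝔤)) (toEnv (j : 𝔤)) := by
      have h0 : ⁅(i : 𝔤), (j : 𝔤)⁆ = 0 := by
        simpa using congrArg Subtype.val (trivial_lie_zero H H i j)
      have := toEnv_lie (i : 𝔤) (j : 𝔤)
      rw [h0, toEnv, map_zero] at this
      exact (sub_eq_zero.mp this.symm)
    exact this.map (Module.toModuleEnd ℂ (S := Env 𝔤) M)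
  have h1 := Module.End.independent_iInf_maxGenEigenspace_of_forall_mapsTo f
    fun i j χ => Module.End.mapsTo_maxGenEigenspace_of_comm (hc j i) χ
  have h2 := h1.comp (f := fun μ : Dual ℂ H => (μ : H → ℂ)) DFunLike.coe_injective
  refine h2.mono fun μ w hw => ?_
  simp only [Function.comp_apply, Submodule.mem_iInf]
  intro h
  rw [Module.End.mem_maxGenEigenspace]
  exact ⟨1, by simpa [f, sub_eq_zero] using hw h⟩

variable (b : (rootSystem H).Base) (x : H.root → 𝔤)

/-- The weight `lam - ∑ c_α α`. -/
def lowerWeight (lam : Dual ℂ H) (c : b.support → ℕ) : Dual ℂ H :=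
  lam - ∑ α, c α • (rootSystem H).root α

variable {b}

theorem lowerWeight_zero (lam : Dual ℂ H) : lowerWeight b lam 0 = lam := by
  simp [lowerWeight]

theorem lowerWeight_add (lam : Dual ℂ H) (c d : b.support → ℕ) :
    lowerWeight b lam (c + d) = lowerWeight b (lowerWeight b lam c) d := by
  simp [lowerWeight, add_smul, Finset.sum_add_distrib, sub_sub]

theorem lowerWeight_single [DecidableEq b.support] (lam : Dual ℂ H) (γ : b.support) (n : ℕ) :
    lowerWeight b lam (Pi.single γ n) = lam + n • -(rootSystem H).root γ.1 := by
  rw [lowerWeight, Finset.sum_eq_single γ]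
  · simp [sub_eq_add_neg]
  · intro d _ hd
    rw [Pi.single_eq_of_ne hd, zero_smul]
  · simp

theorem lowerWeight_injective (lam : Dual ℂ H) :
    Function.Injective (lowerWeight b lam) := by
  intro c d h
  have h1 : ∑ α : b.support, ((c α : ℂ) - (d α : ℂ)) • (rootSystem H).root α.1 = 0 := by
    have := sub_right_injective h
    simp only [sub_smul, Finset.sum_sub_distrib, Nat.cast_smul_eq_nsmul, sub_eq_zero]
    exact this
  have h2 := Fintype.linearIndependent_iff.mp b.linearIndepOn_root _ h1
  funext α
  exact_mod_cast sub_eq_zero.mp (h2 α)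

theorem iSupIndep_lowerWeight (lam : Dual ℂ H) :
    iSupIndep fun c : b.support → ℕ => weightSpace M (lowerWeight b lam c) :=
  (iSupIndep_weightSpace H M).comp (lowerWeight_injective lam)

/-- A weight vector in a sum of subgroups of the weight spaces lies in the corresponding
subgroup. -/
theorem mem_of_mem_iSup_of_mem_weightSpace {lam : Dual ℂ H}
    {P : (b.support → ℕ) → Submodule ℤ M}
    (hP : ∀ c, P c ≤ (weightSpace M (lowerWeight b lam c)).restrictScalars ℤ)
    {c : b.support → ℕ} {w : M} (hw : w ∈ ⨆ d, P d)
    (hc : w ∈ weightSpace M (lowerWeight b lam c)) : w ∈ P c := by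
  have h1 : (⨆ d, P d) ≤ P c ⊔ ⨆ d, ⨆ (_ : d ≠ c), P d := iSup_le fun d => by
    by_cases hd : d = c
    · subst hd
      exact le_sup_left
    · exact le_sup_of_le_right (le_iSup₂_of_le d hd le_rfl)
  obtain ⟨y, hy, z, hz, rfl⟩ := Submodule.mem_sup.mp (h1 hw)
  have hz' : z ∈ ⨆ d, ⨆ (_ : d ≠ c), weightSpace M (lowerWeight b lam d) := by
    have : (⨆ d, ⨆ (_ : d ≠ c), P d) ≤
        (⨆ d, ⨆ (_ : d ≠ c), weightSpace M (lowerWeight b lam d)).restrictScalars ℤ :=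
      iSup₂_le fun d hd => (hP d).trans
        (Submodule.restrictScalars_mono ℤ (le_iSup₂_of_le d hd le_rfl))
    exact this hz
  have hz0 : z = 0 := by
    have := (iSupIndep_lowerWeight lam c).le_bot (Submodule.mem_inf.mpr
      ⟨(Submodule.add_mem_iff_right _ (hP c hy)).mp hc, hz'⟩)
    simpa using this
  rwa [hz0, add_zero]

theorem map_mem_weightSpace (f : M →ₗ[Env 𝔤] M') {μ : Dual ℂ H} {w : M}
    (hw : w ∈ weightSpace M μ) : f w ∈ weightSpace M' μ := fun h => by
  rw [← map_smul, hw h, ← algebraMap_smul (Env 𝔤) (μ h) w, map_smul, algebraMap_smul]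

/-! ### Orbits -/

theorem self_mem_orbit (A : Subalgebra ℤ (Env 𝔤)) (v : M) : v ∈ orbit A v :=
  ⟨1, A.one_mem, (one_smul _ v).symm⟩

theorem smul_mem_orbit {A : Subalgebra ℤ (Env 𝔤)} {v w : M} {u : Env 𝔤} (hu : u ∈ A)
    (hw : w ∈ orbit A v) : u • w ∈ orbit A v := by
  obtain ⟨u', hu', rfl⟩ := hw
  exact ⟨u * u', A.mul_mem hu hu', (mul_smul u u' v).symm⟩

theorem orbit_mono {A B : Subalgebra ℤ (Env 𝔤)} (h : A ≤ B) (v : M) : orbit A v ≤ orbit B v := by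
  rintro _ ⟨u, hu, rfl⟩
  exact ⟨u, h hu, rfl⟩

theorem smul_mem_of_adjoin {S : Set (Env 𝔤)} {N : Submodule ℤ M}
    (hS : ∀ u ∈ S, ∀ w ∈ N, u • w ∈ N) {u : Env 𝔤} (hu : u ∈ Algebra.adjoin ℤ S) :
    ∀ w ∈ N, u • w ∈ N := by
  induction hu using Algebra.adjoin_induction with
  | mem u hu => exact hS u hu
  | algebraMap n =>
    intro w hw
    rw [algebraMap_smul]
    exact N.smul_mem n hw
  | add u u' _ _ h h' =>
    intro w hw
    rw [add_smul]
    exact N.add_mem (h w hw) (h' w hw)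
  | mul u u' _ _ h h' =>
    intro w hw
    rw [mul_smul]
    exact h _ (h' w hw)

theorem orbit_adjoin_le {S : Set (Env 𝔤)} {N : Submodule ℤ M} {v : M} (hv : v ∈ N)
    (hS : ∀ u ∈ S, ∀ w ∈ N, u • w ∈ N) : orbit (Algebra.adjoin ℤ S) v ≤ N := by
  rintro _ ⟨u, hu, rfl⟩
  exact smul_mem_of_adjoin hS hu v hv

/-- Multiplication by an element of the enveloping algebra, as a `ℤ`-linear map. -/
def smulHom (M : Type*) [AddCommGroup M] [Module (Env 𝔤) M] (u : Env 𝔤) : M →ₗ[ℤ] M :=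
  Module.toModuleEnd ℤ (S := Env 𝔤) M u

@[simp] theorem smulHom_apply (u : Env 𝔤) (w : M) : smulHom M u w = u • w := rfl

/-- Multiplication by an element of the enveloping algebra, as a `ℂ`-linear map. -/
def smulEnd (M : Type*) [AddCommGroup M] [Module ℂ M] [Module (Env 𝔤) M]
    [IsScalarTower ℂ (Env 𝔤) M] (u : Env 𝔤) : M →ₗ[ℂ] M :=
  Module.toModuleEnd ℂ (S := Env 𝔤) M u

end Weights

/-! ### Integral forms of highest weight modules -/

section Kostant

/-- The divided power `a ^ n / n!`, which is zero for negative `n`. -/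
def dpowInt {A : Type*} [Ring A] [Algebra ℂ A] (a : A) (n : ℤ) : A :=
  if 0 ≤ n then dpow a n.toNat else 0

section

variable {A : Type*} [Ring A] [Algebra ℂ A] (a : A)

theorem dpowInt_natCast (n : ℕ) : dpowInt a n = dpow a n := by simp [dpowInt]

theorem dpowInt_of_neg {n : ℤ} (h : n < 0) : dpowInt a n = 0 := if_neg (not_le.mpr h)

theorem mul_dpowInt (n : ℤ) : a * dpowInt a n = ((n + 1 : ℤ) : ℂ) • dpowInt a (n + 1) := by
  rcases lt_trichotomy n (-1) with h | rfl | h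
  · rw [dpowInt_of_neg a (by omega), dpowInt_of_neg a (by omega), mul_zero, smul_zero]
  · rw [dpowInt_of_neg a (by omega)]
    simp
  · lift n to ℕ using by omega
    rw [dpowInt_natCast, mul_dpow_succ]
    exact_mod_cast rfl

end

variable {M : Type*} [AddCommGroup M] [Module ℂ M] [Module (Env 𝔤) M] [IsScalarTower ℂ (Env 𝔤) M]
variable {x : H.root → 𝔤} (hx : IsChevalleyBasis x)
include hx

theorem IsChevalleyBasis.lie_coe_neg (α : H.root) (h : H) :
    ⁅(h : 𝔤), x (negRoot α)⁆ = (-(rootSystem H).root α) h • x (negRoot α) := by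
  rw [hx.lie_coe, root_negRoot]

theorem IsChevalleyBasis.smul_pow_succ_smul (α : H.root) {μ : Dual ℂ H} {w : M}
    (hw : w ∈ weightSpace M μ) (n : ℕ) :
    toEnv (x α) • toEnv (x (negRoot α)) ^ (n + 1) • w =
      toEnv (x (negRoot α)) ^ (n + 1) • toEnv (x α) • w +
        ((n + 1) * (μ (coroot α.1) - n) : ℂ) • toEnv (x (negRoot α)) ^ n • w := by
  have key : ∀ n : ℕ, toEnv (coroot α.1 : 𝔤) • toEnv (x (negRoot α)) ^ n • w =
      (μ (coroot α.1) - 2 * n) • toEnv (x (negRoot α)) ^ n • w := fun n => by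
    rw [toEnv_pow_smul_mem_weightSpace (hx.lie_coe_neg α) hw n]
    simp only [LinearMap.add_apply, LinearMap.smul_apply, LinearMap.neg_apply,
      root_apply_coroot_self]
    congr 1
    simp
    ring
  induction n with
  | zero =>
    have := key 0
    simp only [pow_zero, one_smul, zero_add, pow_one] at this ⊢
    rw [toEnv_smul_toEnv_smul, hx.lie_neg, this]
    simp
  | succ n ih =>
    rw [pow_succ', mul_smul, toEnv_smul_toEnv_smul, hx.lie_neg, ih, key, smul_add,
      smul_comm (toEnv (x (negRoot α))) (_ : ℂ), ← mul_smul (toEnv (x (negRoot α))) (_ ^ n) w,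
      ← pow_succ', ← mul_smul (toEnv (x (negRoot α))) (_ ^ (n + 1)), ← pow_succ', add_assoc,
      ← add_smul]
    congr 2
    push_cast
    ring

theorem IsChevalleyBasis.smul_dpowInt_smul (α : H.root) {μ : Dual ℂ H} {w : M}
    (hw : w ∈ weightSpace M μ) (n : ℤ) :
    toEnv (x α) • dpowInt (toEnv (x (negRoot α))) n • w =
      dpowInt (toEnv (x (negRoot α))) n • toEnv (x α) • w +
        (μ (coroot α.1) - n + 1) • dpowInt (toEnv (x (negRoot α))) (n - 1) • w := by
  rcases lt_trichotomy n 0 with h | rfl | h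
  · rw [dpowInt_of_neg _ h, dpowInt_of_neg _ (by omega)]
    simp
  · rw [dpowInt_of_neg (toEnv (x (negRoot α))) (n := 0 - 1) (by omega)]
    simp [dpowInt]
  · obtain ⟨n, rfl⟩ : ∃ k : ℕ, n = (k + 1 : ℕ) := ⟨(n - 1).toNat, by omega⟩
    rw [show ((n + 1 : ℕ) : ℤ) - 1 = n by push_cast; ring, dpowInt_natCast, dpowInt_natCast, dpow,
      dpow, smul_assoc, smul_assoc, smul_assoc, smul_comm (toEnv (x α)) (_ : ℂ),
      hx.smul_pow_succ_smul α hw, smul_add, smul_smul (_ : ℂ) (_ : ℂ), smul_smul (_ : ℂ) (_ : ℂ)]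
    congr 2
    rw [Nat.factorial_succ]
    have := factorial_cast_ne_zero n
    have : (n : ℂ) + 1 ≠ 0 := by exact_mod_cast n.succ_ne_zero
    push_cast
    field_simp
    ring

omit hx in
theorem succ_mul_choose_succ (s : ℤ) (k : ℕ) :
    (k + 1) * Ring.choose s (k + 1) = (s - k) * Ring.choose s k := by
  have := Ring.choose_smul_choose s (Nat.le_succ k)
  rw [Nat.choose_succ_self_right, Nat.succ_sub (le_refl k), Nat.sub_self, Ring.choose_one_right,
    nsmul_eq_mul] at this
  push_cast at this
  linear_combination this

/-- Kostant's commutation formula for `e^(m) f^(n)`, evaluated on a weight vector, where the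
binomial in `h` becomes an integer independent of the weight shift. The range `K` does not depend on
`m`, so that it stays fixed in the induction; superfluous terms vanish because divided powers with
negative index are zero. -/
theorem IsChevalleyBasis.divPow_smul_divPow_smul (α : H.root) {μ : Dual ℂ H} {w : M}
    (hw : w ∈ weightSpace M μ) {c : ℤ} (hc : μ (coroot α.1) = c) (n : ℤ) (K : ℕ) {m : ℕ}
    (hm : m ≤ K) :
    dpow (toEnv (x α)) m • dpowInt (toEnv (x (negRoot α))) n • w =
      ∑ k ∈ Finset.range (K + 1), ((Ring.choose (c + m - n) k : ℤ) : ℂ) •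
        dpowInt (toEnv (x (negRoot α))) (n - k) • dpowInt (toEnv (x α)) (m - k) • w := by
  induction m with
  | zero =>
    rw [Finset.sum_range_succ', Finset.sum_eq_zero]
    · simp [dpowInt]
    · intro k _
      rw [dpowInt_of_neg (toEnv (x α)) (by push_cast; omega)]
      simp
  | succ m ih =>
    set e := toEnv (x α)
    set f := toEnv (x (negRoot α))
    have hm1 : ((m + 1 : ℕ) : ℂ) ≠ 0 := Nat.cast_ne_zero.mpr m.succ_ne_zero
    have hwt : ∀ k : ℕ, e • dpowInt f (n - k) • dpowInt e (m - k) • w =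
        ((m - k + 1 : ℤ) : ℂ) • dpowInt f (n - k) • dpowInt e (m - k + 1) • w +
        ((c + 2 * (m - k) - (n - k) + 1 : ℤ) : ℂ) • dpowInt f (n - k - 1) •
          dpowInt e (m - k) • w := by
      intro k
      by_cases hk : (m : ℤ) - k < 0
      · by_cases hk' : (m : ℤ) - k = -1
        · rw [dpowInt_of_neg e hk, hk']
          simp
        · rw [dpowInt_of_neg e hk, dpowInt_of_neg e (show (m : ℤ) - k + 1 < 0 by omega)]
          simp
      · obtain ⟨j, hj⟩ : ∃ j : ℕ, (m : ℤ) - k = j := ⟨((m : ℤ) - k).toNat, by omega⟩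
        have h1 : dpowInt e (m - k) • w ∈ weightSpace M (μ + j • (rootSystem H).root α) := by
          rw [hj, dpowInt_natCast]
          exact divPow_smul_mem_weightSpace (hx.lie_coe α) hw j
        rw [hx.smul_dpowInt_smul α h1, ← mul_smul e, mul_dpowInt, smul_assoc, smul_comm]
        congr 2
        simp only [LinearMap.add_apply, LinearMap.smul_apply, hc, root_apply_coroot_self, hj]
        push_cast
        rw [nsmul_eq_mul]
        ring
    have h2 : dpow e (m + 1) = ((m + 1 : ℕ) : ℂ)⁻¹ • (e * dpow e m) := by
      rw [mul_dpow_succ, smul_smul, inv_mul_cancel₀ hm1, one_smul]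
    rw [h2, smul_assoc, mul_smul, ih (by omega), inv_smul_eq_iff₀ hm1, Finset.smul_sum]
    have h3 : ∀ k ∈ Finset.range (K + 1), e • ((Ring.choose (c + m - n) k : ℤ) : ℂ) •
        dpowInt f (n - k) • dpowInt e (m - k) • w =
        ((Ring.choose (c + m - n) k * (m - k + 1) : ℤ) : ℂ) • dpowInt f (n - k) •
          dpowInt e (m - k + 1) • w +
        ((Ring.choose (c + m - n) k * (c + 2 * (m - k) - (n - k) + 1) : ℤ) : ℂ) •
          dpowInt f (n - k - 1) • dpowInt e (m - k) • w := by
      intro k _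
      rw [smul_comm, hwt, smul_add, smul_smul (_ : ℂ) (_ : ℂ), smul_smul (_ : ℂ) (_ : ℂ), ← Int.cast_mul, ← Int.cast_mul]
    rw [Finset.sum_congr rfl h3, Finset.sum_add_distrib, Finset.sum_range_succ',
      Finset.sum_range_succ _ K, dpowInt_of_neg e (show (m : ℤ) - K < 0 by omega),
      Finset.sum_range_succ' _ K, smul_add, Finset.smul_sum]
    simp only [zero_smul, smul_zero, add_zero]
    rw [add_right_comm, ← Finset.sum_add_distrib]
    congr 1
    · refine Finset.sum_congr rfl fun k _ => ?_
      have e1 : n - ((k + 1 : ℕ) : ℤ) = n - k - 1 := by push_cast; ring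
      have e2 : (m : ℤ) - ((k + 1 : ℕ) : ℤ) + 1 = m - k := by push_cast; ring
      have e3 : ((m + 1 : ℕ) : ℤ) - ((k + 1 : ℕ) : ℤ) = m - k := by push_cast; ring
      rw [e1, e2, e3, ← add_smul, smul_smul (_ : ℂ) (_ : ℂ)]
      congr 1
      -- Two neighbouring terms of the previous sum contribute to the coefficient; Pascal's rule and
      -- the absorption identity combine them.
      have e4 : c + ((m + 1 : ℕ) : ℤ) - n = c + m - n + 1 := by push_cast; ring
      rw [e4, Ring.choose_succ_succ]
      have := congrArg (Int.cast : ℤ → ℂ) (succ_mul_choose_succ (c + m - n) k)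
      push_cast at this ⊢
      linear_combination -this
    · have e4 : ((m + 1 : ℕ) : ℤ) - ((0 : ℕ) : ℤ) = (m : ℤ) - ((0 : ℕ) : ℤ) + 1 := by
        push_cast; ring
      rw [e4, smul_smul (_ : ℂ) (_ : ℂ)]
      congr 1
      simp

end Kostant

/-! ### Generators -/

section Generators

variable (𝔤) in
/-- The map from a Lie algebra to its enveloping algebra as a linear map. -/
def toEnvHom : 𝔤 →ₗ[ℂ] Env 𝔤 where
  toFun := toEnv
  map_add' := fun y z => map_add _ y z
  map_smul' := fun c y => map_smul _ c y

@[simp] theorem toEnvHom_apply (y : 𝔤) : toEnvHom 𝔤 y = toEnv y := rfl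

attribute [local instance 100] LieRing.ofAssociativeRing in
-- By the universal property the inclusion of `𝔤` lifts to a map into `S`, and its composite with `S
-- ⊆ U` is the identity.
theorem mem_of_toEnv_mem (S : Subalgebra ℂ (Env 𝔤)) (h : ∀ y, toEnv y ∈ S) (u : Env 𝔤) : u ∈ S := by
  let f : 𝔤 →ₗ⁅ℂ⁆ S :=
    { toFun := fun y => ⟨toEnv y, h y⟩
      map_add' := fun y z => Subtype.ext (map_add _ y z)
      map_smul' := fun c y => Subtype.ext (map_smul _ c y)
      map_lie' := fun {y z} => Subtype.ext (toEnv_lie y z) }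
  have h1 : S.val.comp (UniversalEnvelopingAlgebra.lift ℂ f) = AlgHom.id ℂ (Env 𝔤) := by
    apply UniversalEnvelopingAlgebra.hom_ext
    ext y
    change ((UniversalEnvelopingAlgebra.lift ℂ f (toEnv y) : S) : Env 𝔤) = toEnv y
    rw [UniversalEnvelopingAlgebra.lift_ι_apply]
    rfl
  have h2 := DFunLike.congr_fun h1 u
  rw [AlgHom.id_apply] at h2
  rw [← h2]
  exact (UniversalEnvelopingAlgebra.lift ℂ f u).2

variable {b : (rootSystem H).Base} {x : H.root → 𝔤} (hx : IsChevalleyBasis x)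
include hx

theorem IsChevalleyBasis.span_chevalleyLattice :
    Submodule.span ℂ (chevalleyLattice x : Set 𝔤) = ⊤ := by
  have hle : (H.toSubmodule : Submodule ℂ 𝔤) ≤ Submodule.span ℂ (chevalleyLattice x : Set 𝔤) := by
    have h1 := RootPairing.IsRootSystem.span_coroot_eq_top (P := rootSystem H)
    have h2 := congrArg (Submodule.map H.toSubmodule.subtype) h1
    rw [Submodule.map_top, Submodule.range_subtype, Submodule.map_span] at h2
    rw [← h2]
    refine Submodule.span_mono ?_
    rintro _ ⟨_, ⟨α, rfl⟩, rfl⟩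
    exact coroot_mem_chevalleyLattice x α
  have h1 := LieModule.iSup_genWeightSpace_eq_top' ℂ H 𝔤
  rw [← LieSubmodule.toSubmodule_inj, LieSubmodule.iSup_toSubmodule,
    LieSubmodule.top_toSubmodule] at h1
  rw [eq_top_iff, ← h1]
  refine iSup_le fun χ => ?_
  by_cases hχ : χ.IsZero
  · intro y hy
    apply hle
    have : y ∈ LieAlgebra.rootSpace H (0 : H → ℂ) := by
      have h0 : (χ : H → ℂ) = 0 := hχ
      rw [h0] at hy
      exact hy
    rw [LieAlgebra.rootSpace_zero_eq] at this
    exact this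
  · intro y hy
    let α : H.root := ⟨χ, by simpa using hχ⟩
    obtain ⟨c, rfl⟩ := hx.exists_eq_smul α (y := y) fun h =>
      lie_eq_smul_of_mem_rootSpace hy h
    exact Submodule.smul_mem _ _ (Submodule.subset_span (mem_chevalleyLattice x α))

/-- A complex subalgebra of the enveloping algebra that contains all root vectors is everything. -/
theorem IsChevalleyBasis.mem_of_root_mem (S : Subalgebra ℂ (Env 𝔤)) (h : ∀ α, toEnv (x α) ∈ S)
    (u : Env 𝔤) : u ∈ S := by
  refine mem_of_toEnv_mem S (fun y => ?_) u
  have hy : y ∈ Submodule.span ℂ (chevalleyLattice x : Set 𝔤) := by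
    rw [hx.span_chevalleyLattice]; trivial
  have h1 : Submodule.span ℂ (chevalleyLattice x : Set 𝔤) ≤
      (Subalgebra.toSubmodule S).comap (toEnvHom 𝔤) := by
    rw [Submodule.span_le]
    intro z hz
    induction hz using Submodule.span_induction with
    | mem z hz =>
      rcases hz with ⟨α, rfl⟩ | ⟨α, rfl⟩
      · exact h α
      · have := toEnv_lie (x α) (x (negRoot α))
        rw [hx.lie_neg] at this
        change toEnv _ ∈ S
        rw [this]
        exact S.sub_mem (S.mul_mem (h _) (h _)) (S.mul_mem (h _) (h _))
    | zero => exact Submodule.zero_mem _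
    | add y z _ _ hy hz => exact Submodule.add_mem _ hy hz
    | smul n z _ hz =>
      have := Submodule.smul_mem _ (n : ℂ) hz
      rwa [Int.cast_smul_eq_zsmul] at this
  exact h1 hy

theorem IsChevalleyBasis.span_kostantForm :
    Submodule.span ℂ (kostantForm x : Set (Env 𝔤)) = ⊤ := by
  rw [eq_top_iff]
  intro u _
  have h1 : u ∈ Algebra.adjoin ℂ (kostantForm x : Set (Env 𝔤)) :=
    hx.mem_of_root_mem _ (fun α => Algebra.subset_adjoin (by
      have : divPow (x α) 1 ∈ kostantForm x := Algebra.subset_adjoin ⟨α, 1, rfl⟩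
      simpa [divPow] using this)) u
  rw [← Subalgebra.mem_toSubmodule, Algebra.adjoin_eq_span] at h1
  have h2 : (Submonoid.closure (kostantForm x : Set (Env 𝔤)) : Set (Env 𝔤)) = kostantForm x :=
    congrArg SetLike.coe (Submonoid.closure_eq (kostantForm x).toSubmonoid)
  rwa [h2] at h1

theorem IsChevalleyBasis.commute_simple {γ δ : H.root} (hγ : γ ∈ b.support) (hδ : δ ∈ b.support)
    (hne : γ ≠ δ) : Commute (toEnv (x γ)) (toEnv (x (negRoot δ))) := by
  have h1 : ⁅x γ, x (negRoot δ)⁆ = 0 := by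
    apply hx.lie_eq_zero
    · rw [root_negRoot, ← sub_eq_add_neg, sub_ne_zero]
      exact (rootSystem H).root.injective.ne hne
    · rw [root_negRoot, ← sub_eq_add_neg]
      exact b.sub_notMem_range_root hγ hδ
  have := toEnv_lie (x γ) (x (negRoot δ))
  rw [h1, toEnv, map_zero] at this
  exact sub_eq_zero.mp this.symm

omit hx in
theorem commute_divPow {y z : 𝔤} (h : Commute (toEnv y) (toEnv z)) (m n : ℕ) :
    Commute (divPow y m) (divPow z n) :=
  ((h.pow_pow m n).smul_left _).smul_right _

end Generators

/-! ### Highest weight vectors -/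

section Highest

variable {M : Type*} [AddCommGroup M] [Module ℂ M] [Module (Env 𝔤) M] [IsScalarTower ℂ (Env 𝔤) M]

variable (b : (rootSystem H).Base) (x : H.root → 𝔤) in
/-- A vector of weight `lam` that is annihilated by the simple root vectors. -/
structure IsHighest (lam : Dual ℂ H) (v : M) : Prop where
  mem_weightSpace : v ∈ weightSpace M lam
  smul_eq_zero : ∀ γ ∈ b.support, toEnv (x γ) • v = 0

variable {b : (rootSystem H).Base} {x : H.root → 𝔤} (hx : IsChevalleyBasis x)

omit hx in
theorem root_mem_weightLattice (α : H.root) : (rootSystem H).root α ∈ weightLattice H :=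
  fun β => ⟨_, root_apply_coroot_eq α β⟩

omit hx in
theorem lowerWeight_mem_weightLattice {lam : Dual ℂ H} (h : lam ∈ weightLattice H)
    (c : b.support → ℕ) : lowerWeight b lam c ∈ weightLattice H :=
  sub_mem h (sum_mem fun _ _ => nsmul_mem (root_mem_weightLattice _) _)

include hx

open Classical in
theorem IsChevalleyBasis.divPow_smul_mem_lowerWeight (γ : b.support) (n : ℕ) {lam : Dual ℂ H}
    {c : b.support → ℕ} {w : M} (hw : w ∈ weightSpace M (lowerWeight b lam c)) :
    divPow (x (negRoot γ.1)) n • w ∈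
      weightSpace M (lowerWeight b lam (c + Pi.single γ n)) := by
  rw [lowerWeight_add, lowerWeight_single]
  exact divPow_smul_mem_weightSpace (hx.lie_coe_neg γ.1) hw n

open Classical in
omit hx in
-- Induction over monomials in the negative simple divided powers that records the weight. `P c` is
-- typically a property of vectors of weight `lowerWeight b lam c`.
theorem orbit_simpleFormNeg_le_iSup {P : (b.support → ℕ) → Submodule ℤ M} {v : M} (hv : v ∈ P 0)
    (hP : ∀ c, ∀ w ∈ P c, ∀ (γ : b.support) (n : ℕ),
      divPow (x (negRoot γ.1)) n • w ∈ P (c + Pi.single γ n)) :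
    orbit (simpleFormNeg b x) v ≤ ⨆ c, P c := by
  refine orbit_adjoin_le (Submodule.mem_iSup_of_mem 0 hv) ?_
  rintro _ ⟨γ, hγ, n, rfl⟩ w hw
  have : (⨆ c, P c) ≤ (⨆ c, P c).comap (smulHom M (divPow (x (negRoot γ)) n)) :=
    iSup_le fun c w hw => Submodule.mem_iSup_of_mem _ (hP c w hw ⟨γ, hγ⟩ n)
  exact this hw

omit hx in
theorem divPow_mem_simpleFormNeg (γ : b.support) (n : ℕ) :
    divPow (x (negRoot γ.1)) n ∈ simpleFormNeg b x :=
  Algebra.subset_adjoin ⟨γ.1, γ.2, n, rfl⟩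

omit hx in
theorem simpleFormNeg_le : simpleFormNeg b x ≤ kostantFormNeg b x := by
  refine Algebra.adjoin_mono ?_
  rintro _ ⟨γ, hγ, n, rfl⟩
  exact ⟨γ, n, b.isPos_of_mem_support hγ, rfl⟩

omit hx in
theorem kostantFormNeg_le : kostantFormNeg b x ≤ kostantForm x := by
  refine Algebra.adjoin_mono ?_
  rintro _ ⟨γ, n, -, rfl⟩
  exact ⟨_, n, rfl⟩

theorem IsChevalleyBasis.orbit_le_iSup {lam : Dual ℂ H} {v : M} (hv : v ∈ weightSpace M lam) :
    orbit (simpleFormNeg b x) v ≤ ⨆ c : b.support → ℕ, (orbit (simpleFormNeg b x) v ⊓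
      (weightSpace M (lowerWeight b lam c)).restrictScalars ℤ) := by
  refine orbit_simpleFormNeg_le_iSup ⟨self_mem_orbit _ _, ?_⟩ ?_
  · rw [lowerWeight_zero]
    exact hv
  · rintro c w ⟨hw, hw'⟩ γ n
    exact ⟨smul_mem_orbit (divPow_mem_simpleFormNeg γ n) hw,
      hx.divPow_smul_mem_lowerWeight γ n hw'⟩

omit hx in
theorem dpowInt_smul_mem {N : Submodule ℤ M} {y : 𝔤} {w : M} (h : ∀ n, divPow y n • w ∈ N) (n : ℤ) :
    dpowInt (toEnv y) n • w ∈ N := by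
  rcases lt_or_ge n 0 with hn | hn
  · rw [dpowInt_of_neg _ hn, zero_smul]
    exact N.zero_mem
  · lift n to ℕ using hn
    rw [dpowInt_natCast]
    exact h n

open Classical in
/-- **Kostant's theorem** for highest weight modules: the orbit of a highest weight vector of
integral weight under the negative part of the Kostant form is stable under the Kostant form. -/
theorem IsChevalleyBasis.divPow_smul_mem_orbit {lam : Dual ℂ H} (hlam : lam ∈ weightLattice H)
    {v : M} (hv : IsHighest b x lam v) (γ : b.support) (m : ℕ) {w : M}
    (hw : w ∈ orbit (simpleFormNeg b x) v) :
    divPow (x γ.1) m • w ∈ orbit (simpleFormNeg b x) v := by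
  let N := orbit (simpleFormNeg b x) v
  -- `Q` consists of the vectors that all positive simple divided powers send into `N`. The claim
  -- for all simple roots and all `m` at once is what the induction needs.
  let Q : Submodule ℤ M := ⨅ γ : b.support, ⨅ m : ℕ, N.comap (smulHom M (divPow (x γ.1) m))
  have hQ : ∀ {w}, w ∈ Q ↔ ∀ (γ : b.support) (m : ℕ), divPow (x γ.1) m • w ∈ N := by
    intro w
    simp only [Q, Submodule.mem_iInf, Submodule.mem_comap, smulHom_apply]
  let P : (b.support → ℕ) → Submodule ℤ M := fun c =>
    (N ⊓ (weightSpace M (lowerWeight b lam c)).restrictScalars ℤ) ⊓ Q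
  have hP : ∀ {c w}, w ∈ P c ↔ (w ∈ N ∧ w ∈ weightSpace M (lowerWeight b lam c)) ∧ w ∈ Q :=
    fun {c w} => Iff.rfl
  have h0 : v ∈ P 0 := by
    refine hP.mpr ⟨⟨self_mem_orbit _ _, ?_⟩, hQ.mpr fun γ m => ?_⟩
    · rw [lowerWeight_zero]
      exact hv.mem_weightSpace
    · cases m with
      | zero =>
        rw [divPow_eq_dpow, dpow_zero, one_smul]
        exact self_mem_orbit _ _
      | succ m =>
        rw [divPow, smul_assoc, pow_succ, mul_smul, hv.smul_eq_zero γ.1 γ.2, smul_zero, smul_zero]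
        exact N.zero_mem
  have h1 : ∀ c, ∀ w ∈ P c, ∀ (δ : b.support) (n : ℕ),
      divPow (x (negRoot δ.1)) n • w ∈ P (c + Pi.single δ n) := by
    intro c w hw δ n
    obtain ⟨⟨hw, hw'⟩, hw''⟩ := hP.mp hw
    refine hP.mpr ⟨⟨smul_mem_orbit (divPow_mem_simpleFormNeg δ n) hw,
      hx.divPow_smul_mem_lowerWeight δ n hw'⟩, hQ.mpr fun γ m => ?_⟩
    by_cases hγδ : γ = δ
    · subst hγδ
      -- Integrality of the weight makes the binomial coefficients of the commutation formula
      -- integers.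
      obtain ⟨k, hk⟩ := lowerWeight_mem_weightLattice hlam c γ.1
      rw [divPow_eq_dpow, divPow_eq_dpow, ← dpowInt_natCast _ n,
        hx.divPow_smul_divPow_smul γ.1 hw' hk n m le_rfl]
      refine N.sum_mem fun j _ => ?_
      rw [Int.cast_smul_eq_zsmul]
      refine N.smul_mem _ ?_
      refine dpowInt_smul_mem (fun i => smul_mem_orbit (divPow_mem_simpleFormNeg γ i) ?_) _
      exact dpowInt_smul_mem (fun i => hQ.mp hw'' γ i) _
    · have := commute_divPow (hx.commute_simple γ.2 δ.2 (fun h => hγδ (Subtype.ext h))) m n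
      rw [← mul_smul, this.eq, mul_smul]
      exact smul_mem_orbit (divPow_mem_simpleFormNeg δ n) (hQ.mp hw'' γ m)
  have h2 : w ∈ Q := iSup_le (fun c => (inf_le_right : P c ≤ Q))
    (orbit_simpleFormNeg_le_iSup h0 h1 hw)
  exact hQ.mp h2 γ m

theorem IsChevalleyBasis.orbit_kostantForm_eq {lam : Dual ℂ H} (hlam : lam ∈ weightLattice H)
    {v : M} (hv : IsHighest b x lam v) :
    orbit (kostantForm x) v = orbit (simpleFormNeg b x) v := by
  apply le_antisymm
  · rw [hx.kostantForm_eq (b := b)]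
    refine orbit_adjoin_le (self_mem_orbit _ _) ?_
    rintro _ ⟨γ, hγ, n, rfl | rfl⟩ w hw
    · exact hx.divPow_smul_mem_orbit hlam hv ⟨γ, hγ⟩ n hw
    · exact smul_mem_orbit (divPow_mem_simpleFormNeg ⟨γ, hγ⟩ n) hw
  · exact orbit_mono (simpleFormNeg_le.trans kostantFormNeg_le) v

theorem IsChevalleyBasis.orbit_kostantFormNeg_eq {lam : Dual ℂ H} (hlam : lam ∈ weightLattice H)
    {v : M} (hv : IsHighest b x lam v) :
    orbit (kostantFormNeg b x) v = orbit (simpleFormNeg b x) v :=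
  le_antisymm ((orbit_mono kostantFormNeg_le v).trans (hx.orbit_kostantForm_eq hlam hv).le)
    (orbit_mono simpleFormNeg_le v)

/-- The submodule generated by a highest weight vector of integral weight is spanned by its
integral form. -/
theorem IsChevalleyBasis.smul_mem_span_orbit {lam : Dual ℂ H} (hlam : lam ∈ weightLattice H)
    {v : M} (hv : IsHighest b x lam v) (u : Env 𝔤) :
    u • v ∈ Submodule.span ℂ (orbit (simpleFormNeg b x) v : Set M) := by
  have hu : u ∈ Submodule.span ℂ (kostantForm x : Set (Env 𝔤)) := by
    rw [hx.span_kostantForm]; trivial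
  have h1 : Submodule.span ℂ (kostantForm x : Set (Env 𝔤)) ≤
      (Submodule.span ℂ (orbit (simpleFormNeg b x) v : Set M)).comap
        ((LinearMap.toSpanSingleton (Env 𝔤) M v).restrictScalars ℂ) := by
    rw [Submodule.span_le]
    intro u hu
    apply Submodule.subset_span
    rw [← hx.orbit_kostantForm_eq hlam hv]
    exact ⟨u, hu, rfl⟩
  exact h1 hu

end Highest

/-! ### Sums of weight spaces -/

section WeightSum

variable {M : Type*} [AddCommGroup M] [Module ℂ M] [Module (Env 𝔤) M] [IsScalarTower ℂ (Env 𝔤) M]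
  {M' : Type*} [AddCommGroup M'] [Module ℂ M'] [Module (Env 𝔤) M'] [IsScalarTower ℂ (Env 𝔤) M']
  {b : (rootSystem H).Base} {x : H.root → 𝔤} (hx : IsChevalleyBasis x)

variable (M b) in
/-- The sum of the weight spaces of weight `lam - ∑ c_α α` with `c` in a given set. -/
def weightSum (lam : Dual ℂ H) (S : Set (b.support → ℕ)) : Submodule ℂ M :=
  ⨆ c : S, weightSpace M (lowerWeight b lam c)

theorem mem_weightSum {lam : Dual ℂ H} {S : Set (b.support → ℕ)} {c : b.support → ℕ} (hc : c ∈ S)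
    {w : M} (hw : w ∈ weightSpace M (lowerWeight b lam c)) : w ∈ weightSum M b lam S :=
  Submodule.mem_iSup_of_mem (⟨c, hc⟩ : S) hw

theorem weightSum_le {lam : Dual ℂ H} {S : Set (b.support → ℕ)} {P : Submodule ℂ M}
    (h : ∀ c ∈ S, ∀ w ∈ weightSpace M (lowerWeight b lam c), w ∈ P) : weightSum M b lam S ≤ P :=
  iSup_le fun c w hw => h c.1 c.2 w hw

theorem weightSum_mono (lam : Dual ℂ H) {S S' : Set (b.support → ℕ)} (h : S ⊆ S') :
    weightSum M b lam S ≤ weightSum M b lam S' :=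
  weightSum_le fun _ hc _ hw => mem_weightSum (h hc) hw

theorem eq_zero_of_mem_weightSum {lam : Dual ℂ H} {S S' : Set (b.support → ℕ)} (h : Disjoint S S')
    {w : M} (hw : w ∈ weightSum M b lam S) (hw' : w ∈ weightSum M b lam S') : w = 0 := by
  have h1 : Disjoint (weightSum M b lam S) (weightSum M b lam S') := by
    rw [weightSum, weightSum, iSup_subtype, iSup_subtype]
    exact (iSupIndep_lowerWeight (b := b) (M := M) lam).disjoint_biSup_biSup h
  exact Submodule.disjoint_def.mp h1 w hw hw'

theorem map_mem_weightSum (f : M →ₗ[Env 𝔤] M') {lam : Dual ℂ H} {S : Set (b.support → ℕ)} {w : M}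
    (hw : w ∈ weightSum M b lam S) : f w ∈ weightSum M' b lam S := by
  have h1 : weightSum M b lam S ≤ (weightSum M' b lam S).comap (f.restrictScalars ℂ) :=
    weightSum_le fun c hc w hw => mem_weightSum hc (map_mem_weightSpace f hw)
  exact h1 hw

include hx

open Classical in
theorem IsChevalleyBasis.divPow_smul_mem_weightSum {lam : Dual ℂ H} {S S' : Set (b.support → ℕ)}
    (γ : b.support) (n : ℕ) (hS : ∀ c ∈ S, c + Pi.single γ n ∈ S') {w : M}
    (hw : w ∈ weightSum M b lam S) : divPow (x (negRoot γ.1)) n • w ∈ weightSum M b lam S' := by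
  have h1 : weightSum M b lam S ≤
      (weightSum M b lam S').comap (smulEnd M (divPow (x (negRoot γ.1)) n)) :=
    weightSum_le fun c hc w hw =>
      mem_weightSum (hS c hc) (hx.divPow_smul_mem_lowerWeight γ n hw)
  exact h1 hw

theorem IsChevalleyBasis.orbit_le_weightSum {lam : Dual ℂ H} {v : M}
    (hv : v ∈ weightSpace M lam) {w : M} (hw : w ∈ orbit (simpleFormNeg b x) v) :
    w ∈ weightSum M b lam Set.univ := by
  have h1 := hx.orbit_le_iSup hv hw
  have h2 : (⨆ c : b.support → ℕ, (orbit (simpleFormNeg b x) v ⊓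
      (weightSpace M (lowerWeight b lam c)).restrictScalars ℤ)) ≤
      (weightSum M b lam Set.univ).restrictScalars ℤ :=
    iSup_le fun c w hw => mem_weightSum (Set.mem_univ c) hw.2
  exact h2 h1

/-- A module generated by a highest weight vector is the sum of its weight spaces. -/
theorem IsChevalleyBasis.smul_mem_weightSum {lam : Dual ℂ H} (hlam : lam ∈ weightLattice H)
    {v : M} (hv : IsHighest b x lam v) (u : Env 𝔤) : u • v ∈ weightSum M b lam Set.univ :=
  (Submodule.span_le.mpr fun _ hz => hx.orbit_le_weightSum hv.mem_weightSpace hz)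
    (hx.smul_mem_span_orbit hlam hv u)

end WeightSum

/-! ### Verma modules -/

section Verma

variable {M : Type*} [AddCommGroup M] [Module ℂ M] [Module (Env 𝔤) M] [IsScalarTower ℂ (Env 𝔤) M]

variable (b : (rootSystem H).Base) (x : H.root → 𝔤)

/-- The complex subalgebra of the enveloping algebra generated by the root vectors that belong to
the negatives of the simple roots. -/
def negAlgebra : Subalgebra ℂ (Env 𝔤) :=
  Algebra.adjoin ℂ {u | ∃ γ ∈ b.support, u = toEnv (x (negRoot γ))}

variable {b x}

theorem toEnv_mem_negAlgebra {γ : H.root} (hγ : γ ∈ b.support) :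
    toEnv (x (negRoot γ)) ∈ negAlgebra b x := Algebra.subset_adjoin ⟨γ, hγ, rfl⟩

theorem divPow_mem {S : Subalgebra ℂ (Env 𝔤)} {y : 𝔤} (h : toEnv y ∈ S) (n : ℕ) :
    divPow y n ∈ S := S.smul_mem (S.pow_mem h n) _

theorem simpleFormNeg_le_negAlgebra {u : Env 𝔤} (hu : u ∈ simpleFormNeg b x) :
    u ∈ negAlgebra b x := by
  have : simpleFormNeg b x ≤ (negAlgebra b x).restrictScalars ℤ := by
    refine Algebra.adjoin_le ?_
    rintro _ ⟨γ, hγ, n, rfl⟩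
    exact divPow_mem (toEnv_mem_negAlgebra hγ) n
  exact this hu

variable (hx : IsChevalleyBasis x)

include hx

/-- The structure constant is plus or minus a positive integer, hence invertible over `ℂ`. By
induction on positive roots, the simple root vectors thus generate all the others of the same sign.
-/
theorem IsChevalleyBasis.exists_smul_lie {i j k : H.root}
    (hk : (rootSystem H).root k = (rootSystem H).root i + (rootSystem H).root j) :
    ∃ c : ℂ, x k = c • ⁅x i, x j⁆ := by
  have h := (rootSystem H).linearIndependent_of_add_mem_range_root' (i := i) (j := j) ⟨k, hk⟩
  have h1 : (((rootSystem H).chainBotCoeff i j + 1 : ℕ) : ℂ) ≠ 0 := Nat.cast_ne_zero.mpr (by omega)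
  rcases hx.lie_eq h (by rw [hk, add_comm]) with h2 | h2
  · refine ⟨(((rootSystem H).chainBotCoeff i j + 1 : ℕ) : ℂ)⁻¹, ?_⟩
    rw [h2, eq_inv_smul_iff₀ h1, Nat.cast_smul_eq_nsmul]
  · refine ⟨-(((rootSystem H).chainBotCoeff i j + 1 : ℕ) : ℂ)⁻¹, ?_⟩
    rw [h2, neg_smul_neg, eq_inv_smul_iff₀ h1, Nat.cast_smul_eq_nsmul]

theorem IsChevalleyBasis.neg_mem_negAlgebra {α : H.root} (hα : b.IsPos α) :
    toEnv (x (negRoot α)) ∈ negAlgebra b x := by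
  refine hα.induction_on_add (fun i hi => toEnv_mem_negAlgebra hi) fun i j k hk hi hj => ?_
  obtain ⟨c, hc⟩ := hx.exists_smul_lie (i := negRoot i) (j := negRoot j) (k := negRoot k) (by
    rw [root_negRoot, root_negRoot, root_negRoot, hk, neg_add])
  rw [hc, toEnv_smul, toEnv_lie]
  have hj' := toEnv_mem_negAlgebra (x := x) hj
  exact Subalgebra.smul_mem _ (sub_mem (mul_mem hi hj') (mul_mem hj' hi)) c

theorem IsChevalleyBasis.smul_eq_zero_of_isPos {lam : Dual ℂ H} {v : M} (hv : IsHighest b x lam v)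
    {α : H.root} (hα : b.IsPos α) : toEnv (x α) • v = 0 := by
  refine hα.induction_on_add (fun i hi => hv.smul_eq_zero i hi) fun i j k hk hi hj => ?_
  obtain ⟨c, hc⟩ := hx.exists_smul_lie hk
  rw [hc, toEnv_smul, toEnv_lie, smul_assoc, sub_smul, mul_smul, mul_smul, hi,
    hv.smul_eq_zero j hj, smul_zero, smul_zero, sub_zero, smul_zero]

omit hx in
theorem smul_vermaVector (lam : Dual ℂ H) (u : Env 𝔤) :
    u • vermaVector b x lam = (vermaIdeal b x lam).mkQ u := by
  rw [vermaVector, ← map_smul, smul_eq_mul, mul_one]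

omit hx in
theorem exists_eq_smul_vermaVector (lam : Dual ℂ H) (w : Verma b x lam) :
    ∃ u : Env 𝔤, w = u • vermaVector b x lam := by
  obtain ⟨u, rfl⟩ := (vermaIdeal b x lam).mkQ_surjective w
  exact ⟨u, (smul_vermaVector lam u).symm⟩

omit hx in
theorem isHighest_vermaVector (lam : Dual ℂ H) :
    IsHighest b x lam (vermaVector b x lam) where
  mem_weightSpace := by
    have h1 : (⊤ : Submodule ℂ H) ≤
        LinearMap.ker ((((LinearMap.toSpanSingleton (Env 𝔤) (Verma b x lam)
          (vermaVector b x lam)).restrictScalars ℂ) ∘ₗ (toEnvHom 𝔤) ∘ₗ H.toSubmodule.subtype) -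
            (LinearMap.toSpanSingleton ℂ (Verma b x lam) (vermaVector b x lam)) ∘ₗ lam) := by
      rw [← RootPairing.IsRootSystem.span_coroot_eq_top (P := rootSystem H)]
      change (rootSystem H).corootSpan ℂ ≤ _
      rw [← b.span_coroot_support, Submodule.span_le]
      rintro _ ⟨γ, hγ, rfl⟩
      rw [SetLike.mem_coe, LinearMap.mem_ker, LinearMap.sub_apply, sub_eq_zero]
      change toEnv (coroot γ.1 : 𝔤) • vermaVector b x lam =
        lam (coroot γ.1) • vermaVector b x lam
      rw [← algebraMap_smul (Env 𝔤) (lam (coroot γ.1)), ← sub_eq_zero, ← sub_smul,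
        smul_vermaVector, Submodule.mkQ_apply, Submodule.Quotient.mk_eq_zero]
      exact Submodule.subset_span (Or.inr ⟨γ, hγ, rfl⟩)
    intro h
    have := h1 (Submodule.mem_top : h ∈ _)
    rw [LinearMap.mem_ker, LinearMap.sub_apply, sub_eq_zero] at this
    exact this
  smul_eq_zero γ hγ := by
    rw [smul_vermaVector, Submodule.mkQ_apply, Submodule.Quotient.mk_eq_zero]
    exact Submodule.subset_span (Or.inl ⟨γ, b.isPos_of_mem_support hγ, rfl⟩)

theorem IsChevalleyBasis.vermaIdeal_le {lam : Dual ℂ H} {v : M} (hv : IsHighest b x lam v) :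
    vermaIdeal b x lam ≤ LinearMap.ker (LinearMap.toSpanSingleton (Env 𝔤) M v) := by
  rw [vermaIdeal, Submodule.span_le]
  rintro _ (⟨α, hα, rfl⟩ | ⟨γ, hγ, rfl⟩)
  · exact hx.smul_eq_zero_of_isPos hv hα
  · rw [SetLike.mem_coe, LinearMap.mem_ker, LinearMap.toSpanSingleton_apply, sub_smul,
      algebraMap_smul, hv.mem_weightSpace, sub_self]

/-- The homomorphism from a Verma module to a module with a highest weight vector. -/
def IsChevalleyBasis.vermaHom {lam : Dual ℂ H} {v : M} (hv : IsHighest b x lam v) :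
    Verma b x lam →ₗ[Env 𝔤] M :=
  (vermaIdeal b x lam).liftQ (LinearMap.toSpanSingleton (Env 𝔤) M v) (hx.vermaIdeal_le hv)

@[simp] theorem IsChevalleyBasis.vermaHom_vermaVector {lam : Dual ℂ H} {v : M}
    (hv : IsHighest b x lam v) : hx.vermaHom hv (vermaVector b x lam) = v := by
  rw [vermaVector, IsChevalleyBasis.vermaHom, Submodule.mkQ_apply, Submodule.liftQ_apply,
    LinearMap.toSpanSingleton_apply, one_smul]

omit hx in
theorem IsMaximalVector.isHighest {lam : Dual ℂ H} {v : M} (hv : IsMaximalVector b lam v)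
    (hx : IsChevalleyBasis x) : IsHighest b x lam v :=
  ⟨hv.mem_weightSpace, fun γ hγ => hv.smul_eq_zero γ (b.isPos_of_mem_support hγ) _
    (hx.mem_rootSpace γ)⟩

/-- There is a linear functional on the Verma module that does not vanish on the generator but
vanishes on the images of the simple negative root vectors. -/
theorem IsChevalleyBasis.exists_dual_verma {lam : Dual ℂ H} (hlam : lam ∈ weightLattice H)
    (h0 : vermaVector b x lam ≠ 0) : ∃ ε : Verma b x lam →ₗ[ℂ] ℂ, ε (vermaVector b x lam) ≠ 0 ∧
      ∀ γ ∈ b.support, ∀ w, ε (toEnv (x (negRoot γ)) • w) = 0 := by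
  have hv : vermaVector b x lam ∈ weightSum (Verma b x lam) b lam {0} :=
    mem_weightSum (Set.mem_singleton 0)
      (by rw [lowerWeight_zero]; exact (isHighest_vermaVector lam).mem_weightSpace)
  -- The generator has weight `lam`, while the negative simple root vectors map into the sum of the
  -- weight spaces strictly below; a functional separating the two exists as soon as the generator
  -- is nonzero.
  have hK : vermaVector b x lam ∉ weightSum (Verma b x lam) b lam {0}ᶜ :=
    fun h => h0 (eq_zero_of_mem_weightSum disjoint_compl_right hv h)
  obtain ⟨ε, hε, hε'⟩ := Submodule.exists_le_ker_of_notMem hK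
  refine ⟨ε, hε, fun γ hγ w => ?_⟩
  obtain ⟨u, rfl⟩ := exists_eq_smul_vermaVector lam w
  have h1 := hx.divPow_smul_mem_weightSum ⟨γ, hγ⟩ 1 (S' := {0}ᶜ) (fun c _ h => by
    have := congrFun h ⟨γ, hγ⟩
    simp at this) (hx.smul_mem_weightSum hlam (isHighest_vermaVector (b := b) lam) u)
  have h2 : divPow (x (negRoot γ)) 1 = toEnv (x (negRoot γ)) := by simp [divPow]
  rw [h2] at h1
  exact hε' h1

end Verma

/-! ### Annihilators of highest weight vectors -/

section Tensor

/-- A module over the enveloping algebra as a module over the Lie algebra. -/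
abbrev lieRingModuleOfEnv (M : Type*) [AddCommGroup M] [Module (Env 𝔤) M] :
    LieRingModule 𝔤 M where
  bracket y w := toEnv y • w
  add_lie y z w := by
    rw [← add_smul, ← map_add]
  lie_add y v w := smul_add _ v w
  leibniz_lie y z w := by
    change toEnv y • toEnv z • w = toEnv ⁅y, z⁆ • w + toEnv z • toEnv y • w
    rw [toEnv_lie, sub_smul, mul_smul, mul_smul, sub_add_cancel]

theorem lieModuleOfEnv (M : Type*) [AddCommGroup M] [Module ℂ M] [Module (Env 𝔤) M]
    [IsScalarTower ℂ (Env 𝔤) M] :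
    letI := lieRingModuleOfEnv (𝔤 := 𝔤) M
    LieModule ℂ 𝔤 M :=
  letI := lieRingModuleOfEnv (𝔤 := 𝔤) M
  { smul_lie := fun c y w => by
      change toEnv (c • y) • w = c • toEnv y • w
      rw [toEnv_smul, smul_assoc]
    lie_smul := fun c y w => by
      change toEnv y • c • w = c • toEnv y • w
      rw [smul_comm] }

variable {b : (rootSystem H).Base} {x : H.root → 𝔤} (hx : IsChevalleyBasis x)
include hx

variable {M : Type*} [AddCommGroup M] [Module ℂ M] [Module (Env 𝔤) M] [IsScalarTower ℂ (Env 𝔤) M]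
  {N : Type*} [AddCommGroup N] [Module ℂ N] [Module (Env 𝔤) N] [IsScalarTower ℂ (Env 𝔤) N]

open TensorProduct in
-- The vector `n ⊗ m` has highest weight `lam + μ`, so it satisfies the relation. Contraction of the
-- second factor with `ε` commutes with the negative algebra, because `ε` kills the terms in which a
-- negative root vector acts on the second factor; it sends `u • (n ⊗ m)` to `ε m • u • n`.
theorem IsChevalleyBasis.smul_eq_zero_of_functional {lam μ : Dual ℂ H} {m : M} {n : N}
    (hm : IsHighest b x μ m) (hn : IsHighest b x lam n) (ε : M →ₗ[ℂ] ℂ) (hε : ε m ≠ 0)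
    (hε' : ∀ γ ∈ b.support, ∀ w, ε (toEnv (x (negRoot γ)) • w) = 0) {u : Env 𝔤}
    (hu : u ∈ negAlgebra b x) (h0 : u • vermaVector b x (lam + μ) = 0) : u • n = 0 := by
  let _ := lieRingModuleOfEnv (𝔤 := 𝔤) M
  let _ := lieRingModuleOfEnv (𝔤 := 𝔤) N
  have := lieModuleOfEnv (𝔤 := 𝔤) M
  have := lieModuleOfEnv (𝔤 := 𝔤) N
  let T := EnvModule 𝔤 (N ⊗[ℂ] M)
  have hT : ∀ (y : 𝔤) (a : N) (c : M), toEnv y • (EnvModule.of 𝔤 (a ⊗ₜ[ℂ] c) : T) =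
      EnvModule.of 𝔤 ((toEnv y • a) ⊗ₜ[ℂ] c + a ⊗ₜ[ℂ] (toEnv y • c)) := fun y a c => by
    rw [EnvModule.toEnv_smul, TensorProduct.LieModule.lie_tmul_right]
    rfl
  have ht : IsHighest b x (lam + μ) (EnvModule.of 𝔤 (n ⊗ₜ[ℂ] m) : T) := by
    constructor
    · intro h
      rw [hT, hn.mem_weightSpace, hm.mem_weightSpace, ← TensorProduct.smul_tmul',
        TensorProduct.tmul_smul, ← add_smul, map_smul]
      rfl
    · intro γ hγ
      rw [hT, hn.smul_eq_zero γ hγ, hm.smul_eq_zero γ hγ, TensorProduct.zero_tmul,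
        TensorProduct.tmul_zero, add_zero, map_zero]
  have h1 : u • (EnvModule.of 𝔤 (n ⊗ₜ[ℂ] m) : T) = 0 := by
    rw [← hx.vermaHom_vermaVector ht, ← map_smul, h0, map_zero]
  let E : T →ₗ[ℂ] N := (TensorProduct.rid ℂ N).toLinearMap ∘ₗ LinearMap.lTensor N ε ∘ₗ
    (EnvModule.of 𝔤).symm.toLinearMap
  have hE : ∀ a c, E (EnvModule.of 𝔤 (a ⊗ₜ[ℂ] c)) = ε c • a := fun a c => by
    simp [E]
  have hEf : ∀ γ ∈ b.support, ∀ t : T, E (toEnv (x (negRoot γ)) • t) =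
      toEnv (x (negRoot γ)) • E t := by
    intro γ hγ t
    obtain ⟨t, rfl⟩ := (EnvModule.of 𝔤).surjective t
    induction t using TensorProduct.induction_on with
    | zero => simp
    | tmul a c =>
      rw [hT, map_add, map_add, hE, hE, hE, hε' γ hγ, zero_smul, add_zero, smul_comm]
    | add s t hs ht => rw [map_add, smul_add, map_add, map_add, smul_add, hs, ht]
  have hEu : ∀ t : T, E (u • t) = u • E t := by
    refine Algebra.adjoin_induction (p := fun u _ => ∀ t : T, E (u • t) = u • E t)
      ?_ ?_ ?_ ?_ hu
    · rintro _ ⟨γ, hγ, rfl⟩ t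
      exact hEf γ hγ t
    · intro c t
      rw [algebraMap_smul, algebraMap_smul, map_smul]
    · intro u u' _ _ h h' t
      rw [add_smul, add_smul, map_add, h, h']
    · intro u u' _ _ h h' t
      rw [mul_smul, mul_smul, h, h']
  have h2 := hEu (EnvModule.of 𝔤 (n ⊗ₜ[ℂ] m))
  rw [h1, map_zero, hE, smul_comm] at h2
  exact (smul_eq_zero.mp h2.symm).resolve_left hε

/-- If there is a module with a nonzero highest weight vector of weight `μ`, then every relation
between the negative root vectors on the generator of the Verma module of highest weight `lam + μ`
also holds on every vector of highest weight `lam`. -/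
theorem IsChevalleyBasis.smul_eq_zero_of_add {lam μ : Dual ℂ H} (hμ : μ ∈ weightLattice H)
    {m : M} {n : N} (hm : IsHighest b x μ m) (hm0 : m ≠ 0) (hn : IsHighest b x lam n)
    {u : Env 𝔤} (hu : u ∈ negAlgebra b x) (h0 : u • vermaVector b x (lam + μ) = 0) : u • n = 0 := by
  have hv : vermaVector b x μ ≠ 0 := fun h => hm0 (by
    rw [← hx.vermaHom_vermaVector hm, h, map_zero])
  obtain ⟨ε, hε, hε'⟩ := hx.exists_dual_verma hμ hv
  exact hx.smul_eq_zero_of_functional (isHighest_vermaVector μ) hn ε hε hε' hu h0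

end Tensor

/-! ### A module with a highest weight vector of the opposite weight -/

section Inverse

variable {L : Type*} [AddCommGroup L] [Module ℂ L] [LieRingModule 𝔤 L] [LieModule ℂ 𝔤 L]

/-- The ring of polynomial functions on an affine hyperplane in the dual of a representation `L`,
namely on the set of all functionals that take the value `1` on the vector `v`. The Lie algebra acts
on it as on the products of these functions, extended by homogeneity, with the inverse of `v`. -/
@[nolint unusedArguments]
def InverseModule (𝔤 : Type*) [LieRing 𝔤] [LieAlgebra ℂ 𝔤] {L : Type*} [AddCommGroup L]
    [Module ℂ L] [LieRingModule 𝔤 L] [LieModule ℂ 𝔤 L] {v : L} {f : Dual ℂ L} (_ : f v = 1) :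
    Type _ :=
  MvPolynomial (Module.Free.ChooseBasisIndex ℂ (LinearMap.ker f)) ℂ

namespace InverseModule

variable {v : L} {f : Dual ℂ L} (hf : f v = 1)

instance : CommRing (InverseModule 𝔤 hf) := inferInstanceAs (CommRing (MvPolynomial _ ℂ))

instance : Algebra ℂ (InverseModule 𝔤 hf) := inferInstanceAs (Algebra ℂ (MvPolynomial _ ℂ))

instance : Module ℂ (InverseModule 𝔤 hf) := Algebra.toModule

instance : Nontrivial (InverseModule 𝔤 hf) := inferInstanceAs (Nontrivial (MvPolynomial _ ℂ))

variable (𝔤)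

/-- The coordinate functions. -/
def var (i : Module.Free.ChooseBasisIndex ℂ (LinearMap.ker f)) : InverseModule 𝔤 hf :=
  (MvPolynomial.X i : MvPolynomial _ ℂ)

/-- The polynomial function given by a vector of `L`. -/
def eval : L →ₗ[ℂ] InverseModule 𝔤 hf :=
  -- Since `v` is the constant function `1`, a vector `w` splits into a linear form from `w - f w •
  -- v` in the kernel of `f` and the constant `f w`.
  ((Module.Free.chooseBasis ℂ (LinearMap.ker f)).constr ℂ (var 𝔤 hf)) ∘ₗ
    (LinearMap.id - (LinearMap.toSpanSingleton ℂ L v) ∘ₗ f).codRestrict (LinearMap.ker f)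
      (fun w => by simp [hf]) + (Algebra.linearMap ℂ (InverseModule 𝔤 hf)) ∘ₗ f

theorem eval_self : eval 𝔤 hf v = 1 := by
  have h : (LinearMap.id - (LinearMap.toSpanSingleton ℂ L v) ∘ₗ f).codRestrict (LinearMap.ker f)
      (fun w => by simp [hf]) v = 0 := Subtype.ext (by simp [hf])
  rw [eval, LinearMap.add_apply, LinearMap.comp_apply, h, map_zero, zero_add, LinearMap.comp_apply,
    hf, Algebra.linearMap_apply, map_one]

theorem eval_basis (i : Module.Free.ChooseBasisIndex ℂ (LinearMap.ker f)) :
    eval 𝔤 hf (Module.Free.chooseBasis ℂ (LinearMap.ker f) i : L) = var 𝔤 hf i := by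
  set w := Module.Free.chooseBasis ℂ (LinearMap.ker f) i with hw
  have h0 : f (w : L) = 0 := w.2
  have h : (LinearMap.id - (LinearMap.toSpanSingleton ℂ L v) ∘ₗ f).codRestrict (LinearMap.ker f)
      (fun w => by simp [hf]) w = w := Subtype.ext (by simp [h0])
  rw [eval, LinearMap.add_apply, LinearMap.comp_apply, h, LinearMap.comp_apply, h0, map_zero,
    add_zero, hw, Basis.constr_basis]

/-- The derivation by which an element of the Lie algebra acts on quotients by powers of `v`. -/
def der (y : 𝔤) : Derivation ℂ (InverseModule 𝔤 hf) (InverseModule 𝔤 hf) :=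
  (MvPolynomial.mkDerivation ℂ fun i =>
    (eval 𝔤 hf ⁅y, (Module.Free.chooseBasis ℂ (LinearMap.ker f) i : L)⁆ -
      var 𝔤 hf i * eval 𝔤 hf ⁅y, v⁆ : InverseModule 𝔤 hf) :
      Derivation ℂ (MvPolynomial (Module.Free.ChooseBasisIndex ℂ (LinearMap.ker f)) ℂ)
        (MvPolynomial (Module.Free.ChooseBasisIndex ℂ (LinearMap.ker f)) ℂ))

variable {𝔤}

theorem der_var (y : 𝔤) (i : Module.Free.ChooseBasisIndex ℂ (LinearMap.ker f)) :
    der 𝔤 hf y (var 𝔤 hf i) =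
      eval 𝔤 hf ⁅y, (Module.Free.chooseBasis ℂ (LinearMap.ker f) i : L)⁆ -
        var 𝔤 hf i * eval 𝔤 hf ⁅y, v⁆ :=
  MvPolynomial.mkDerivation_X ℂ
    (A := MvPolynomial (Module.Free.ChooseBasisIndex ℂ (LinearMap.ker f)) ℂ) _ i

/-- With `eval w` read as `w / v`, this is the quotient rule. The derivation was prescribed by it on
a basis of the kernel of `f` only; at `v` both sides vanish. -/
theorem der_eval (y : 𝔤) (w : L) : der 𝔤 hf y (eval 𝔤 hf w) =
    eval 𝔤 hf ⁅y, w⁆ - eval 𝔤 hf w * eval 𝔤 hf ⁅y, v⁆ := by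
  have h1 : (der 𝔤 hf y).toLinearMap ∘ₗ eval 𝔤 hf ∘ₗ (LinearMap.ker f).subtype =
      (eval 𝔤 hf ∘ₗ LieModule.toEnd ℂ 𝔤 L y - (LinearMap.mulRight ℂ (eval 𝔤 hf ⁅y, v⁆)) ∘ₗ
        eval 𝔤 hf) ∘ₗ (LinearMap.ker f).subtype := by
    refine (Module.Free.chooseBasis ℂ (LinearMap.ker f)).ext fun i => ?_
    simp only [LinearMap.comp_apply, LinearMap.sub_apply, Submodule.subtype_apply, eval_basis,
      LinearMap.mulRight_apply]
    exact der_var hf y i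
  have h2 := DFunLike.congr_fun h1 ⟨w - f w • v, by simp [hf]⟩
  simp only [LinearMap.comp_apply, LinearMap.sub_apply, Submodule.subtype_apply,
    LinearMap.mulRight_apply, LieModule.toEnd_apply_apply, map_sub, map_smul,
    eval_self, Derivation.coeFn_coe, Derivation.map_one_eq_zero, smul_zero, sub_zero, one_mul,
    sub_self] at h2
  exact h2

theorem der_ext {D₁ D₂ : Derivation ℂ (InverseModule 𝔤 hf) (InverseModule 𝔤 hf)}
    (h : ∀ w, D₁ (eval 𝔤 hf w) = D₂ (eval 𝔤 hf w)) : D₁ = D₂ := by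
  refine MvPolynomial.derivation_ext (R := ℂ)
    (A := MvPolynomial (Module.Free.ChooseBasisIndex ℂ (LinearMap.ker f)) ℂ) fun i => ?_
  have := h (Module.Free.chooseBasis ℂ (LinearMap.ker f) i)
  rw [eval_basis] at this
  exact this

theorem der_add (y z : 𝔤) : der 𝔤 hf (y + z) = der 𝔤 hf y + der 𝔤 hf z := by
  refine der_ext hf fun w => ?_
  simp only [Derivation.add_apply, der_eval, add_lie, map_add]
  ring

theorem der_smul (c : ℂ) (y : 𝔤) : der 𝔤 hf (c • y) = c • der 𝔤 hf y := by
  refine der_ext hf fun w => ?_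
  simp only [Derivation.smul_apply, der_eval, smul_lie, map_smul, mul_smul_comm, smul_sub]

theorem der_lie (y z : 𝔤) : der 𝔤 hf ⁅y, z⁆ = ⁅der 𝔤 hf y, der 𝔤 hf z⁆ := by
  refine der_ext hf fun w => ?_
  simp only [Derivation.commutator_apply, der_eval, lie_lie, map_sub, Derivation.leibniz,
    smul_eq_mul]
  ring

/-- An element `q` stands for `q * v⁻¹`, whence the correction term. In particular `1` stands for
`v⁻¹`, which has the opposite weight and is again annihilated by whatever annihilates `v`. -/
instance : LieRingModule 𝔤 (InverseModule 𝔤 hf) where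
  bracket y q := der 𝔤 hf y q - eval 𝔤 hf ⁅y, v⁆ * q
  add_lie y z q := by
    change der 𝔤 hf (y + z) q - eval 𝔤 hf ⁅y + z, v⁆ * q =
      der 𝔤 hf y q - eval 𝔤 hf ⁅y, v⁆ * q + (der 𝔤 hf z q - eval 𝔤 hf ⁅z, v⁆ * q)
    rw [der_add, Derivation.add_apply, add_lie, map_add]
    ring
  lie_add y p q := by
    change der 𝔤 hf y (p + q) - eval 𝔤 hf ⁅y, v⁆ * (p + q) =
      der 𝔤 hf y p - eval 𝔤 hf ⁅y, v⁆ * p + (der 𝔤 hf y q - eval 𝔤 hf ⁅y, v⁆ * q)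
    rw [map_add]
    ring
  leibniz_lie y z q := by
    change der 𝔤 hf y (der 𝔤 hf z q - eval 𝔤 hf ⁅z, v⁆ * q) -
        eval 𝔤 hf ⁅y, v⁆ * (der 𝔤 hf z q - eval 𝔤 hf ⁅z, v⁆ * q) =
      der 𝔤 hf ⁅y, z⁆ q - eval 𝔤 hf ⁅⁅y, z⁆, v⁆ * q +
        (der 𝔤 hf z (der 𝔤 hf y q - eval 𝔤 hf ⁅y, v⁆ * q) -
          eval 𝔤 hf ⁅z, v⁆ * (der 𝔤 hf y q - eval 𝔤 hf ⁅y, v⁆ * q))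
    rw [der_lie, Derivation.commutator_apply, lie_lie]
    simp only [map_sub, Derivation.leibniz, smul_eq_mul, der_eval]
    ring

theorem lie_def (y : 𝔤) (q : InverseModule 𝔤 hf) :
    ⁅y, q⁆ = der 𝔤 hf y q - eval 𝔤 hf ⁅y, v⁆ * q := rfl

instance : LieModule ℂ 𝔤 (InverseModule 𝔤 hf) where
  smul_lie c y q := by
    rw [lie_def, lie_def, der_smul, Derivation.smul_apply, smul_lie, map_smul, smul_mul_assoc,
      smul_sub]
  lie_smul c y q := by
    rw [lie_def, lie_def, Derivation.map_smul, mul_smul_comm, smul_sub]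

theorem lie_one (y : 𝔤) : ⁅y, (1 : InverseModule 𝔤 hf)⁆ = -eval 𝔤 hf ⁅y, v⁆ := by
  rw [lie_def, Derivation.map_one_eq_zero, mul_one, zero_sub]

theorem isHighest_one {b : (rootSystem H).Base} {x : H.root → 𝔤} {lam : Dual ℂ H}
    (hv : IsHighest b x lam (EnvModule.of 𝔤 v)) :
    IsHighest b x (-lam) (EnvModule.of 𝔤 (1 : InverseModule 𝔤 hf)) where
  mem_weightSpace h := by
    have h1 := hv.mem_weightSpace h
    rw [EnvModule.toEnv_smul, ← map_smul] at h1
    rw [EnvModule.toEnv_smul, lie_one, (EnvModule.of 𝔤).injective h1, map_smul, eval_self,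
      ← map_smul, LinearMap.neg_apply, neg_smul]
  smul_eq_zero γ hγ := by
    have h1 := hv.smul_eq_zero γ hγ
    rw [EnvModule.toEnv_smul, ← map_zero (EnvModule.of 𝔤)] at h1
    rw [EnvModule.toEnv_smul, lie_one, (EnvModule.of 𝔤).injective h1, map_zero, neg_zero, map_zero]

end InverseModule

end Inverse

/-! ### Comparison of Verma modules -/

section Comparison

variable {b : (rootSystem H).Base} {x : H.root → 𝔤} (hx : IsChevalleyBasis x)
include hx

variable {L : Type*} [AddCommGroup L] [Module ℂ L] [LieRingModule 𝔤 L] [LieModule ℂ 𝔤 L]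
  {L' : Type*} [AddCommGroup L'] [Module ℂ L'] [LieRingModule 𝔤 L'] [LieModule ℂ 𝔤 L']

/-- The negative root vectors satisfy the same relations on the generators of the Verma modules of
highest weights `lam` and `lam'`. -/
theorem IsChevalleyBasis.smul_vermaVector_eq_zero {lam lam' : Dual ℂ H}
    (hlam : lam ∈ weightLattice H) (hlam' : lam' ∈ weightLattice H) {v : L} {v' : L'}
    (hv : IsHighest b x lam (EnvModule.of 𝔤 v)) (hv0 : v ≠ 0)
    (hv' : IsHighest b x lam' (EnvModule.of 𝔤 v')) (hv0' : v' ≠ 0) {u : Env 𝔤}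
    (hu : u ∈ negAlgebra b x) (h : u • vermaVector b x lam = 0) :
    u • vermaVector b x lam' = 0 := by
  -- The comparison passes through weight `0`: tensoring with the module of `v` leads from `lam`
  -- down to `0`, and tensoring with the module of the inverse of `v'` leads from `0 = lam' +
  -- (-lam')` to `lam'`.
  have h1 : u • vermaVector b x (0 : Dual ℂ H) = 0 := by
    refine hx.smul_eq_zero_of_add hlam hv ?_ (isHighest_vermaVector 0) hu (by rwa [zero_add])
    simpa using hv0
  obtain ⟨f, hf⟩ := Module.Projective.exists_dual_eq_one ℂ hv0'
  refine hx.smul_eq_zero_of_add (neg_mem hlam') (InverseModule.isHighest_one hf hv') ?_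
    (isHighest_vermaVector lam') hu (by rwa [add_neg_cancel])
  simp

end Comparison

/-! ### The Casimir element -/

section Casimir

/-- Expanding both brackets in the dual families, invariance of the Killing form makes the
coefficients cancel in pairs. -/
theorem sum_lie_mul_add_mul_lie {ι : Type*} [Fintype ι] {e e' : ι → 𝔤}
    (h : ∀ y, ∑ j, killingForm ℂ 𝔤 y (e' j) • e j = y)
    (h' : ∀ y, ∑ j, killingForm ℂ 𝔤 y (e j) • e' j = y) (y : 𝔤) :
    ∑ j, (toEnv ⁅y, e j⁆ * toEnv (e' j) + toEnv (e j) * toEnv ⁅y, e' j⁆) = 0 := by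
  have h1 : ∀ j, toEnv ⁅y, e j⁆ * toEnv (e' j) =
      ∑ k, killingForm ℂ 𝔤 ⁅y, e j⁆ (e' k) • (toEnv (e k) * toEnv (e' j)) := fun j => by
    conv_lhs => rw [← h ⁅y, e j⁆, ← toEnvHom_apply, map_sum, Finset.sum_mul]
    simp only [toEnvHom_apply, toEnv_smul, smul_mul_assoc]
  have h2 : ∀ k, toEnv (e k) * toEnv ⁅y, e' k⁆ =
      ∑ j, killingForm ℂ 𝔤 ⁅y, e' k⁆ (e j) • (toEnv (e k) * toEnv (e' j)) := fun k => by
    conv_lhs => rw [← h' ⁅y, e' k⁆, ← toEnvHom_apply (∑ j, _), map_sum, Finset.mul_sum]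
    simp only [toEnvHom_apply, toEnv_smul, mul_smul_comm]
  rw [Finset.sum_add_distrib, Finset.sum_congr rfl fun j _ => h1 j,
    Finset.sum_congr rfl fun k _ => h2 k, Finset.sum_comm, ← Finset.sum_add_distrib]
  refine Finset.sum_eq_zero fun k _ => ?_
  rw [← Finset.sum_add_distrib]
  refine Finset.sum_eq_zero fun j _ => ?_
  rw [← add_smul, LieModule.traceForm_apply_lie_apply', LieModule.traceForm_comm ℂ 𝔤 𝔤 (e j),
    neg_add_cancel, zero_smul]

theorem sum_killingForm_smul_symm {ι : Type*} [Fintype ι] {e e' : ι → 𝔤}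
    (h : ∀ y, ∑ j, killingForm ℂ 𝔤 y (e' j) • e j = y) (y : 𝔤) :
    ∑ j, killingForm ℂ 𝔤 y (e j) • e' j = y := by
  rw [← sub_eq_zero]
  apply (LieAlgebra.IsKilling.killingForm_nondegenerate ℂ 𝔤).1
  intro z
  rw [map_sub, LinearMap.sub_apply, sub_eq_zero, map_sum, LinearMap.sum_apply]
  conv_rhs => rw [← h z, map_sum]
  refine Finset.sum_congr rfl fun j _ => ?_
  rw [map_smul, map_smul, LinearMap.smul_apply, LieModule.traceForm_comm ℂ 𝔤 𝔤 z, smul_eq_mul,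
    smul_eq_mul, mul_comm]

/-- The Casimir element given by a pair of dual families commutes with the Lie algebra. -/
theorem commute_casimir {ι : Type*} [Fintype ι] {e e' : ι → 𝔤}
    (h : ∀ y, ∑ j, killingForm ℂ 𝔤 y (e' j) • e j = y) (y : 𝔤) :
    Commute (∑ j, toEnv (e j) * toEnv (e' j)) (toEnv y) := by
  refine Commute.symm (sub_eq_zero.mp ?_)
  rw [← sum_lie_mul_add_mul_lie h (sum_killingForm_smul_symm h) y, Finset.mul_sum, Finset.sum_mul, ← Finset.sum_sub_distrib]
  refine Finset.sum_congr rfl fun j _ => ?_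
  rw [toEnv_lie, toEnv_lie]
  noncomm_ring

variable {b : (rootSystem H).Base} {x : H.root → 𝔤} (hx : IsChevalleyBasis x)

theorem killingForm_coe_root {h : H} {y : 𝔤} {α : H.root} (hy : y ∈ LieAlgebra.rootSpace H α.1) :
    killingForm ℂ 𝔤 (h : 𝔤) y = 0 := by
  have h0 : (h : 𝔤) ∈ LieAlgebra.rootSpace H (0 : H → ℂ) := by
    rw [LieAlgebra.rootSpace_zero_eq]
    exact h.2
  rw [LieAlgebra.killingForm_apply_eq_zero_of_mem_rootSpace_of_add_ne_zero ℂ 𝔤 H h0 hy]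
  rw [zero_add]
  exact LieSubalgebra.isNonZero_coe_root α

include hx

theorem IsChevalleyBasis.killingForm_of_ne {α β : H.root} (h : β ≠ α) :
    killingForm ℂ 𝔤 (x β) (x (negRoot α)) = 0 := by
  apply LieAlgebra.killingForm_apply_eq_zero_of_mem_rootSpace_of_add_ne_zero ℂ 𝔤 H
    (hx.mem_rootSpace β) (hx.mem_rootSpace (negRoot α))
  intro h0
  apply h
  apply Subtype.ext
  ext k
  have := congrFun h0 k
  simp only [coe_negRoot, LieModule.Weight.coe_neg, Pi.add_apply, Pi.neg_apply,
    Pi.zero_apply] at this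
  linear_combination this

omit hx in
theorem killingNorm_negRoot (x : H.root → 𝔤) (α : H.root) :
    killingNorm x (negRoot α) = killingNorm x α := by
  rw [killingNorm, killingNorm, negRoot_negRoot, LieModule.traceForm_comm]

/-- The Killing form on the Cartan subalgebra. -/
abbrev cartanForm (H : LieSubalgebra ℂ 𝔤) : LinearMap.BilinForm ℂ H := LieModule.traceForm ℂ H 𝔤

theorem IsChevalleyBasis.sum_killingForm_smul {ι : Type*} [Fintype ι] {u u' : ι → H}
    (hu : ∀ h : H, ∑ i, killingForm ℂ 𝔤 (h : 𝔤) (u' i : 𝔤) • u i = h) {a : H.root → ℂ}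
    (ha : ∀ α, a α * killingNorm x α = 1) (y : 𝔤) :
    ∑ j : ι ⊕ H.root, killingForm ℂ 𝔤 y
      (Sum.elim (fun i => (u' i : 𝔤)) (fun α => x (negRoot α)) j) •
      (Sum.elim (fun i => (u i : 𝔤)) (fun α => a α • x α) j) = y := by
  classical
  have hy : y ∈ Submodule.span ℂ (chevalleyLattice x : Set 𝔤) := by
    rw [hx.span_chevalleyLattice]; trivial
  simp only [Fintype.sum_sum_type, Sum.elim_inl, Sum.elim_inr]
  have hs : ∀ z : H, ∑ i, killingForm ℂ 𝔤 (z : 𝔤) (u' i : 𝔤) • (u i : 𝔤) = z := fun z => by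
    have := congrArg H.toSubmodule.subtype (hu z)
    rw [map_sum] at this
    simpa using this
  have key : ∀ z ∈ chevalleyLattice x, ∑ i, killingForm ℂ 𝔤 z (u' i : 𝔤) • (u i : 𝔤) +
      ∑ α, killingForm ℂ 𝔤 z (x (negRoot α)) • a α • x α = z := by
    intro z hz
    induction hz using Submodule.span_induction with
    | mem z hz =>
      rcases hz with ⟨β, rfl⟩ | ⟨β, rfl⟩
      · rw [Finset.sum_eq_zero, zero_add, Finset.sum_eq_single β]
        · rw [← killingNorm, smul_smul, mul_comm, ha, one_smul]
        · intro α _ hα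
          rw [hx.killingForm_of_ne hα.symm, zero_smul]
        · simp
        · intro i _
          rw [LieModule.traceForm_comm, killingForm_coe_root (hx.mem_rootSpace β), zero_smul]
      · rw [hs, Finset.sum_eq_zero, add_zero]
        intro α _
        rw [killingForm_coe_root (hx.mem_rootSpace (negRoot α)), zero_smul]
    | zero => simp
    | add y z _ _ hy hz =>
      conv_rhs => rw [← hy, ← hz]
      simp only [map_add, LinearMap.add_apply, add_smul, Finset.sum_add_distrib]
      abel
    | smul n z _ hz =>
      conv_rhs => rw [← hz]
      simp only [← Int.cast_smul_eq_zsmul ℂ n, map_smul, LinearMap.smul_apply, smul_add,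
        Finset.smul_sum, smul_assoc]
  induction hy using Submodule.span_induction with
  | mem z hz => exact key z hz
  | zero => simp
  | add y z _ _ hy hz =>
    conv_rhs => rw [← hy, ← hz]
    simp only [map_add, LinearMap.add_apply, add_smul, Finset.sum_add_distrib]
    abel
  | smul c z _ hz =>
    conv_rhs => rw [← hz]
    simp only [map_smul, LinearMap.smul_apply, smul_add, Finset.smul_sum, smul_assoc]

/-- The Casimir element. -/
def casimir (x : H.root → 𝔤) : Env 𝔤 :=
  ∑ i, toEnv (((cartanForm H).dualBasis (traceForm_cartan_nondegenerate ℂ 𝔤 H)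
    (Module.finBasis ℂ H) i : H) : 𝔤) * toEnv (Module.finBasis ℂ H i : 𝔤) +
  ∑ α : H.root, (killingNorm x α)⁻¹ • (toEnv (x α) * toEnv (x (negRoot α)))

omit hx in
theorem sum_cartanForm_smul (h : H) : ∑ i, killingForm ℂ 𝔤 (h : 𝔤) (Module.finBasis ℂ H i : 𝔤) •
    (cartanForm H).dualBasis (traceForm_cartan_nondegenerate ℂ 𝔤 H) (Module.finBasis ℂ H) i =
      h := by
  conv_rhs => rw [← ((cartanForm H).dualBasis (traceForm_cartan_nondegenerate ℂ 𝔤 H)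
    (Module.finBasis ℂ H)).sum_repr h]
  simp only [LinearMap.BilinForm.dualBasis_repr_apply]
  rfl

theorem IsChevalleyBasis.commute_casimir (u : Env 𝔤) : Commute (casimir x) u := by
  have h1 := fun y => Truncation.commute_casimir (hx.sum_killingForm_smul sum_cartanForm_smul
    (a := fun α => (killingNorm x α)⁻¹) fun α => inv_mul_cancel₀ (hx.killingNorm_ne_zero α)) y
  simp only [Fintype.sum_sum_type, Sum.elim_inl, Sum.elim_inr, toEnv_smul, smul_mul_assoc] at h1
  have h2 := mem_of_toEnv_mem (Subalgebra.centralizer ℂ {casimir x}) (fun y => by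
    rw [Subalgebra.mem_centralizer_iff]
    rintro _ rfl
    exact (h1 y).eq) u
  rw [Subalgebra.mem_centralizer_iff] at h2
  exact h2 _ rfl

/-- Twice the norm is the Killing form of the coroot with itself, which is the sum of the squares of
its integral pairings with the roots. The positivity decides the Casimir comparison. -/
theorem IsChevalleyBasis.killingNorm_pos (α : H.root) :
    ∃ q : ℝ, 0 < q ∧ killingNorm x α = q := by
  have h1 : (killingForm ℂ 𝔤) (coroot α.1 : H) (coroot α.1 : H) = 2 * killingNorm x α := by
    have h2 := root_apply_coroot_self α
    rw [← (cartanEquivDual H).apply_symm_apply ((rootSystem H).root α)] at h2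
    have h3 : (killingForm ℂ 𝔤) ((cartanEquivDual H).symm ((rootSystem H).root α) : H)
      (coroot α.1 : H) = 2 := h2
    have h4 : (coroot α.1 : 𝔤) = killingNorm x α •
        (((cartanEquivDual H).symm ((rootSystem H).root α) : H) : 𝔤) :=
      congrArg Subtype.val (hx.coroot_eq α)
    conv_lhs =>
      enter [1]
      rw [h4]
    rw [map_smul, LinearMap.smul_apply, h3, smul_eq_mul, mul_comm]
  have h2 : (killingForm ℂ 𝔤) (coroot α.1 : H) (coroot α.1 : H) =
      ((∑ β : H.root, (rootSystem H).pairingIn ℤ β α ^ 2 : ℤ) : ℂ) := by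
    have h3 := DFunLike.congr_fun (DFunLike.congr_fun
      (restrict_killingForm_eq_sum (K := ℂ) (L := 𝔤) (H := H)) (coroot α.1)) (coroot α.1)
    rw [LinearMap.BilinForm.restrict_apply] at h3
    refine h3.trans ?_
    rw [LinearMap.sum_apply, LinearMap.sum_apply, ← Finset.sum_coe_sort, Int.cast_sum]
    refine Finset.sum_congr rfl fun β _ => ?_
    have h4 := root_apply_coroot_eq β α
    simp only [LinearMap.smulRight_apply, LinearMap.smul_apply, smul_eq_mul]
    push_cast
    rw [← h4, pow_two]
    rfl
  have h3 : 0 < ∑ β : H.root, (rootSystem H).pairingIn ℤ β α ^ 2 := by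
    refine Finset.sum_pos' (fun β _ => sq_nonneg _) ⟨α, Finset.mem_univ α, ?_⟩
    rw [RootPairing.pairingIn_same]
    norm_num
  refine ⟨((∑ β : H.root, (rootSystem H).pairingIn ℤ β α ^ 2 : ℤ) : ℝ) / 2, ?_, ?_⟩
  · have : (0 : ℝ) < ((∑ β : H.root, (rootSystem H).pairingIn ℤ β α ^ 2 : ℤ) : ℝ) := by
      exact_mod_cast h3
    linarith
  · rw [h1] at h2
    have h5 : killingNorm x α = ((∑ β : H.root, (rootSystem H).pairingIn ℤ β α ^ 2 : ℤ) : ℂ) / 2 := by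
      rw [← h2]; ring
    rw [h5]
    push_cast
    rfl

end Casimir

/-! ### The eigenvalue of the Casimir element -/

section Eigenvalue

theorem isPos_negRoot_iff {b : (rootSystem H).Base} (α : H.root) :
    b.IsPos (negRoot α) ↔ ¬ b.IsPos α := by
  rw [negRoot_eq_reflectionPerm]
  exact RootPairing.Base.IsPos.neg_iff_not (b := b) α

variable {b : (rootSystem H).Base} {x : H.root → 𝔤} (hx : IsChevalleyBasis x)

open Classical in
theorem sum_root_eq (b : (rootSystem H).Base) {A : Type*} [AddCommMonoid A] (g : H.root → A) :
    ∑ α, g α = ∑ α with b.IsPos α, (g α + g (negRoot α)) := by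
  rw [← Finset.sum_filter_add_sum_filter_not Finset.univ (fun α => b.IsPos α),
    Finset.sum_add_distrib]
  congr 1
  refine Finset.sum_nbij' negRoot negRoot ?_ ?_ ?_ ?_ ?_
  · intro α hα
    simpa [isPos_negRoot_iff] using hα
  · intro α hα
    simpa [isPos_negRoot_iff] using hα
  · intro α _
    exact negRoot_negRoot α
  · intro α _
    exact negRoot_negRoot α
  · intro α _
    rw [negRoot_negRoot]

open Classical in
/-- The sum of the positive roots takes the value `2` on all simple coroots. -/
theorem sum_isPos_apply_coroot {γ : H.root} (hγ : γ ∈ b.support) :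
    ∑ α with b.IsPos α, (rootSystem H).root α (coroot γ.1) = 2 := by
  have hmem : γ ∈ Finset.univ.filter (fun α => b.IsPos α) := by
    simpa using b.isPos_of_mem_support hγ
  rw [← Finset.add_sum_erase _ _ hmem, root_apply_coroot_self, add_eq_left]
  set s := (Finset.univ.filter (fun α => b.IsPos α)).erase γ with hs
  -- The simple reflection permutes the positive roots other than `γ` and changes the sign of their
  -- value on the coroot of `γ`, so these roots contribute `0` in total.
  have h1 : ∑ α ∈ s, (rootSystem H).root α (coroot γ.1) =
      ∑ α ∈ s, (rootSystem H).root ((rootSystem H).reflectionPerm γ α) (coroot γ.1) := by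
    have hmaps : ∀ α ∈ s, (rootSystem H).reflectionPerm γ α ∈ s := by
      intro α hα
      simp only [hs, Finset.mem_erase, Finset.mem_filter_univ] at hα ⊢
      refine ⟨fun h => ?_, hα.2.reflectionPerm hγ hα.1⟩
      have h2 : α = negRoot γ := by
        rw [negRoot_eq_reflectionPerm, ← h]
        conv_rhs => rw [h]
        rw [← (rootSystem H).reflectionPerm_self γ α, h]
      rw [h2, isPos_negRoot_iff] at hα
      exact hα.2 (b.isPos_of_mem_support hγ)
    refine Finset.sum_nbij' ((rootSystem H).reflectionPerm γ) ((rootSystem H).reflectionPerm γ)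
      hmaps hmaps ?_ ?_ ?_
    · intro α _
      exact (rootSystem H).reflectionPerm_self γ α
    · intro α _
      exact (rootSystem H).reflectionPerm_self γ α
    · intro α _
      rw [(rootSystem H).reflectionPerm_self γ α]
  have h2 : ∀ α, (rootSystem H).root ((rootSystem H).reflectionPerm γ α) (coroot γ.1) =
      -(rootSystem H).root α (coroot γ.1) := by
    intro α
    rw [RootPairing.root_reflectionPerm, RootPairing.reflection_apply, LinearMap.sub_apply,
      LinearMap.smul_apply, root_apply_coroot_self, smul_eq_mul]
    change _ - (rootSystem H).root α (coroot γ.1) * 2 = _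
    ring
  rw [Finset.sum_congr rfl fun α _ => h2 α, Finset.sum_neg_distrib] at h1
  linear_combination h1 / 2

open Classical in
variable (b x) in
/-- The scalar by which the Casimir element acts on a vector of highest weight `μ`. -/
def casimirValue (μ : Dual ℂ H) : ℂ :=
  μ ((cartanEquivDual H).symm μ) +
    ∑ α with b.IsPos α, (killingNorm x α)⁻¹ * μ (coroot α.1)

include hx

open Classical in
theorem IsChevalleyBasis.casimir_smul {M : Type*} [AddCommGroup M] [Module ℂ M]
    [Module (Env 𝔤) M] [IsScalarTower ℂ (Env 𝔤) M] {μ : Dual ℂ H} {w : M}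
    (hw : IsHighest b x μ w) : casimir x • w = casimirValue b x μ • w := by
  rw [casimir, casimirValue, add_smul, add_smul]
  congr 1
  · have h1 := sum_cartanForm_smul ((cartanEquivDual H).symm μ)
    have h2 : ∀ h : H, killingForm ℂ 𝔤 ((cartanEquivDual H).symm μ : H) (h : 𝔤) = μ h := fun h => by
      conv_rhs => rw [← (cartanEquivDual H).apply_symm_apply μ]
      rfl
    simp only [h2] at h1
    conv_rhs =>
      enter [1]
      rw [← h1]
    rw [map_sum, Finset.sum_smul, Finset.sum_smul]
    refine Finset.sum_congr rfl fun i _ => ?_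
    rw [mul_smul, hw.mem_weightSpace, smul_comm, hw.mem_weightSpace, map_smul, smul_assoc]
  · rw [sum_root_eq b, Finset.sum_smul, Finset.sum_smul]
    refine Finset.sum_congr rfl fun α hα => ?_
    rw [Finset.mem_filter_univ] at hα
    rw [killingNorm_negRoot, negRoot_negRoot, ← smul_add, smul_assoc, add_smul, mul_smul, mul_smul,
      hx.smul_eq_zero_of_isPos hw hα, smul_zero, add_zero, toEnv_smul_toEnv_smul,
      hx.smul_eq_zero_of_isPos hw hα, smul_zero, zero_add, hx.lie_neg, hw.mem_weightSpace,
      smul_smul]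

open Classical in
-- This is `|lam + ρ|² - |μ + ρ|² = (lam + μ + 2ρ, lam - μ)`, expanded along the simple roots in
-- `lam - μ`; the summand `2` is the value of `2ρ` on a simple coroot.
theorem IsChevalleyBasis.casimirValue_sub (lam : Dual ℂ H) (c : b.support → ℕ) :
    casimirValue b x lam - casimirValue b x (lowerWeight b lam c) =
      ∑ γ, c γ * (killingNorm x γ.1)⁻¹ *
        (lam (coroot γ.1.1) + lowerWeight b lam c (coroot γ.1.1) + 2) := by
  set μ := lowerWeight b lam c with hμ
  have hη : lam - μ = ∑ γ, c γ • (rootSystem H).root γ.1 := by rw [hμ, lowerWeight, sub_sub_cancel]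
  have ht : (cartanEquivDual H).symm (lam - μ) =
      ∑ γ, (c γ : ℂ) • (killingNorm x γ.1)⁻¹ • coroot γ.1.1 := by
    rw [hη, map_sum]
    refine Finset.sum_congr rfl fun γ _ => ?_
    rw [map_nsmul, hx.inv_smul_coroot, Nat.cast_smul_eq_nsmul]
  have h1 : lam ((cartanEquivDual H).symm lam) - μ ((cartanEquivDual H).symm μ) =
      (lam + μ) ((cartanEquivDual H).symm (lam - μ)) := by
    rw [map_sub, map_sub, LinearMap.add_apply, LinearMap.add_apply,
      apply_cartanEquivDual_symm_comm μ lam]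
    ring
  have h2 : ∑ α with b.IsPos α, (killingNorm x α)⁻¹ * lam (coroot α.1) -
      ∑ α with b.IsPos α, (killingNorm x α)⁻¹ * μ (coroot α.1) =
      ∑ α with b.IsPos α, (rootSystem H).root α ((cartanEquivDual H).symm (lam - μ)) := by
    rw [← Finset.sum_sub_distrib]
    refine Finset.sum_congr rfl fun α _ => ?_
    rw [apply_cartanEquivDual_symm_comm, ← hx.inv_smul_coroot, map_smul, LinearMap.sub_apply,
      smul_eq_mul]
    ring
  have h3 : casimirValue b x lam - casimirValue b x μ =
      (lam + μ) ((cartanEquivDual H).symm (lam - μ)) +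
        ∑ α with b.IsPos α, (rootSystem H).root α ((cartanEquivDual H).symm (lam - μ)) := by
    rw [← h1, ← h2, casimirValue, casimirValue]
    ring
  rw [h3, ht, map_sum]
  simp only [map_sum, map_smul, smul_eq_mul]
  rw [Finset.sum_comm, ← Finset.sum_add_distrib]
  refine Finset.sum_congr rfl fun γ _ => ?_
  simp only [← Finset.mul_sum]
  rw [sum_isPos_apply_coroot γ.2, LinearMap.add_apply]
  ring

/-- As both weights are dominant, the difference of Casimir values is a sum of nonnegative terms in
which only the factors `c γ` can vanish. -/
theorem IsChevalleyBasis.eq_zero_of_casimirValue_eq {lam : Dual ℂ H} {c : b.support → ℕ}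
    {m n : b.support → ℕ} (hm : ∀ γ, lam (coroot γ.1.1) = m γ)
    (hn : ∀ γ, lowerWeight b lam c (coroot γ.1.1) = n γ)
    (h : casimirValue b x (lowerWeight b lam c) = casimirValue b x lam) : c = 0 := by
  choose q hq hq' using hx.killingNorm_pos
  have h1 := hx.casimirValue_sub lam c
  rw [h, sub_self] at h1
  have h2 : ∑ γ : b.support, (c γ : ℝ) * (q γ.1)⁻¹ * (m γ + n γ + 2) = 0 := by
    have h3 : ((∑ γ : b.support, (c γ : ℝ) * (q γ.1)⁻¹ * (m γ + n γ + 2) : ℝ) : ℂ) = 0 := by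
      rw [h1]
      push_cast
      refine Finset.sum_congr rfl fun γ _ => ?_
      rw [hm, hn, hq']
    exact_mod_cast h3
  rw [Finset.sum_eq_zero_iff_of_nonneg] at h2
  · funext γ
    have h4 := h2 γ (Finset.mem_univ γ)
    have h5 := inv_pos.mpr (hq γ.1)
    have h6 : (0 : ℝ) < m γ + n γ + 2 := by positivity
    have h7 := (mul_eq_zero.mp h4).resolve_right h6.ne'
    exact_mod_cast (mul_eq_zero.mp h7).resolve_right h5.ne'
  · intro γ _
    have h5 := inv_pos.mpr (hq γ.1)
    positivity

end Eigenvalue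

/-! ### The kernel of the homomorphism from the Verma module to the irreducible representation -/

section DividedPowers

variable {A : Type*} [Ring A] [Algebra ℂ A]

theorem dpow_mul_eq_sum (a y : A) (n : ℕ) :
    dpow a n * y = ∑ ij ∈ Finset.HasAntidiagonal.antidiagonal n, dad a ij.1 y * dpow a ij.2 := by
  have h1 : LinearMap.mulLeft ℂ a = (LinearMap.mulLeft ℂ a - LinearMap.mulRight ℂ a) +
      LinearMap.mulRight ℂ a := by abel
  have h : Commute (LinearMap.mulLeft ℂ a - LinearMap.mulRight ℂ a) (LinearMap.mulRight ℂ a) :=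
    (LinearMap.commute_mulLeft_right (R := ℂ) a a).sub_left (Commute.refl _)
  rw [← dpow_mulLeft, h1, dpow_add h, LinearMap.sum_apply]
  refine Finset.sum_congr rfl fun ij _ => ?_
  have h2 := (h.pow_pow ij.1 ij.2).smul_left ((ij.1 ! : ℂ)⁻¹) |>.smul_right ((ij.2 ! : ℂ)⁻¹)
  rw [dpow, dpow, h2.eq, ← dpow, ← dpow, Module.End.mul_apply, dpow_mulRight, dad]

theorem dpow_smul_eq_zero_iff {M : Type*} [AddCommGroup M] [Module ℂ M] [Module A M]
    [IsScalarTower ℂ A M] (a : A) (n : ℕ) (w : M) : dpow a n • w = 0 ↔ a ^ n • w = 0 := by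
  rw [dpow, smul_assoc, smul_eq_zero_iff_right (inv_ne_zero (factorial_cast_ne_zero n))]

theorem pow_smul_eq_zero_of_le {M : Type*} [AddCommGroup M] [Module A M] {a : A} {k n : ℕ}
    (hkn : k ≤ n) {w : M} (h : a ^ k • w = 0) : a ^ n • w = 0 := by
  rw [← Nat.sub_add_cancel hkn, pow_add, mul_smul, h, smul_zero]

end DividedPowers

section Kernel

variable {M : Type*} [AddCommGroup M] [Module ℂ M] [Module (Env 𝔤) M] [IsScalarTower ℂ (Env 𝔤) M]
  {M' : Type*} [AddCommGroup M'] [Module ℂ M'] [Module (Env 𝔤) M'] [IsScalarTower ℂ (Env 𝔤) M']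

/-- Moving a high power of `a` past `y` distributes it between `ad a` and the action on `w`, and one
of the two shares is large enough to give zero. -/
theorem exists_pow_smul_toEnv_smul_eq_zero {a y : 𝔤} (ha : IsNilpotent (LieAlgebra.ad ℂ 𝔤 a))
    {w : M} (hw : ∃ k, toEnv a ^ k • w = 0) : ∃ k, toEnv a ^ k • toEnv y • w = 0 := by
  obtain ⟨k, hk⟩ := hw
  obtain ⟨K, hK⟩ := ha
  refine ⟨K + k, ?_⟩
  rw [← dpow_smul_eq_zero_iff, ← mul_smul, dpow_mul_eq_sum, Finset.sum_smul]
  refine Finset.sum_eq_zero fun ij hij => ?_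
  rw [Finset.HasAntidiagonal.mem_antidiagonal] at hij
  rw [mul_smul]
  by_cases hi : K ≤ ij.1
  · rw [← toEnv_dadLie, dadLie_eq_zero hK hi, LinearMap.zero_apply, toEnv, map_zero, zero_smul]
  · have : toEnv a ^ ij.2 • w = 0 := pow_smul_eq_zero_of_le (by omega) hk
    rw [(dpow_smul_eq_zero_iff _ _ _).mpr this, smul_zero]

theorem exists_pow_smul_smul_eq_zero {a : 𝔤} (ha : IsNilpotent (LieAlgebra.ad ℂ 𝔤 a)) (u : Env 𝔤) :
    ∀ w : M, (∃ k, toEnv a ^ k • w = 0) → ∃ k, toEnv a ^ k • u • w = 0 := by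
  let S : Subalgebra ℂ (Env 𝔤) :=
    { carrier := {u | ∀ w : M, (∃ k, toEnv a ^ k • w = 0) → ∃ k, toEnv a ^ k • u • w = 0}
      mul_mem' := fun {u u'} hu hu' w hw => by
        obtain ⟨k, hk⟩ := hu _ (hu' w hw)
        exact ⟨k, by rw [mul_smul, hk]⟩
      add_mem' := fun {u u'} hu hu' w hw => by
        obtain ⟨k, hk⟩ := hu w hw
        obtain ⟨k', hk'⟩ := hu' w hw
        refine ⟨max k k', ?_⟩
        rw [add_smul, smul_add, pow_smul_eq_zero_of_le (le_max_left k k') hk,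
          pow_smul_eq_zero_of_le (le_max_right k k') hk', add_zero]
      algebraMap_mem' := fun c w hw => by
        obtain ⟨k, hk⟩ := hw
        exact ⟨k, by rw [algebraMap_smul, smul_comm, hk, smul_zero]⟩ }
  exact mem_of_toEnv_mem S (fun y w hw => exists_pow_smul_toEnv_smul_eq_zero ha hw) u

variable {b : (rootSystem H).Base} {x : H.root → 𝔤} (hx : IsChevalleyBasis x)

/-- A vector in the kernel of a homomorphism is a sum of weight vectors in the kernel. -/
theorem mem_of_forall_weight_mem {lam : Dual ℂ H} (f : M →ₗ[Env 𝔤] M') {N : Submodule ℂ M}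
    (hN : ∀ c : b.support → ℕ, ∀ w ∈ weightSpace M (lowerWeight b lam c), f w = 0 → w ∈ N)
    {w : M} (hw : w ∈ weightSum M b lam Set.univ) (h0 : f w = 0) : w ∈ N := by
  classical
  obtain ⟨g, hg, rfl⟩ := (Submodule.mem_iSup_iff_exists_finsupp _ _).mp hw
  refine Submodule.finsuppSum_mem _ _ _ _ fun c _ => hN c.1 (g c) (hg c) ?_
  have h1 : f (g c) ∈ weightSum M' b lam {c.1} :=
    mem_weightSum (Set.mem_singleton _) (map_mem_weightSpace f (hg c))
  have h2 : f (g c) ∈ weightSum M' b lam {c.1}ᶜ := by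
    by_cases hc : c ∈ g.support
    · rw [Finsupp.sum, ← Finset.add_sum_erase _ _ hc, map_add, map_sum] at h0
      rw [eq_neg_of_add_eq_zero_left h0]
      refine Submodule.neg_mem _ (Submodule.sum_mem _ fun d hd => ?_)
      refine mem_weightSum ?_ (map_mem_weightSpace f (hg d))
      exact fun h => Finset.ne_of_mem_erase hd (Subtype.ext h)
    · rw [Finsupp.notMem_support_iff.mp hc, map_zero]
      exact Submodule.zero_mem _
  exact eq_zero_of_mem_weightSum disjoint_compl_right h1 h2

include hx

/-- A highest weight vector on which a simple negative root vector acts nilpotently has a natural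
number as its weight. -/
theorem IsChevalleyBasis.exists_nat_of_pow_smul_eq_zero {μ : Dual ℂ H} {w : M}
    (hw : IsHighest b x μ w) (hw0 : w ≠ 0) {γ : H.root} (hγ : γ ∈ b.support)
    (h : ∃ k, toEnv (x (negRoot γ)) ^ k • w = 0) :
    ∃ n : ℕ, μ (coroot γ.1) = n ∧ toEnv (x (negRoot γ)) ^ (n + 1) • w = 0 := by
  classical
  have h1 := Nat.find_spec h
  have h2 : Nat.find h ≠ 0 := by
    intro h0
    rw [h0, pow_zero, one_smul] at h1
    exact hw0 h1
  obtain ⟨n, hn⟩ := Nat.exists_eq_succ_of_ne_zero h2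
  rw [hn] at h1
  refine ⟨n, ?_, h1⟩
  have h3 : toEnv (x (negRoot γ)) ^ n • w ≠ 0 := Nat.find_min h (by omega)
  -- For the least power `n + 1` that kills `w`, raising gives `(n + 1) (μ(h) - n)` times a nonzero
  -- vector, which must be zero.
  have h4 := hx.smul_pow_succ_smul γ hw.mem_weightSpace n
  rw [h1, hw.smul_eq_zero γ hγ, smul_zero, smul_zero, zero_add] at h4
  have h5 := (smul_eq_zero.mp h4.symm).resolve_right h3
  have h6 : (n : ℂ) + 1 ≠ 0 := by exact_mod_cast n.succ_ne_zero
  linear_combination (mul_eq_zero.mp h5).resolve_left h6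

/-- The powers of the simple negative root vectors that generate `vermaKernel` yield highest weight
vectors. -/
theorem IsChevalleyBasis.isHighest_pow_smul {lam : Dual ℂ H} {v : M} (hv : IsHighest b x lam v)
    (γ : b.support) {m : ℕ} (hm : lam (coroot γ.1.1) = m) :
    IsHighest b x (lam + (m + 1) • -(rootSystem H).root γ.1)
      (toEnv (x (negRoot γ.1)) ^ (m + 1) • v) where
  mem_weightSpace := toEnv_pow_smul_mem_weightSpace (hx.lie_coe_neg γ.1) hv.mem_weightSpace (m + 1)
  smul_eq_zero δ hδ := by
    by_cases h : δ = γ.1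
    · subst h
      rw [hx.smul_pow_succ_smul γ.1 hv.mem_weightSpace, hv.smul_eq_zero _ γ.2, hm, sub_self,
        mul_zero, zero_smul, smul_zero, add_zero]
    · have := (hx.commute_simple hδ γ.2 h).pow_right (m + 1)
      rw [← mul_smul, this.eq, mul_smul, hv.smul_eq_zero δ hδ, smul_zero]

theorem IsChevalleyBasis.pow_smul_eq_zero {L : Type*} [AddCommGroup L] [Module ℂ L]
    [LieRingModule 𝔤 L] [LieModule ℂ 𝔤 L] [FiniteDimensional ℂ L] {lam : Dual ℂ H} {v : L}
    (hv : IsHighest b x lam (EnvModule.of 𝔤 v)) (hv0 : v ≠ 0) (γ : b.support) {m : ℕ}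
    (hm : lam (coroot γ.1.1) = m) :
    toEnv (x (negRoot γ.1)) ^ (m + 1) • EnvModule.of 𝔤 v = 0 := by
  have ht := hx.isSl2Triple γ.1
  have hp : ht.HasPrimitiveVectorWith v (m : ℂ) :=
    { ne_zero := hv0
      lie_h := by
        have := hv.mem_weightSpace (coroot γ.1.1)
        rw [hm, EnvModule.toEnv_smul, ← map_smul] at this
        exact (EnvModule.of 𝔤).injective this
      lie_e := by
        have := hv.smul_eq_zero γ.1 γ.2
        rw [EnvModule.toEnv_smul, ← map_zero (EnvModule.of 𝔤)] at this
        exact (EnvModule.of 𝔤).injective this }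
  have h1 := hp.pow_toEnd_f_eq_zero_of_eq_nat (n := m) rfl
  have h2 : ∀ n, toEnv (x (negRoot γ.1)) ^ n • EnvModule.of 𝔤 v =
      EnvModule.of 𝔤 ((LieModule.toEnd ℂ 𝔤 L (x (negRoot γ.1)) ^ n) v) := by
    intro n
    induction n with
    | zero => simp
    | succ n ih =>
      rw [pow_succ', mul_smul, ih, EnvModule.toEnv_smul, pow_succ']
      rfl
  rw [h2, h1, map_zero]

end Kernel

/-! ### The kernel is generated by powers of the simple negative root vectors. -/

section KernelEq

variable {M : Type*} [AddCommGroup M] [Module ℂ M] [Module (Env 𝔤) M] [IsScalarTower ℂ (Env 𝔤) M]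
variable {b : (rootSystem H).Base} {x : H.root → 𝔤} (hx : IsChevalleyBasis x)

theorem exists_eq_lowerWeight {lam μ : Dual ℂ H} {S : Set (b.support → ℕ)} {w : M}
    (hw : w ∈ weightSum M b lam S) (hμ : w ∈ weightSpace M μ) (h0 : w ≠ 0) :
    ∃ c ∈ S, μ = lowerWeight b lam c := by
  by_contra! hne
  have h1 : weightSum M b lam S ≤ ⨆ ν, ⨆ (_ : ν ≠ μ), weightSpace M ν :=
    iSup_le fun c => le_iSup₂_of_le _ (hne c.1 c.2).symm le_rfl
  exact h0 (by simpa using (iSupIndep_weightSpace H M μ).le_bot (Submodule.mem_inf.mpr ⟨hμ, h1 hw⟩))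

/-- A vector whose weight is raised by a simple root stays within the cone of weights. -/
theorem exists_eq_add_single [DecidableEq b.support] {lam : Dual ℂ H} {c : b.support → ℕ}
    {γ : b.support} {w : M} (hw : w ∈ weightSum M b lam Set.univ) (h0 : w ≠ 0)
    (hμ : w ∈ weightSpace M (lowerWeight b lam c + (rootSystem H).root γ.1)) :
    ∃ d, c = d + Pi.single γ 1 ∧ w ∈ weightSpace M (lowerWeight b lam d) := by
  obtain ⟨d, -, hd⟩ := exists_eq_lowerWeight hw hμ h0
  refine ⟨d, lowerWeight_injective lam ?_, hd ▸ hμ⟩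
  rw [lowerWeight_add, ← hd, lowerWeight_single, one_smul, add_neg_cancel_right]

include hx

/-- Every nontrivial monomial in the negative divided powers strictly lowers the weight, so the top
weight space of the generated submodule is at most a line. -/
theorem IsChevalleyBasis.exists_eq_smul_of_mem_weightSpace {lam : Dual ℂ H}
    (hlam : lam ∈ weightLattice H) {v : M} (hv : IsHighest b x lam v) {u : Env 𝔤}
    (hu : u • v ∈ weightSpace M lam) : ∃ a : ℂ, u • v = a • v := by
  have hv0 : v ∈ weightSum M b lam {0} :=
    mem_weightSum (Set.mem_singleton 0) (by rw [lowerWeight_zero]; exact hv.mem_weightSpace)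
  have h1 : orbit (simpleFormNeg b x) v ≤
      (Submodule.span ℂ {v} ⊔ weightSum M b lam {0}ᶜ).restrictScalars ℤ := by
    refine orbit_adjoin_le (Submodule.mem_sup_left (Submodule.mem_span_singleton_self v)) ?_
    rintro _ ⟨γ, hγ, n, rfl⟩ w hw
    cases n with
    | zero => simpa [divPow] using hw
    | succ n =>
      refine Submodule.mem_sup_right (hx.divPow_smul_mem_weightSum (S := Set.univ) (S' := {0}ᶜ) ⟨γ, hγ⟩
        (n + 1)
        (fun c _ h => ?_) ?_)
      · have := congrFun h ⟨γ, hγ⟩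
        simp at this
      · have h2 : Submodule.span ℂ {v} ⊔ weightSum M b lam {0}ᶜ ≤ weightSum M b lam Set.univ :=
          sup_le ((Submodule.span_singleton_le_iff_mem _ _).mpr
            (weightSum_mono lam (Set.subset_univ _) hv0)) (weightSum_mono lam (Set.subset_univ _))
        exact h2 hw
  have h2 := ((Submodule.span_le (R := ℂ)
    (p := Submodule.span ℂ {v} ⊔ weightSum M b lam {0}ᶜ)).mpr h1) (hx.smul_mem_span_orbit hlam hv u)
  obtain ⟨y, hy, z, hz, hyz⟩ := Submodule.mem_sup.mp h2
  obtain ⟨a, rfl⟩ := Submodule.mem_span_singleton.mp hy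
  refine ⟨a, ?_⟩
  have hz0 : z ∈ weightSum M b lam {0} := by
    rw [eq_sub_of_add_eq' hyz]
    exact Submodule.sub_mem _ (mem_weightSum (Set.mem_singleton 0)
      (by rw [lowerWeight_zero]; exact hu)) (Submodule.smul_mem _ a hv0)
  rw [← hyz, eq_zero_of_mem_weightSum disjoint_compl_right hz0 hz, add_zero]

/-- Induction on the height makes the image of `w` modulo `vermaKernel` a highest weight vector, as
raising it stays in the kernel of the homomorphism. If the image is nonzero, its weight is dominant,
since the negative simple root vectors act locally nilpotently on the quotient. The Casimir element
acts on it as on the generator, so its weight is `lam`. Then `w` is a multiple of the generator,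
which the homomorphism does not kill. -/
theorem IsChevalleyBasis.mem_vermaKernel_of_weight {lam : Dual ℂ H}
    (hlam : lam ∈ weightLattice H) {m : b.support → ℕ} (hm : ∀ γ, lam (coroot γ.1.1) = m γ) {v : M}
    (hv : IsHighest b x lam v) (hv0 : v ≠ 0) (c : b.support → ℕ)
    {w : Verma b x lam}
    (hw : w ∈ weightSpace (Verma b x lam) (lowerWeight b lam c)) (h0 : hx.vermaHom hv w = 0) :
    w ∈ vermaKernel b x lam := by
  classical
  induction hN : ∑ γ, c γ using Nat.strong_induction_on generalizing c w with
  | _ N ih =>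
  have hV := isHighest_vermaVector (b := b) (x := x) lam
  obtain ⟨u, rfl⟩ := exists_eq_smul_vermaVector lam w
  set q := (vermaKernel b x lam).mkQ with hq
  have hqv : IsHighest b x lam (q (vermaVector b x lam)) :=
    ⟨map_mem_weightSpace q hV.mem_weightSpace, fun γ hγ => by
      rw [← map_smul, hV.smul_eq_zero γ hγ, map_zero]⟩
  have hqw : IsHighest b x (lowerWeight b lam c) (q (u • vermaVector b x lam)) := by
    refine ⟨map_mem_weightSpace q hw, fun γ hγ => ?_⟩
    rw [← map_smul, hq, Submodule.mkQ_apply, Submodule.Quotient.mk_eq_zero]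
    by_cases he : toEnv (x γ) • u • vermaVector b x lam = 0
    · rw [he]
      exact Submodule.zero_mem _
    · obtain ⟨d, hd, hd'⟩ := exists_eq_add_single (γ := ⟨γ, hγ⟩)
        (by rw [← mul_smul]; exact hx.smul_mem_weightSum hlam hV _) he
        (toEnv_smul_mem_weightSpace (hx.lie_coe γ) hw)
      refine ih (∑ γ, d γ) ?_ d hd' ?_ rfl
      · rw [← hN, hd]
        simp [Finset.sum_add_distrib]
      · rw [map_smul, h0, smul_zero]
  by_cases hw0 : q (u • vermaVector b x lam) = 0
  · rwa [hq, Submodule.mkQ_apply, Submodule.Quotient.mk_eq_zero] at hw0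
  have hnat : ∀ γ : b.support, ∃ n : ℕ, lowerWeight b lam c (coroot γ.1.1) = n := fun γ => by
    obtain ⟨n, hn, -⟩ := hx.exists_nat_of_pow_smul_eq_zero hqw hw0 γ.2 (by
      rw [map_smul]
      refine exists_pow_smul_smul_eq_zero (hx.isNilpotent_ad (negRoot γ.1)) u _ ⟨m γ + 1, ?_⟩
      rw [← map_smul, hq, Submodule.mkQ_apply, Submodule.Quotient.mk_eq_zero]
      exact Submodule.subset_span ⟨γ.1, γ.2, m γ, hm γ, rfl⟩)
    exact ⟨n, hn⟩
  choose n hn using hnat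
  have hcas : casimirValue b x (lowerWeight b lam c) = casimirValue b x lam := by
    have h1 := hx.casimir_smul hqw
    have h2 : casimir x • q (u • vermaVector b x lam) =
        casimirValue b x lam • q (u • vermaVector b x lam) := by
      rw [map_smul, ← mul_smul, (hx.commute_casimir u).eq, mul_smul, hx.casimir_smul hqv, smul_comm]
    rw [h1, ← sub_eq_zero, ← sub_smul] at h2
    exact sub_eq_zero.mp ((smul_eq_zero.mp h2).resolve_right hw0)
  have hc := hx.eq_zero_of_casimirValue_eq hm hn hcas
  rw [hc, lowerWeight_zero] at hw
  obtain ⟨a, ha⟩ := hx.exists_eq_smul_of_mem_weightSpace hlam hV hw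
  rw [ha, ← algebraMap_smul (Env 𝔤) a, map_smul, hx.vermaHom_vermaVector, algebraMap_smul] at h0
  rw [ha, (smul_eq_zero.mp h0).resolve_right hv0, zero_smul]
  exact Submodule.zero_mem _

/-- The kernel of the homomorphism from the Verma module to a finite-dimensional module with a
maximal vector. -/
theorem IsChevalleyBasis.ker_vermaHom {L : Type*} [AddCommGroup L] [Module ℂ L]
    [LieRingModule 𝔤 L] [LieModule ℂ 𝔤 L] [FiniteDimensional ℂ L] {lam : Dual ℂ H}
    (hlam : lam ∈ weightLattice H) {m : b.support → ℕ} (hm : ∀ γ, lam (coroot γ.1.1) = m γ) {v : L}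
    (hv : IsHighest b x lam (EnvModule.of 𝔤 v)) (hv0 : v ≠ 0) :
    LinearMap.ker (hx.vermaHom hv) = vermaKernel b x lam := by
  have hle : vermaKernel b x lam ≤ LinearMap.ker (hx.vermaHom hv) := by
    rw [vermaKernel, Submodule.span_le]
    rintro _ ⟨γ, hγ, n, hn, rfl⟩
    rw [SetLike.mem_coe, LinearMap.mem_ker, map_smul, hx.vermaHom_vermaVector]
    exact hx.pow_smul_eq_zero hv hv0 ⟨γ, hγ⟩ hn
  refine le_antisymm (fun w hw => ?_) hle
  have hwt : w ∈ weightSum (Verma b x lam) b lam Set.univ := by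
    obtain ⟨u, rfl⟩ := exists_eq_smul_vermaVector lam w
    exact hx.smul_mem_weightSum hlam (isHighest_vermaVector lam) u
  have h1 := mem_of_forall_weight_mem (hx.vermaHom hv)
    (N := (vermaKernel b x lam).restrictScalars ℂ) (fun c w hw h0 =>
      hx.mem_vermaKernel_of_weight hlam hm hv (by simpa using hv0) c hw h0) hwt hw
  exact h1

end KernelEq

/-! ### Truncating submodules -/

section Truncating

variable {M : Type*} [AddCommGroup M] [Module ℂ M] [Module (Env 𝔤) M] [IsScalarTower ℂ (Env 𝔤) M]
  {M' : Type*} [AddCommGroup M'] [Module ℂ M'] [Module (Env 𝔤) M'] [IsScalarTower ℂ (Env 𝔤) M']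
variable {b : (rootSystem H).Base} {x : H.root → 𝔤} (hx : IsChevalleyBasis x)

theorem exists_root_eq_sum_height {α : H.root} (hα : b.IsPos α) :
    ∃ a : b.support → ℕ, (rootSystem H).root α = ∑ γ, a γ • (rootSystem H).root γ.1 ∧
      (b.height α).toNat = ∑ γ, a γ := by
  classical
  suffices h : ∃ a : b.support → ℕ, (rootSystem H).root α = ∑ γ, a γ • (rootSystem H).root γ.1 ∧
      b.height α = ((∑ γ, a γ : ℕ) : ℤ) by
    obtain ⟨a, h, h'⟩ := h
    exact ⟨a, h, by rw [h', Int.toNat_natCast]⟩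
  refine hα.induction_on_add (p := fun α => ∃ a : b.support → ℕ,
    (rootSystem H).root α = ∑ γ, a γ • (rootSystem H).root γ.1 ∧
      b.height α = ((∑ γ, a γ : ℕ) : ℤ)) (fun i hi => ⟨Pi.single ⟨i, hi⟩ 1, ?_, ?_⟩) ?_
  · rw [Finset.sum_eq_single ⟨i, hi⟩ _ (by simp), Pi.single_eq_same, one_smul]
    intro d _ hd
    rw [Pi.single_eq_of_ne hd, zero_smul]
  · rw [b.height_one_of_mem_support hi]
    simp
  · rintro i j k hk ⟨a, ha, ha'⟩ hj
    refine ⟨a + Pi.single ⟨j, hj⟩ 1, ?_, ?_⟩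
    · simp only [Pi.add_apply, add_smul, Finset.sum_add_distrib]
      rw [hk, ha, Finset.sum_eq_single (a := ⟨j, hj⟩) (f := fun γ : b.support =>
        (Pi.single ⟨j, hj⟩ 1 : b.support → ℕ) γ • (rootSystem H).root γ.1) _ (by simp),
        Pi.single_eq_same, one_smul]
      intro d _ hd
      rw [Pi.single_eq_of_ne hd, zero_smul]
    · rw [b.height_add hk, ha', b.height_one_of_mem_support hj]
      simp [Finset.sum_add_distrib]

theorem lowerWeight_add_smul {lam : Dual ℂ H} {α : H.root} {a : b.support → ℕ}
    (ha : (rootSystem H).root α = ∑ γ, a γ • (rootSystem H).root γ.1) (c : b.support → ℕ) (n : ℕ) :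
    lowerWeight b lam (c + n • a) = lowerWeight b lam c + n • -(rootSystem H).root α := by
  rw [lowerWeight_add, lowerWeight, ha, ← sub_neg_eq_add, smul_neg, neg_neg, Finset.smul_sum]
  simp only [Pi.smul_apply, smul_eq_mul, mul_smul]

variable (b) in
-- The form used for all membership proofs: any exponent at least `r` minus the height is good
-- enough.
theorem mem_truncating {p r k : ℕ} {lam : Dual ℂ H} {N : Submodule ℤ M} {c : b.support → ℕ} {z : M}
    (hz : z ∈ N) (hc : z ∈ weightSpace M (lowerWeight b lam c)) (hk : r ≤ k + ∑ γ, c γ) :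
    ((p : ℤ) ^ k) • z ∈ truncating b p r lam N := by
  refine Submodule.mem_iSup_of_mem c ?_
  obtain ⟨j, hj⟩ := Nat.exists_eq_add_of_le (show r - ∑ γ, c γ ≤ k by omega)
  rw [hj, pow_add, mul_smul]
  refine Submodule.smul_mem_pointwise_smul _ _ _ ?_
  exact Submodule.smul_mem _ _ ⟨hz, hc⟩

theorem truncating_le_of {p r : ℕ} {lam : Dual ℂ H} {N P : Submodule ℤ M}
    (h : ∀ c : b.support → ℕ, ∀ z ∈ N, z ∈ weightSpace M (lowerWeight b lam c) →
      ((p : ℤ) ^ (r - ∑ γ, c γ)) • z ∈ P) : truncating b p r lam N ≤ P := by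
  refine iSup_le fun c w hw => ?_
  obtain ⟨z, hz, rfl⟩ := (Submodule.mem_smul_pointwise_iff_exists _ _ _).mp hw
  exact h c z hz.1 hz.2

theorem truncating_le (p r : ℕ) (lam : Dual ℂ H) (N : Submodule ℤ M) :
    truncating b p r lam N ≤ N :=
  truncating_le_of fun _ _ hz _ => N.smul_mem _ hz

theorem map_mem_truncating {p r : ℕ} {lam lam' : Dual ℂ H} {N : Submodule ℤ M}
    {N' : Submodule ℤ M'} (f : M →ₗ[ℤ] M') (hf : ∀ w ∈ N, f w ∈ N')
    (hf' : ∀ c : b.support → ℕ, ∀ w ∈ N, w ∈ weightSpace M (lowerWeight b lam c) →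
      f w ∈ weightSpace M' (lowerWeight b lam' c)) {w : M} (hw : w ∈ truncating b p r lam N) :
    f w ∈ truncating b p r lam' N' := by
  have h1 : truncating b p r lam N ≤ (truncating b p r lam' N').comap f :=
    truncating_le_of fun c z hz hc => by
      rw [Submodule.mem_comap, map_smul]
      exact mem_truncating b (hf z hz) (hf' c z hz hc) (by omega)
  exact h1 hw

theorem zsmul_smul_comm (k : ℤ) (u : Env 𝔤) (w : M) : u • k • w = k • u • w :=
  map_zsmul (smulHom M u) k w

include hx

theorem IsChevalleyBasis.pow_smul_mem_truncating {p r : ℕ} {lam : Dual ℂ H} {v : M}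
    (hv : v ∈ weightSpace M lam) {w : M} (hw : w ∈ orbit (simpleFormNeg b x) v) :
    ((p : ℤ) ^ r) • w ∈ truncating b p r lam (orbit (simpleFormNeg b x) v) := by
  have h1 : (⨆ c : b.support → ℕ, (orbit (simpleFormNeg b x) v ⊓
      (weightSpace M (lowerWeight b lam c)).restrictScalars ℤ)) ≤
      (truncating b p r lam (orbit (simpleFormNeg b x) v)).comap
        (LinearMap.lsmul ℤ M ((p : ℤ) ^ r)) :=
    iSup_le fun c w hw => mem_truncating b hw.1 hw.2 (by omega)
  exact h1 (hx.orbit_le_iSup hv hw)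

omit hx in
theorem divPow_mem_kostantForm (x : H.root → 𝔤) (α : H.root) (n : ℕ) :
    divPow (x α) n ∈ kostantForm x := Algebra.subset_adjoin ⟨α, n, rfl⟩

omit hx in
theorem iwahoriAlgebra_le (p : ℕ) : iwahoriAlgebra b x p ≤ kostantForm x := by
  refine Algebra.adjoin_le ?_
  rintro _ (⟨α, n, -, rfl⟩ | ⟨α, m, -, rfl⟩)
  · exact divPow_mem_kostantForm x _ n
  · exact Subalgebra.smul_mem _ (divPow_mem_kostantForm x α m) _

omit hx in
theorem isStable_orbit (p : ℕ) (v : M) :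
    IsStable (iwahoriAlgebra b x p) (orbit (kostantForm x) v) :=
  fun _ hu _ hw => smul_mem_orbit (iwahoriAlgebra_le p hu) hw

/-- Lowering by `n α` increases the height, so fewer factors `p` are required. Raising decreases it
by `n ht α`, exactly what the factor `p ^ (n ht α)` of the generator makes up for; a vector raised
out of the cone below `lam` is zero. -/
theorem IsChevalleyBasis.isStable_truncating {p r : ℕ} {lam : Dual ℂ H}
    (hlam : lam ∈ weightLattice H) {v : M} (hv : IsHighest b x lam v) :
    IsStable (iwahoriAlgebra b x p) (truncating b p r lam (orbit (kostantForm x) v)) := by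
  set N := orbit (kostantForm x) v with hN
  have hwt : ∀ w ∈ N, w ∈ weightSum M b lam Set.univ := fun w hw => by
    rw [hN, hx.orbit_kostantForm_eq hlam hv] at hw
    exact hx.orbit_le_weightSum hv.mem_weightSpace hw
  intro u hu
  refine smul_mem_of_adjoin ?_ hu
  rintro _ (⟨α, n, hα, rfl⟩ | ⟨α, n, hα, rfl⟩)
  · suffices h : truncating b p r lam N ≤ (truncating b p r lam N).comap
      (smulHom M (divPow (x (negRoot α)) n)) from h
    refine truncating_le_of fun c z hz hc => ?_
    obtain ⟨a, ha, -⟩ := exists_root_eq_sum_height hα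
    rw [Submodule.mem_comap, map_smul]
    refine mem_truncating b (c := c + n • a) (smul_mem_orbit (divPow_mem_kostantForm x _ n) hz) ?_ ?_
    · rw [lowerWeight_add_smul ha]
      exact divPow_smul_mem_weightSpace (hx.lie_coe_neg α) hc n
    · simp only [Pi.add_apply, Finset.sum_add_distrib]
      omega
  · suffices h : truncating b p r lam N ≤ (truncating b p r lam N).comap
      (smulHom M (((p : ℤ) ^ (n * (b.height α).toNat)) • divPow (x α) n)) from h
    refine truncating_le_of fun c z hz hc => ?_
    obtain ⟨a, ha, ha'⟩ := exists_root_eq_sum_height hα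
    rw [Submodule.mem_comap, map_smul, smulHom_apply, smul_assoc, ← mul_smul, ← pow_add]
    have hz' : divPow (x α) n • z ∈ N := smul_mem_orbit (divPow_mem_kostantForm x _ n) hz
    have hc' := divPow_smul_mem_weightSpace (hx.lie_coe α) hc n
    by_cases h0 : divPow (x α) n • z = 0
    · rw [h0, smul_zero]
      exact Submodule.zero_mem _
    · obtain ⟨d, -, hd⟩ := exists_eq_lowerWeight (hwt _ hz') hc' h0
      have hcd : c = d + n • a := by
        apply lowerWeight_injective lam
        rw [lowerWeight_add_smul ha, ← hd, smul_neg, add_neg_cancel_right]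
      rw [hd] at hc'
      refine mem_truncating b hz' hc' ?_
      rw [hcd, ha']
      simp only [Pi.add_apply, Pi.smul_apply, smul_eq_mul, Finset.sum_add_distrib,
        ← Finset.mul_sum]
      omega

end Truncating

/-! ### Isomorphisms of subquotients -/

section Quotients

variable {M M' M'' : Type*} [AddCommGroup M] [Module (Env 𝔤) M] [AddCommGroup M']
  [Module (Env 𝔤) M'] [AddCommGroup M''] [Module (Env 𝔤) M'']
  {A : Subalgebra ℤ (Env 𝔤)} {N K : Submodule ℤ M} {N' K' : Submodule ℤ M'}
  {N'' K'' : Submodule ℤ M''}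

theorem QuotientsIsomorphic.symm (h : QuotientsIsomorphic A N K N' K') :
    QuotientsIsomorphic A N' K' N K := by
  obtain ⟨h1, h2, hN, hK, hN', hK', ⟨e⟩⟩ := h
  exact ⟨h2, h1, hN', hK', hN, hK, ⟨e.symm⟩⟩

theorem QuotientsIsomorphic.trans (h : QuotientsIsomorphic A N K N' K')
    (h' : QuotientsIsomorphic A N' K' N'' K'') : QuotientsIsomorphic A N K N'' K'' := by
  obtain ⟨h1, h2, hN, hK, hN', hK', ⟨e⟩⟩ := h
  obtain ⟨_, h3, _, _, hN'', hK'', ⟨e'⟩⟩ := h'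
  exact ⟨h1, h3, hN, hK, hN'', hK'', ⟨e.trans e'⟩⟩

/-- A homomorphism of abelian groups that is compatible with the action of generators of `A` up to
elements of `K'` induces an isomorphism of quotients. -/
theorem quotientsIsomorphic_of_map {S : Set (Env 𝔤)} (hKN : K ≤ N) (hKN' : K' ≤ N')
    (hN : IsStable (Algebra.adjoin ℤ S) N) (hK : IsStable (Algebra.adjoin ℤ S) K)
    (hN' : IsStable (Algebra.adjoin ℤ S) N') (hK' : IsStable (Algebra.adjoin ℤ S) K')
    (f : M →ₗ[ℤ] M') (hf : ∀ w ∈ N, f w ∈ N') (hsurj : ∀ w' ∈ N', ∃ w ∈ N, f w = w')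
    (hker : ∀ w ∈ N, f w ∈ K' ↔ w ∈ K) (hcomm : ∀ u ∈ S, ∀ w ∈ N, f (u • w) - u • f w ∈ K') :
    QuotientsIsomorphic (Algebra.adjoin ℤ S) N K N' K' := by
  have hcomm' : ∀ u ∈ Algebra.adjoin ℤ S, ∀ w ∈ N, f (u • w) - u • f w ∈ K' := by
    intro u hu
    induction hu using Algebra.adjoin_induction with
    | mem u hu => exact hcomm u hu
    | algebraMap n =>
      intro w _
      rw [algebraMap_smul, algebraMap_smul, map_smul, sub_self]
      exact K'.zero_mem
    | add u u' _ _ h h' =>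
      intro w hw
      rw [add_smul, add_smul, map_add, add_sub_add_comm]
      exact K'.add_mem (h w hw) (h' w hw)
    | mul u u' hu hu' h h' =>
      intro w hw
      -- The defect of a product is the defect of `u` at `u' • w` plus `u` times the defect of `u'`
      -- at `w`, and `K'` is stable.
      have h1 := K'.add_mem (h _ (hN u' hu' w hw)) (hK' u hu _ (h' w hw))
      rw [smul_sub, sub_add_sub_cancel] at h1
      rwa [mul_smul, mul_smul]
  let g : hN.toSubmodule →ₗ[Algebra.adjoin ℤ S] Subquotient hN' hK' :=
    { toFun := fun w => Submodule.Quotient.mk ⟨f w.1, hf w.1 w.2⟩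
      map_add' := fun w w' => by
        rw [← Submodule.Quotient.mk_add]
        congr 1
        exact Subtype.ext (map_add f w.1 w'.1)
      map_smul' := fun u w => by
        rw [RingHom.id_apply, ← Submodule.Quotient.mk_smul, Submodule.Quotient.eq]
        exact hcomm' u.1 u.2 w.1 w.2 }
  have hg : Function.Surjective g := by
    intro z
    obtain ⟨⟨w', hw'⟩, rfl⟩ := Submodule.Quotient.mk_surjective _ z
    obtain ⟨w, hw, rfl⟩ := hsurj w' hw'
    exact ⟨⟨w, hw⟩, rfl⟩
  have hgker : hK.toSubmodule.submoduleOf hN.toSubmodule = LinearMap.ker g := by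
    ext w
    rw [LinearMap.mem_ker]
    change _ ↔ Submodule.Quotient.mk _ = _
    rw [Submodule.Quotient.mk_eq_zero]
    exact (hker w.1 w.2).symm
  exact ⟨hKN, hKN', hN, hK, hN', hK', ⟨(Submodule.quotEquivOfEq _ _ hgker).trans
    (g.quotKerEquivOfSurjective hg)⟩⟩

end Quotients

/-! ### Comparison of Verma modules -/

section Comparison

variable {b : (rootSystem H).Base} {x : H.root → 𝔤} {lam lam' : Dual ℂ H}

/-- The linear map between two Verma modules that is compatible with the generators and with the
negative root vectors. -/
def IsComparison (f : Verma b x lam →ₗ[ℂ] Verma b x lam') : Prop :=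
  ∀ u ∈ negAlgebra b x, f (u • vermaVector b x lam) = u • vermaVector b x lam'

theorem IsChevalleyBasis.exists_mem_negAlgebra (hx : IsChevalleyBasis x)
    (hlam : lam ∈ weightLattice H) (w : Verma b x lam) :
    ∃ u ∈ negAlgebra b x, w = u • vermaVector b x lam := by
  obtain ⟨u, rfl⟩ := exists_eq_smul_vermaVector lam w
  have h1 : Submodule.span ℂ (orbit (simpleFormNeg b x) (vermaVector b x lam) :
      Set (Verma b x lam)) ≤ (Subalgebra.toSubmodule (negAlgebra b x)).map
        ((LinearMap.toSpanSingleton (Env 𝔤) _ (vermaVector b x lam)).restrictScalars ℂ) := by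
    rw [Submodule.span_le]
    rintro _ ⟨u, hu, rfl⟩
    exact ⟨u, simpleFormNeg_le_negAlgebra hu, rfl⟩
  obtain ⟨u', hu', h⟩ := h1 (hx.smul_mem_span_orbit hlam (isHighest_vermaVector lam) u)
  exact ⟨u', hu', h.symm⟩

/-- Every vector is the image of the generator under the negative algebra, so the inclusion of
annihilators is precisely well-definedness. -/
theorem IsChevalleyBasis.exists_isComparison (hx : IsChevalleyBasis x)
    (hlam : lam ∈ weightLattice H)
    (h : ∀ u ∈ negAlgebra b x, u • vermaVector b x lam = 0 → u • vermaVector b x lam' = 0) :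
    ∃ f : Verma b x lam →ₗ[ℂ] Verma b x lam', IsComparison f := by
  let g (μ : Dual ℂ H) : Subalgebra.toSubmodule (negAlgebra b x) →ₗ[ℂ] Verma b x μ :=
    ((LinearMap.toSpanSingleton (Env 𝔤) _ (vermaVector b x μ)).restrictScalars ℂ) ∘ₗ
      Submodule.subtype _
  have hg : Function.Surjective (g lam) := fun w => by
    obtain ⟨u, hu, rfl⟩ := hx.exists_mem_negAlgebra hlam w
    exact ⟨⟨u, hu⟩, rfl⟩
  have hker : LinearMap.ker (g lam) ≤ LinearMap.ker (g lam') := fun u hu =>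
    LinearMap.mem_ker.mpr (h u.1 u.2 (LinearMap.mem_ker.mp hu))
  refine ⟨(LinearMap.ker (g lam)).liftQ (g lam') hker ∘ₗ
    ((g lam).quotKerEquivOfSurjective hg).symm.toLinearMap, fun u hu => ?_⟩
  have h1 : ((g lam).quotKerEquivOfSurjective hg).symm (u • vermaVector b x lam) =
      Submodule.Quotient.mk ⟨u, hu⟩ := by
    rw [LinearEquiv.symm_apply_eq]
    rfl
  rw [LinearMap.comp_apply, LinearEquiv.coe_coe, h1]
  rfl

variable {f : Verma b x lam →ₗ[ℂ] Verma b x lam'} (hf : IsComparison f)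
include hf

theorem IsComparison.map_vermaVector : f (vermaVector b x lam) = vermaVector b x lam' := by
  have := hf 1 (one_mem _)
  rwa [one_smul, one_smul] at this

theorem IsComparison.map_smul (hx : IsChevalleyBasis x) (hlam : lam ∈ weightLattice H) {u : Env 𝔤}
    (hu : u ∈ negAlgebra b x) (w : Verma b x lam) : f (u • w) = u • f w := by
  obtain ⟨u', hu', rfl⟩ := hx.exists_mem_negAlgebra hlam w
  rw [hf u' hu', ← mul_smul, hf _ (mul_mem hu hu'), mul_smul]

theorem IsComparison.leftInverse (hx : IsChevalleyBasis x) (hlam : lam ∈ weightLattice H)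
    {g : Verma b x lam' →ₗ[ℂ] Verma b x lam} (hg : IsComparison g) (w : Verma b x lam) :
    g (f w) = w := by
  obtain ⟨u, hu, rfl⟩ := hx.exists_mem_negAlgebra hlam w
  rw [hf u hu, hg u hu]

theorem IsComparison.map_mem_orbit {w : Verma b x lam}
    (hw : w ∈ orbit (simpleFormNeg b x) (vermaVector b x lam)) :
    f w ∈ orbit (simpleFormNeg b x) (vermaVector b x lam') := by
  obtain ⟨u, hu, rfl⟩ := hw
  exact ⟨u, hu, hf u (simpleFormNeg_le_negAlgebra hu)⟩

theorem IsComparison.exists_map_eq {w' : Verma b x lam'}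
    (hw' : w' ∈ orbit (simpleFormNeg b x) (vermaVector b x lam')) :
    ∃ w ∈ orbit (simpleFormNeg b x) (vermaVector b x lam), f w = w' := by
  obtain ⟨u, hu, rfl⟩ := hw'
  exact ⟨_, ⟨u, hu, rfl⟩, hf u (simpleFormNeg_le_negAlgebra hu)⟩

open Classical in
theorem IsComparison.map_mem_weightSpace (hx : IsChevalleyBasis x) (hlam : lam ∈ weightLattice H)
    {c : b.support → ℕ} {w : Verma b x lam}
    (hw : w ∈ orbit (simpleFormNeg b x) (vermaVector b x lam))
    (hc : w ∈ weightSpace _ (lowerWeight b lam c)) : f w ∈ weightSpace _ (lowerWeight b lam' c) := by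
  let P : (b.support → ℕ) → Submodule ℤ (Verma b x lam) := fun c =>
    (weightSpace (Verma b x lam) (lowerWeight b lam c) ⊓
      (weightSpace (Verma b x lam') (lowerWeight b lam' c)).comap f).restrictScalars ℤ
  have hP : ∀ {c w}, w ∈ P c ↔ w ∈ weightSpace (Verma b x lam) (lowerWeight b lam c) ∧
      f w ∈ weightSpace (Verma b x lam') (lowerWeight b lam' c) := fun {c w} => Iff.rfl
  have h1 : w ∈ ⨆ c, P c := by
    refine orbit_simpleFormNeg_le_iSup (hP.mpr ⟨?_, ?_⟩) (fun c w hw γ n => ?_) hw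
    · rw [lowerWeight_zero]
      exact (isHighest_vermaVector lam).mem_weightSpace
    · rw [lowerWeight_zero, hf.map_vermaVector]
      exact (isHighest_vermaVector lam').mem_weightSpace
    · obtain ⟨hw, hw'⟩ := hP.mp hw
      refine hP.mpr ⟨hx.divPow_smul_mem_lowerWeight γ n hw, ?_⟩
      rw [hf.map_smul hx hlam (divPow_mem (toEnv_mem_negAlgebra γ.2) n)]
      exact hx.divPow_smul_mem_lowerWeight γ n hw'
  exact (hP.mp (mem_of_mem_iSup_of_mem_weightSpace (fun c w hw => (hP.mp hw).1) h1 hc)).2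

omit hf in
theorem smul_mem_zsmul_orbit {M : Type*} [AddCommGroup M] [Module ℂ M] [Module (Env 𝔤) M]
    [IsScalarTower ℂ (Env 𝔤) M] {v z : M} {k : ℤ}
    {u : Env 𝔤} (hu : u ∈ kostantForm x) (hz : z ∈ k • orbit (kostantForm x) v) :
    u • z ∈ k • orbit (kostantForm x) v := by
  obtain ⟨y, hy, rfl⟩ := (Submodule.mem_smul_pointwise_iff_exists _ _ _).mp hz
  rw [zsmul_smul_comm]
  exact Submodule.smul_mem_pointwise_smul _ _ _ (smul_mem_orbit hu hy)

omit hf in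
/-- The elements of the Kostant form that correspond to elements of `chevalleyLattice`. -/
theorem IsChevalleyBasis.toEnv_mem_kostantForm (hx : IsChevalleyBasis x) {y : 𝔤}
    (hy : y ∈ chevalleyLattice x) : toEnv y ∈ kostantForm x := by
  have h1 : ∀ α, toEnv (x α) ∈ kostantForm x := fun α => by
    simpa [divPow] using divPow_mem_kostantForm x α 1
  have h2 : chevalleyLattice x ≤ (Subalgebra.toSubmodule (kostantForm x)).comap
      ((toEnvHom 𝔤).restrictScalars ℤ) := by
    rw [chevalleyLattice, Submodule.span_le]
    rintro _ (⟨α, rfl⟩ | ⟨α, rfl⟩)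
    · exact h1 α
    · change toEnv (coroot α.1 : 𝔤) ∈ kostantForm x
      rw [← hx.lie_neg α, toEnv_lie]
      exact sub_mem (mul_mem (h1 _) (h1 _)) (mul_mem (h1 _) (h1 _))
  exact h2 hy

/-- If `lam` and `lam'` are congruent modulo `k`, then the comparison map between the Verma modules
is compatible with the action of `𝔤` modulo `k`. -/
theorem IsComparison.map_toEnv_smul_sub_mem (hx : IsChevalleyBasis x) (hlam : lam ∈ weightLattice H)
    {k : ℕ} {ν : Dual ℂ H} (hν : ν ∈ weightLattice H)
    (hk : lam - lam' = k • ν) {y : 𝔤} (hy : y ∈ chevalleyLattice x) {w : Verma b x lam}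
    (hw : w ∈ orbit (simpleFormNeg b x) (vermaVector b x lam)) :
    f (toEnv y • w) - toEnv y • f w ∈ (k : ℤ) • orbit (kostantForm x) (vermaVector b x lam') := by
  set K := (k : ℤ) • orbit (kostantForm x) (vermaVector b x lam') with hK
  let δ (u : Env 𝔤) : Verma b x lam →ₗ[ℤ] Verma b x lam' :=
    (f.restrictScalars ℤ) ∘ₗ smulHom _ u - smulHom _ u ∘ₗ f.restrictScalars ℤ
  have hδ : ∀ u w, δ u w = f (u • w) - u • f w := fun u w => rfl
  -- All `y` in the Chevalley lattice are treated at once, because passing a divided power replaces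
  -- `y` by divided powers of the adjoint action on `y`.
  let Q : Submodule ℤ (Verma b x lam) := ⨅ y : chevalleyLattice x, K.comap (δ (toEnv y.1))
  have hQ : ∀ {w}, w ∈ Q ↔ ∀ y ∈ chevalleyLattice x, f (toEnv y • w) - toEnv y • f w ∈ K := by
    intro w
    simp only [Q, Submodule.mem_iInf, Submodule.mem_comap, hδ, Subtype.forall]
  suffices h : orbit (simpleFormNeg b x) (vermaVector b x lam) ≤ Q from hQ.mp (h hw) y hy
  refine orbit_adjoin_le (hQ.mpr ?_) ?_
  · let δ' : 𝔤 →ₗ[ℤ] Verma b x lam' :=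
      { toFun := fun y => f (toEnv y • vermaVector b x lam) - toEnv y • f (vermaVector b x lam)
        map_add' := fun y z => by
          rw [toEnv, toEnv, toEnv, map_add, add_smul, add_smul, map_add, add_sub_add_comm]
        map_smul' := fun c y => by
          rw [toEnv, toEnv, map_zsmul, smul_assoc, smul_assoc, map_zsmul, smul_sub]
          rfl }
    suffices h : chevalleyLattice x ≤ K.comap δ' from fun y hy => h hy
    rw [chevalleyLattice, Submodule.span_le]
    -- On the generator, positive root vectors give zero on both sides and negative ones commute
    -- with `f`; only the coroots see the difference of the weights, which is divisible by `k`.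
    have hroot : ∀ α, δ' (x α) = 0 := fun α => by
      change f _ - _ = 0
      rw [sub_eq_zero]
      rcases em (b.IsPos α) with hα | hα
      · rw [hx.smul_eq_zero_of_isPos (isHighest_vermaVector lam) hα, hf.map_vermaVector,
          hx.smul_eq_zero_of_isPos (isHighest_vermaVector lam') hα, map_zero]
      · rw [← isPos_negRoot_iff] at hα
        have := hx.neg_mem_negAlgebra hα
        rw [negRoot_negRoot] at this
        exact hf.map_smul hx hlam this _
    rintro _ (⟨α, rfl⟩ | ⟨α, rfl⟩)
    · rw [SetLike.mem_coe, Submodule.mem_comap, hroot]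
      exact K.zero_mem
    · obtain ⟨n, hn⟩ := hν α
      change f _ - _ ∈ K
      rw [(isHighest_vermaVector lam).mem_weightSpace, hf.map_vermaVector,
        (isHighest_vermaVector lam').mem_weightSpace, _root_.map_smul, hf.map_vermaVector, ← sub_smul,
        ← LinearMap.sub_apply, hk, LinearMap.smul_apply, hn, smul_assoc, ← natCast_zsmul,
        Int.cast_smul_eq_zsmul]
      exact Submodule.smul_mem_pointwise_smul _ _ _ (Submodule.smul_mem _ _ (self_mem_orbit _ _))
  · rintro _ ⟨γ, hγ, n, rfl⟩ w hw
    refine hQ.mpr fun y hy => ?_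
    have hd : ∀ i, divPow (x (negRoot γ)) i ∈ negAlgebra b x :=
      divPow_mem (toEnv_mem_negAlgebra hγ)
    have hcomm : ∀ {μ : Dual ℂ H} (z : Verma b x μ),
        toEnv y • divPow (x (negRoot γ)) n • z =
          ∑ ij ∈ Finset.HasAntidiagonal.antidiagonal n,
            divPow (x (negRoot γ)) ij.1 • toEnv (dadLie (-x (negRoot γ)) ij.2 y) • z := by
      intro μ z
      rw [← mul_smul, divPow_eq_dpow, mul_dpow_eq_sum, Finset.sum_smul]
      refine Finset.sum_congr rfl fun ij _ => ?_
      rw [mul_smul, toEnv_dadLie, divPow_eq_dpow]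
      congr 3
      exact (map_neg (toEnvHom 𝔤) _).symm
    rw [hcomm, hf.map_smul hx hlam (hd n), hcomm, map_sum, ← Finset.sum_sub_distrib]
    refine K.sum_mem fun ij _ => ?_
    rw [hf.map_smul hx hlam (hd _), ← smul_sub]
    exact smul_mem_zsmul_orbit (divPow_mem_kostantForm x _ _)
      (hQ.mp hw _ (hx.dadLie_neg_mem _ _ hy))

theorem IsComparison.map_toEnv_pow_smul_sub_mem (hx : IsChevalleyBasis x)
    (hlam : lam ∈ weightLattice H) {k : ℕ} {ν : Dual ℂ H} (hν : ν ∈ weightLattice H)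
    (hk : lam - lam' = k • ν) {y : 𝔤} (hy : y ∈ chevalleyLattice x) (m : ℕ) {w : Verma b x lam}
    (hw : w ∈ orbit (simpleFormNeg b x) (vermaVector b x lam)) :
    f (toEnv y ^ m • w) - toEnv y ^ m • f w ∈
      (k : ℤ) • orbit (kostantForm x) (vermaVector b x lam') := by
  have hy' := hx.toEnv_mem_kostantForm hy
  induction m with
  | zero => simp
  | succ m ih =>
    have h1 : toEnv y ^ m • w ∈ orbit (simpleFormNeg b x) (vermaVector b x lam) := by
      rw [← hx.orbit_kostantForm_eq hlam (isHighest_vermaVector lam)] at hw ⊢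
      exact smul_mem_orbit (pow_mem hy' m) hw
    have h2 := add_mem (hf.map_toEnv_smul_sub_mem hx hlam hν hk hy h1) (smul_mem_zsmul_orbit hy' ih)
    rwa [smul_sub, sub_add_sub_cancel, ← mul_smul, ← mul_smul, ← pow_succ'] at h2

end Comparison

/-! ### Division by factorials -/

/-- Legendre's formula gives `(p - 1) v_p(m!) ≤ m ≤ r`, and `r / (p - 1) + r = p r / (p - 1)`. This
is the source of the exponent in the congruence. -/
theorem padicValNat_factorial_add_le {p : ℕ} (hp : p.Prime) {m r : ℕ} (h : m ≤ r) :
    padicValNat p (m !) + r ≤ ⌈(p : ℚ) / ((p : ℚ) - 1) * r⌉₊ := by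
  have := Fact.mk hp
  have h1 : (p - 1) * padicValNat p (m !) ≤ r := by
    rw [sub_one_mul_padicValNat_factorial]
    omega
  have h2 : (1 : ℚ) < p := by exact_mod_cast hp.one_lt
  have h3 : ((p : ℚ) - 1) * padicValNat p (m !) ≤ r := by
    have := (Nat.cast_le (α := ℚ)).mpr h1
    rwa [Nat.cast_mul, Nat.cast_sub hp.one_lt.le, Nat.cast_one] at this
  have h4 : (padicValNat p (m !) + r : ℚ) ≤ p / ((p : ℚ) - 1) * r := by
    rw [div_mul_eq_mul_div, le_div_iff₀ (by linarith)]
    linarith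
  exact_mod_cast h4.trans (Nat.le_ceil _)

/-- The `p`-part of `m!` is cancelled, which is allowed in a complex vector space and leaves at
least `p ^ r` by the previous estimate; the part prime to `p` is removed by Bézout, which uses that
`z` lies in `N`. -/
theorem mem_pow_smul_of_factorial_smul_mem {M : Type*} [AddCommGroup M] [Module ℂ M] {p : ℕ}
    (hp : p.Prime) {m r : ℕ} (h : m ≤ r) {N : Submodule ℤ M} {z : M} (hz : z ∈ N)
    (hz' : (m ! : ℤ) • z ∈ ((p ^ ⌈(p : ℚ) / ((p : ℚ) - 1) * r⌉₊ : ℕ) : ℤ) • N) :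
    z ∈ ((p : ℤ) ^ r) • N := by
  have := Fact.mk hp
  obtain ⟨q, hq⟩ := pow_padicValNat_dvd (p := p) (n := m !)
  have hpq : p.Coprime q := by
    rw [Nat.Prime.coprime_iff_not_dvd hp]
    intro h
    refine pow_succ_padicValNat_not_dvd (p := p) (Nat.factorial_ne_zero m) ?_
    rw [pow_succ]
    conv_rhs => rw [hq]
    exact Nat.mul_dvd_mul_left _ h
  obtain ⟨y, hy, hyz⟩ := (Submodule.mem_smul_pointwise_iff_exists _ _ _).mp hz'
  obtain ⟨j, hj⟩ := Nat.exists_eq_add_of_le (padicValNat_factorial_add_le hp h)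
  have h1 : (q : ℤ) • z = ((p : ℤ) ^ r) • ((p : ℤ) ^ j) • y := by
    have h2 : ((p : ℤ) ^ padicValNat p (m !)) ≠ 0 := pow_ne_zero _ (by exact_mod_cast hp.ne_zero)
    refine smul_right_injective M (Int.cast_ne_zero (α := ℂ).mpr h2) ?_
    change _ • _ = _ • _
    rw [Int.cast_smul_eq_zsmul, Int.cast_smul_eq_zsmul]
    rw [← mul_smul, ← mul_smul, ← mul_smul, ← pow_add, ← pow_add, ← Nat.cast_pow, ← Nat.cast_mul,
      ← hq, ← hyz, hj, Nat.cast_pow]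
  obtain ⟨s, t, hst⟩ := (Nat.isCoprime_iff_coprime.mpr (hpq.pow_left r))
  rw [Nat.cast_pow] at hst
  have h2 : z = ((p : ℤ) ^ r) • (s • z + (t * (p : ℤ) ^ j) • y) := by
    calc z = (s * (p : ℤ) ^ r + t * q) • z := by rw [hst, one_smul]
      _ = _ := by
        rw [add_smul, mul_smul t, h1, smul_add, ← mul_smul, ← mul_smul, ← mul_smul, ← mul_smul]
        congr 2 <;> ring
  rw [h2]
  exact Submodule.smul_mem_pointwise_smul _ _ _
    (add_mem (Submodule.smul_mem _ _ hz) (Submodule.smul_mem _ _ hy))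

/-! ### Truncations of Verma modules -/

section Verma

variable {b : (rootSystem H).Base} {x : H.root → 𝔤}

theorem IsStable.sup {M : Type*} [AddCommGroup M] [Module (Env 𝔤) M] {A : Subalgebra ℤ (Env 𝔤)}
    {N K : Submodule ℤ M} (hN : IsStable A N) (hK : IsStable A K) : IsStable A (N ⊔ K) := by
  intro u hu w hw
  obtain ⟨y, hy, z, hz, rfl⟩ := Submodule.mem_sup.mp hw
  rw [smul_add]
  exact Submodule.add_mem_sup (hN u hu y hy) (hK u hu z hz)

theorem isStable_vermaKernelLattice (p : ℕ) (lam : Dual ℂ H) :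
    IsStable (iwahoriAlgebra b x p) (vermaKernelLattice b x lam) := fun u hu w hw =>
  ⟨(vermaKernel b x lam).smul_mem u hw.1, isStable_orbit p _ u hu w hw.2⟩

variable (b x) in
/-- The submodule by which the integral Verma module is truncated. -/
def vermaTruncating (p r : ℕ) (lam : Dual ℂ H) : Submodule ℤ (Verma b x lam) :=
  vermaKernelLattice b x lam ⊔ truncating b p r lam (vermaLattice b x lam)

theorem vermaTruncating_le (p r : ℕ) (lam : Dual ℂ H) :
    vermaTruncating b x p r lam ≤ vermaLattice b x lam :=
  sup_le inf_le_right (truncating_le p r lam _)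

variable (hx : IsChevalleyBasis x)
include hx

theorem IsChevalleyBasis.isStable_vermaTruncating (p r : ℕ) {lam : Dual ℂ H}
    (hlam : lam ∈ weightLattice H) :
    IsStable (iwahoriAlgebra b x p) (vermaTruncating b x p r lam) :=
  (isStable_vermaKernelLattice p lam).sup
    (hx.isStable_truncating hlam (isHighest_vermaVector lam))

theorem IsChevalleyBasis.vermaLattice_eq {lam : Dual ℂ H} (hlam : lam ∈ weightLattice H) :
    vermaLattice b x lam = orbit (simpleFormNeg b x) (vermaVector b x lam) :=
  hx.orbit_kostantForm_eq hlam (isHighest_vermaVector lam)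

/-- The sum of the weight spaces of relative height greater than `r` is stable under the negative
root vectors. -/
theorem IsChevalleyBasis.orbit_le_weightSum_lt {M : Type*} [AddCommGroup M] [Module ℂ M]
    [Module (Env 𝔤) M] [IsScalarTower ℂ (Env 𝔤) M] {lam : Dual ℂ H} {r : ℕ} {v : M}
    (hv : v ∈ weightSum M b lam {c | r < ∑ γ, c γ}) :
    orbit (simpleFormNeg b x) v ≤ (weightSum M b lam {c | r < ∑ γ, c γ}).restrictScalars ℤ := by
  classical
  refine orbit_adjoin_le hv ?_
  rintro _ ⟨γ, hγ, n, rfl⟩ w hw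
  refine hx.divPow_smul_mem_weightSum ⟨γ, hγ⟩ n (fun c hc => ?_) hw
  simp only [Set.mem_ofPred_eq, Pi.add_apply, Finset.sum_add_distrib] at hc ⊢
  omega

variable {lam lam' : Dual ℂ H} (hlam : lam ∈ weightLattice H) (hlam' : lam' ∈ weightLattice H)
  {f : Verma b x lam →ₗ[ℂ] Verma b x lam'} (hf : IsComparison f)
include hlam hf

/-- Outside `T` a generator goes to the generator with the same exponent. For `γ ∈ T` its image has
height `m γ + 1 > r`, and lowering it further keeps it there. -/
theorem IsComparison.map_mem_sup_weightSum {r : ℕ} {T : Set H.root} {m m' : b.support → ℕ}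
    (hm : ∀ α : b.support, lam (coroot α.1.1) = m α)
    (hm' : ∀ α : b.support, lam' (coroot α.1.1) = m' α)
    (h_eq : ∀ α : b.support, α.1 ∉ T → m α = m' α) (h_gt : ∀ α : b.support, α.1 ∈ T → r < m α)
    {w : Verma b x lam} (hw : w ∈ vermaKernel b x lam) :
    f w ∈ (vermaKernel b x lam').restrictScalars ℂ ⊔
      weightSum (Verma b x lam') b lam' {c | r < ∑ γ, c γ} := by
  classical
  set P := (vermaKernel b x lam').restrictScalars ℂ ⊔
      weightSum (Verma b x lam') b lam' {c | r < ∑ γ, c γ} with hP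
  refine Submodule.closure_induction (p := fun w _ => f w ∈ P) ?_ ?_ ?_ hw
  · rw [map_zero]
    exact P.zero_mem
  · intro y z _ _ hy hz
    rw [map_add]
    exact P.add_mem hy hz
  · rintro u _ ⟨γ, hγ, n, hn, rfl⟩
    have hnm : n = m ⟨γ, hγ⟩ := by
      have := hm ⟨γ, hγ⟩
      rw [hn] at this
      exact_mod_cast this
    have hw : IsHighest b x _ (toEnv (x (negRoot γ)) ^ (n + 1) • vermaVector b x lam) :=
      hx.isHighest_pow_smul (isHighest_vermaVector lam) ⟨γ, hγ⟩ hn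
    have hwt : lam + (n + 1) • -(rootSystem H).root γ ∈ weightLattice H :=
      add_mem hlam (nsmul_mem (neg_mem (root_mem_weightLattice γ)) _)
    -- The generator is itself a highest weight vector of integral weight, so the submodule it
    -- generates is spanned by its images under negative elements, with which `f` commutes.
    suffices h : Submodule.span ℂ (orbit (simpleFormNeg b x)
        (toEnv (x (negRoot γ)) ^ (n + 1) • vermaVector b x lam) : Set (Verma b x lam)) ≤ P.comap f
      from h (hx.smul_mem_span_orbit hwt hw u)
    rw [Submodule.span_le]
    rintro _ ⟨u, hu, rfl⟩
    rw [SetLike.mem_coe, Submodule.mem_comap, ← mul_smul,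
      hf _ (mul_mem (simpleFormNeg_le_negAlgebra hu) (pow_mem (toEnv_mem_negAlgebra hγ) _)),
      mul_smul]
    by_cases hT : γ ∈ T
    · refine Submodule.mem_sup_right (hx.orbit_le_weightSum_lt ?_ ⟨u, hu, rfl⟩)
      refine mem_weightSum (c := Pi.single ⟨γ, hγ⟩ (n + 1)) ?_ ?_
      · have := h_gt ⟨γ, hγ⟩ hT
        simp only [Set.mem_ofPred_eq, Finset.sum_pi_single', Finset.mem_univ, if_true]
        omega
      · rw [lowerWeight_single]
        exact toEnv_pow_smul_mem_weightSpace (hx.lie_coe_neg γ)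
          (isHighest_vermaVector lam').mem_weightSpace (n + 1)
    · refine Submodule.mem_sup_left ((vermaKernel b x lam').smul_mem u (Submodule.subset_span ?_))
      exact ⟨γ, hγ, n, by rw [hm' ⟨γ, hγ⟩, hnm, h_eq ⟨γ, hγ⟩ hT], rfl⟩

include hlam'

theorem IsComparison.map_mem_vermaTruncating {p r : ℕ} {T : Set H.root} {m m' : b.support → ℕ}
    (hm : ∀ α : b.support, lam (coroot α.1.1) = m α)
    (hm' : ∀ α : b.support, lam' (coroot α.1.1) = m' α)
    (h_eq : ∀ α : b.support, α.1 ∉ T → m α = m' α) (h_gt : ∀ α : b.support, α.1 ∈ T → r < m α)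
    {w : Verma b x lam} (hw : w ∈ vermaTruncating b x p r lam) :
    f w ∈ vermaTruncating b x p r lam' := by
  have hN : ∀ {w}, w ∈ vermaLattice b x lam → f w ∈ vermaLattice b x lam' := fun hw => by
    rw [hx.vermaLattice_eq hlam] at hw
    rw [hx.vermaLattice_eq hlam']
    exact hf.map_mem_orbit hw
  obtain ⟨y, hy, z, hz, rfl⟩ := Submodule.mem_sup.mp hw
  rw [map_add]
  refine add_mem ?_ (Submodule.mem_sup_right (map_mem_truncating (f.restrictScalars ℤ)
    (fun w hw => hN hw) (fun c w hw hc => hf.map_mem_weightSpace hx hlam ?_ hc) hz))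
  swap
  · rwa [hx.vermaLattice_eq hlam] at hw
  -- Integrality has to be recovered, since the decomposition just mentioned is only complex. The
  -- image `f y` is split integrally into a part `a` of height at most `r` and a part `d` above.
  -- Modulo `vermaKernel`, `a` agrees with a vector of height above `r`, so it is zero there and
  -- belongs to the kernel lattice.
  have h1 : (⨆ c : b.support → ℕ, (orbit (simpleFormNeg b x) (vermaVector b x lam') ⊓
      (weightSpace _ (lowerWeight b lam' c)).restrictScalars ℤ)) ≤
      (vermaLattice b x lam' ⊓
        (weightSum _ b lam' {c | r < ∑ γ, c γ}ᶜ).restrictScalars ℤ) ⊔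
      (truncating b p r lam' (vermaLattice b x lam') ⊓
        (weightSum _ b lam' {c | r < ∑ γ, c γ}).restrictScalars ℤ) := by
    refine iSup_le fun c w hw => ?_
    rw [← hx.vermaLattice_eq hlam'] at hw
    by_cases hc : r < ∑ γ, c γ
    · refine Submodule.mem_sup_right ⟨?_, mem_weightSum hc hw.2⟩
      have := mem_truncating b (p := p) (r := r) (k := 0) hw.1 hw.2 (by omega)
      rwa [pow_zero, one_smul] at this
    · exact Submodule.mem_sup_left ⟨hw.1, mem_weightSum hc hw.2⟩
  have h2 := hN hy.2
  rw [hx.vermaLattice_eq hlam'] at h2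
  obtain ⟨a, ha, d, hd, had⟩ := Submodule.mem_sup.mp
    (h1 (hx.orbit_le_iSup (isHighest_vermaVector lam').mem_weightSpace h2))
  obtain ⟨u, hu, e, he, hue⟩ := Submodule.mem_sup.mp
    (hf.map_mem_sup_weightSum hx hlam hm hm' h_eq h_gt hy.1)
  rw [← had]
  refine Submodule.add_mem_sup ⟨?_, ha.1⟩ hd.1
  have h3 : (vermaKernel b x lam').mkQ a = (vermaKernel b x lam').mkQ (e - d) := by
    rw [← sub_eq_zero, ← map_sub, Submodule.mkQ_apply, Submodule.Quotient.mk_eq_zero]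
    have h4 : a - (e - d) = u := by
      rw [eq_sub_of_add_eq had, eq_sub_of_add_eq hue]
      abel
    rw [h4]
    exact hu
  have h5 : (vermaKernel b x lam').mkQ a = 0 := by
    refine eq_zero_of_mem_weightSum disjoint_compl_left (map_mem_weightSum _ ha.2) ?_
    rw [h3]
    exact map_mem_weightSum _ (sub_mem he hd.2)
  rwa [Submodule.mkQ_apply, Submodule.Quotient.mk_eq_zero] at h5

theorem IsComparison.map_smul_sub_mem_truncating {p r : ℕ} (hp : p.Prime) {ν : Dual ℂ H}
    (hν : ν ∈ weightLattice H) (hk : lam - lam' = p ^ ⌈(p : ℚ) / ((p : ℚ) - 1) * r⌉₊ • ν)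
    {u : Env 𝔤} (hu : (∃ (α : H.root) (n : ℕ), b.IsPos α ∧ u = divPow (x (negRoot α)) n) ∨
      ∃ (α : H.root) (m : ℕ), b.IsPos α ∧
        u = ((p : ℤ) ^ (m * (b.height α).toNat)) • divPow (x α) m)
    {w : Verma b x lam} (hw : w ∈ vermaLattice b x lam) :
    f (u • w) - u • f w ∈ truncating b p r lam' (vermaLattice b x lam') := by
  have hw' := hw
  rw [hx.vermaLattice_eq hlam] at hw'
  have hT : ∀ z ∈ vermaLattice b x lam',
      ((p : ℤ) ^ r) • z ∈ truncating b p r lam' (vermaLattice b x lam') := fun z hz => by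
    rw [hx.vermaLattice_eq hlam'] at hz ⊢
    exact hx.pow_smul_mem_truncating (isHighest_vermaVector lam').mem_weightSpace hz
  have hfN : ∀ {w}, w ∈ vermaLattice b x lam → f w ∈ vermaLattice b x lam' := fun hw => by
    rw [hx.vermaLattice_eq hlam] at hw
    rw [hx.vermaLattice_eq hlam']
    exact hf.map_mem_orbit hw
  rcases hu with ⟨α, n, hα, rfl⟩ | ⟨α, m, hα, rfl⟩
  · rw [hf.map_smul hx hlam (divPow_mem (hx.neg_mem_negAlgebra hα) n), sub_self]
    exact Submodule.zero_mem _
  · have hz : f (divPow (x α) m • w) - divPow (x α) m • f w ∈ vermaLattice b x lam' :=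
      sub_mem (hfN (smul_mem_orbit (divPow_mem_kostantForm x α m) hw))
        (smul_mem_orbit (divPow_mem_kostantForm x α m) (hfN hw))
    rw [smul_assoc, smul_assoc, map_zsmul, ← smul_sub]
    -- For `m ≤ r` the congruence of the weights survives division by `m!` as divisibility by `p ^
    -- r`; for `m > r` the factor `p ^ (m ht α)` is divisible by `p ^ r` since `ht α ≥ 1`.
    rcases le_or_gt m r with hmr | hmr
    · refine Submodule.smul_mem _ _ ?_
      have h1 := hf.map_toEnv_pow_smul_sub_mem hx hlam hν hk (mem_chevalleyLattice x α) m hw'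
      have h2 : toEnv (x α) ^ m = (m ! : ℤ) • divPow (x α) m := by
        rw [divPow_eq_dpow, ← factorial_smul_dpow, ← Int.cast_smul_eq_zsmul ℂ, Int.cast_natCast]
      rw [h2, smul_assoc, smul_assoc, map_zsmul, ← smul_sub] at h1
      obtain ⟨y, hy, hyz⟩ := (Submodule.mem_smul_pointwise_iff_exists _ _ _).mp
        (mem_pow_smul_of_factorial_smul_mem hp hmr hz h1)
      rw [← hyz]
      exact hT y hy
    · have hht : 1 ≤ (b.height α).toNat := by
        have := b.isPos_iff.mp hα
        omega
      obtain ⟨j, hj⟩ := Nat.exists_eq_add_of_le (hmr.le.trans (Nat.le_mul_of_pos_right m hht))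
      rw [hj, pow_add, mul_smul]
      exact hT _ (Submodule.smul_mem _ _ hz)

omit hf in
theorem IsComparison.quotientsIsomorphic {p r : ℕ} (hp : p.Prime) {T : Set H.root}
    {m m' : b.support → ℕ}
    (hm : ∀ α : b.support, lam (coroot α.1.1) = m α)
    (hm' : ∀ α : b.support, lam' (coroot α.1.1) = m' α)
    (h_eq : ∀ α : b.support, α.1 ∉ T → m α = m' α)
    (h_gt : ∀ α : b.support, α.1 ∈ T → r < m α ∧ r < m' α) {ν : Dual ℂ H}
    (hν : ν ∈ weightLattice H) (hk : lam - lam' = p ^ ⌈(p : ℚ) / ((p : ℚ) - 1) * r⌉₊ • ν)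
    (hf : IsComparison f) {g : Verma b x lam' →ₗ[ℂ] Verma b x lam} (hg : IsComparison g) :
    QuotientsIsomorphic (iwahoriAlgebra b x p)
      (vermaLattice b x lam) (vermaTruncating b x p r lam)
      (vermaLattice b x lam') (vermaTruncating b x p r lam') := by
  refine quotientsIsomorphic_of_map (vermaTruncating_le p r lam) (vermaTruncating_le p r lam')
    (isStable_orbit p _) (hx.isStable_vermaTruncating p r hlam) (isStable_orbit p _)
    (hx.isStable_vermaTruncating p r hlam') (f.restrictScalars ℤ) ?_ ?_ ?_ ?_
  · rw [hx.vermaLattice_eq hlam, hx.vermaLattice_eq hlam']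
    exact fun w hw => hf.map_mem_orbit hw
  · rw [hx.vermaLattice_eq hlam, hx.vermaLattice_eq hlam']
    exact fun w hw => hf.exists_map_eq hw
  · refine fun w _ => ⟨fun h => ?_, fun h =>
      hf.map_mem_vermaTruncating hx hlam hlam' hm hm' h_eq (fun α hα => (h_gt α hα).1) h⟩
    -- The converse inclusion is the same statement for the inverse comparison map.
    have := hg.map_mem_vermaTruncating hx hlam' hlam hm' hm (fun α hα => (h_eq α hα).symm)
      (fun α hα => (h_gt α hα).2) h
    rwa [LinearMap.restrictScalars_apply, hf.leftInverse hx hlam hg] at this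
  · exact fun u hu w hw => Submodule.mem_sup_right
      (hf.map_smul_sub_mem_truncating hx hlam hlam' hp hν hk hu hw)

end Verma

/-! ### Truncations of irreducible representations -/

section Irreducible

variable {b : (rootSystem H).Base} {x : H.root → 𝔤} (hx : IsChevalleyBasis x) {lam : Dual ℂ H}
  {L : Type*} [AddCommGroup L] [Module ℂ L] [LieRingModule 𝔤 L] [LieModule ℂ 𝔤 L]
include hx

open Classical in
-- An integral weight vector lifts to an integral vector of the same weight, because the monomials
-- that build it can be applied to the generator of the Verma module instead. Truncating submodules
-- hence map onto truncating submodules.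
theorem IsChevalleyBasis.exists_vermaHom_eq (hlam : lam ∈ weightLattice H) {M : Type*}
    [AddCommGroup M] [Module ℂ M] [Module (Env 𝔤) M] [IsScalarTower ℂ (Env 𝔤) M] {v : M}
    (hv : IsHighest b x lam v) {c : b.support → ℕ} {z : M} (hz : z ∈ orbit (kostantForm x) v)
    (hc : z ∈ weightSpace M (lowerWeight b lam c)) :
    ∃ w ∈ vermaLattice b x lam, w ∈ weightSpace _ (lowerWeight b lam c) ∧
      hx.vermaHom hv w = z := by
  let P : (b.support → ℕ) → Submodule ℤ M := fun c =>
    (vermaLattice b x lam ⊓ (weightSpace _ (lowerWeight b lam c)).restrictScalars ℤ).map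
      ((hx.vermaHom hv).restrictScalars ℤ)
  rw [hx.orbit_kostantForm_eq hlam hv] at hz
  have h1 : z ∈ ⨆ c, P c := by
    have h0 : v ∈ P 0 := by
      refine ⟨vermaVector b x lam, ⟨self_mem_orbit _ _, ?_⟩, hx.vermaHom_vermaVector hv⟩
      change _ ∈ weightSpace _ _
      rw [lowerWeight_zero]
      exact (isHighest_vermaVector lam).mem_weightSpace
    refine orbit_simpleFormNeg_le_iSup h0 ?_ hz
    rintro c _ ⟨w, ⟨hw, hw'⟩, rfl⟩ γ n
    exact ⟨_, ⟨smul_mem_orbit (divPow_mem_kostantForm x _ n) hw,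
        hx.divPow_smul_mem_lowerWeight γ n hw'⟩, map_smul (hx.vermaHom hv) _ w⟩
  have hP : ∀ c, P c ≤ (weightSpace M (lowerWeight b lam c)).restrictScalars ℤ := by
    rintro c _ ⟨w, ⟨-, hw⟩, rfl⟩
    exact map_mem_weightSpace (hx.vermaHom hv) hw
  obtain ⟨w, hw, rfl⟩ := mem_of_mem_iSup_of_mem_weightSpace hP h1 hc
  exact ⟨w, hw.1, hw.2, rfl⟩

theorem IsChevalleyBasis.quotientsIsomorphic_irrLattice [FiniteDimensional ℂ L] (p r : ℕ)
    (hlam : lam ∈ weightLattice H) {m : b.support → ℕ}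
    (hm : ∀ α : b.support, lam (coroot α.1.1) = m α) {v : L}
    (hv : IsMaximalVector b lam (EnvModule.of 𝔤 v)) :
    QuotientsIsomorphic (iwahoriAlgebra b x p)
      (vermaLattice b x lam) (vermaTruncating b x p r lam)
      (irrLattice b x v) (truncating b p r lam (irrLattice b x v)) := by
  have hv' : IsHighest b x lam (EnvModule.of 𝔤 v) := hv.isHighest hx
  have hv0 : v ≠ 0 := fun h => hv.ne_zero (by rw [h, map_zero])
  have hL : irrLattice b x v = orbit (kostantForm x) (EnvModule.of 𝔤 v) :=
    (hx.orbit_kostantFormNeg_eq hlam hv').trans (hx.orbit_kostantForm_eq hlam hv').symm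
  rw [hL]
  set g := hx.vermaHom hv' with hg
  have hgv : g (vermaVector b x lam) = EnvModule.of 𝔤 v := hx.vermaHom_vermaVector hv'
  have hgN : ∀ w ∈ vermaLattice b x lam, g w ∈ orbit (kostantForm x) (EnvModule.of 𝔤 v) := by
    rintro _ ⟨u, hu, rfl⟩
    exact ⟨u, hu, by rw [map_smul, hgv]⟩
  have hgT : ∀ w ∈ truncating b p r lam (vermaLattice b x lam),
      g w ∈ truncating b p r lam (orbit (kostantForm x) (EnvModule.of 𝔤 v)) := fun w hw =>
    map_mem_truncating (g.restrictScalars ℤ) hgN (fun c w _ hc => map_mem_weightSpace g hc) hw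
  have hker : ∀ w, g w = 0 ↔ w ∈ vermaKernel b x lam := fun w => by
    rw [← LinearMap.mem_ker, hg, hx.ker_vermaHom hlam hm hv' hv0]
  refine quotientsIsomorphic_of_map (vermaTruncating_le p r lam) (truncating_le p r lam _)
    (isStable_orbit p _) (hx.isStable_vermaTruncating p r hlam) (isStable_orbit p _)
    (hx.isStable_truncating hlam hv') (g.restrictScalars ℤ) hgN ?_ ?_ ?_
  · rintro _ ⟨u, hu, rfl⟩
    exact ⟨u • vermaVector b x lam, ⟨u, hu, rfl⟩, by
      rw [LinearMap.restrictScalars_apply, map_smul, hgv]⟩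
  · intro w hw
    rw [LinearMap.restrictScalars_apply]
    constructor
    · intro h
      have h1 : truncating b p r lam (orbit (kostantForm x) (EnvModule.of 𝔤 v)) ≤
          (truncating b p r lam (vermaLattice b x lam)).map (g.restrictScalars ℤ) :=
        truncating_le_of fun c z hz hc => by
          obtain ⟨w, hw, hwc, rfl⟩ := hx.exists_vermaHom_eq hlam hv' hz hc
          exact ⟨_, mem_truncating b hw hwc (by omega), map_zsmul g _ w⟩
      obtain ⟨t, ht, htw⟩ := h1 h
      rw [LinearMap.restrictScalars_apply] at htw
      -- Two integral vectors with the same image differ by an element of the kernel, which is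
      -- `vermaKernel`, and the difference is integral.
      rw [← sub_add_cancel w t]
      refine Submodule.add_mem_sup ⟨?_, sub_mem hw (truncating_le p r lam _ ht)⟩ ht
      exact (hker _).mp (by rw [map_sub, htw, sub_self])
    · intro h
      obtain ⟨y, hy, z, hz, rfl⟩ := Submodule.mem_sup.mp h
      rw [map_add, (hker y).mpr hy.1, zero_add]
      exact hgT z hz
  · intro u _ w _
    rw [LinearMap.restrictScalars_apply, LinearMap.restrictScalars_apply, map_smul, sub_self]
    exact Submodule.zero_mem _

end Irreducible

end Truncation

end

/-! ### The proposition. -/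

theorem mainTheorem4
    {𝔤 : Type*} [LieRing 𝔤] [LieAlgebra ℂ 𝔤] [FiniteDimensional ℂ 𝔤] [LieAlgebra.IsSemisimple ℂ 𝔤]
    (H : LieSubalgebra ℂ 𝔤) [H.IsCartanSubalgebra]
    (b : (LieAlgebra.IsKilling.rootSystem H).Base)
    (x : H.root → 𝔤) (hx : Truncation.IsChevalleyBasis x)
    (p : ℕ) (hp : p.Prime) (r : ℕ) (T : Set H.root) (hT : T ⊆ b.support)
    (lam lam' : Module.Dual ℂ H)
    (hlam : lam ∈ Truncation.weightLattice H) (hlam' : lam' ∈ Truncation.weightLattice H)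
    -- the values on the simple coroots; that they are natural numbers is dominance
    (m m' : b.support → ℕ)
    (hm : ∀ α : b.support, lam (LieAlgebra.IsKilling.coroot α.1.1) = m α)
    (hm' : ∀ α : b.support, lam' (LieAlgebra.IsKilling.coroot α.1.1) = m' α)
    (h_eq : ∀ α : b.support, α.1 ∉ T → m α = m' α)
    (h_gt : ∀ α : b.support, α.1 ∈ T → r < m α ∧ r < m' α)
    (h_congr : ∃ ν ∈ Truncation.weightLattice H,
      lam - lam' = p ^ ⌈(p : ℚ) / ((p : ℚ) - 1) * r⌉₊ • ν)
    -- the irreducible representations of highest weights `lam` and `lam'`, with maximal vectors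
    {L : Type*} [AddCommGroup L] [Module ℂ L] [LieRingModule 𝔤 L] [LieModule ℂ 𝔤 L]
    [FiniteDimensional ℂ L] [LieModule.IsIrreducible ℂ 𝔤 L]
    (v : L) (hv : Truncation.IsMaximalVector b lam (Truncation.EnvModule.of 𝔤 v))
    {L' : Type*} [AddCommGroup L'] [Module ℂ L'] [LieRingModule 𝔤 L'] [LieModule ℂ 𝔤 L']
    [FiniteDimensional ℂ L'] [LieModule.IsIrreducible ℂ 𝔤 L']
    (v' : L') (hv' : Truncation.IsMaximalVector b lam' (Truncation.EnvModule.of 𝔤 v')) :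
    -- the truncations of the irreducible representations
    Truncation.QuotientsIsomorphic (Truncation.iwahoriAlgebra b x p)
      (Truncation.irrLattice b x v) (Truncation.truncating b p r lam (Truncation.irrLattice b x v))
      (Truncation.irrLattice b x v')
      (Truncation.truncating b p r lam' (Truncation.irrLattice b x v')) ∧
    -- the truncations of the Verma modules
    Truncation.QuotientsIsomorphic (Truncation.iwahoriAlgebra b x p)
      (Truncation.vermaLattice b x lam)
      (Truncation.vermaKernelLattice b x lam ⊔
        Truncation.truncating b p r lam (Truncation.vermaLattice b x lam))
      (Truncation.vermaLattice b x lam')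
      (Truncation.vermaKernelLattice b x lam' ⊔
        Truncation.truncating b p r lam' (Truncation.vermaLattice b x lam')) := by
  have hvh := hv.isHighest hx
  have hvh' := hv'.isHighest hx
  have hv0 : v ≠ 0 := fun h => hv.ne_zero (by rw [h, map_zero])
  have hv0' : v' ≠ 0 := fun h => hv'.ne_zero (by rw [h, map_zero])
  -- The maximal vectors of both representations are needed in each direction, because the equality
  -- of annihilators rests on modules with nonzero highest weight vectors.
  obtain ⟨f, hf⟩ := hx.exists_isComparison hlam fun u hu h =>
    hx.smul_vermaVector_eq_zero hlam hlam' hvh hv0 hvh' hv0' hu h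
  obtain ⟨g, hg⟩ := hx.exists_isComparison hlam' fun u hu h =>
    hx.smul_vermaVector_eq_zero hlam' hlam hvh' hv0' hvh hv0 hu h
  obtain ⟨ν, hν, hk⟩ := h_congr
  have hV := Truncation.IsComparison.quotientsIsomorphic hx hlam hlam' hp hm hm' h_eq h_gt hν hk
    hf hg
  exact ⟨(hx.quotientsIsomorphic_irrLattice p r hlam hm hv).symm.trans
    (hV.trans (hx.quotientsIsomorphic_irrLattice p r hlam' hm' hv')), hV⟩
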